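/- Let $\mathbb K=\mathbb R$ or $\mathbb K=\mathbb C$. Let $M$ be a $\mathbb K$-analytic manifold of $\mathbb K$-dimension $2n$ with a $\mathbb K$-analytic symplectic form $\omega$ (a closed, non-degenerate $2$-form), and let $\{\,,\}$ be the associated Poisson bracket. A \emph{lagrangian subvariety} of $M$ is a reduced analytic subspace $L\subset M$ of dimension $n$, i.e. a subset that near every point of $M$ is the common zero set of finitely many analytic functions, whose ideal sheaf $\mathcal I$ of all analytic functions vanishing on $L$ is involutive: $\{\mathcal I,\mathcal I\}\subset\mathcal I$. For $p\in L$ let $\mathcal O_{L,p}=\mathcal O_{M,p}/\mathcal I_p$ with maximal ideal $\mathbf m_p$, let $\mathrm{edim}(p)=\dim_{\mathbb K}(\mathbf m_p/\mathbf m_p^2)$, and put $S^L_k=\{p\in L \mid \mathrm{edim}(p)=2n-k\}$. Let $L\subset M$ be a lagrangian subvariety and let $p\in S^L_k$ with $k>0$. Then there are a point $p'$ of $\mathbb K^{2n-2}$ (with the standard symplectic form $\sum_{i=1}^{n-1}dx_i\wedge dy_i$), an open neighbourhood $U'$ of $p'$, and a lagrangian subvariety $L'$ of $U'$ containing $p'$,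 such that the germ $(L,p)$ is isomorphic, as a germ of reduced analytic spaces, to the product $$(L',p')\times(\mathbb K,0),$$ and such that $p'\in S^{L'}_{k-1}$, i.e. the embedding dimension of $L'$ at $p'$ is $(2n-2)-(k-1)$. -/

import Mathlib

open scoped Manifold ContDiff Topology

noncomputable section

namespace LagrangianGerm

section Symplectic

variable (𝕜 : Type*) [RCLike 𝕜]
  {E : Type*} [NormedAddCommGroup E] [NormedSpace 𝕜 E]
  {M : Type*} [TopologicalSpace M] [ChartedSpace E M]

/-- The coordinate expression, in the preferred chart around `x₀`, of a field `η` of alternating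
2-forms on the tangent spaces of `M` (the pullback of `η` under the inverse of the chart). -/
def localForm (η : (x : M) → TangentSpace 𝓘(𝕜, E) x [⋀^Fin 2]→L[𝕜] 𝕜) (x₀ : M) :
    E → E [⋀^Fin 2]→L[𝕜] 𝕜 := fun y =>
  (η ((extChartAt 𝓘(𝕜, E) x₀).symm y)).compContinuousLinearMap
    (mfderiv 𝓘(𝕜, E) 𝓘(𝕜, E) (extChartAt 𝓘(𝕜, E) x₀).symm y)

variable (E M) in
/-- An analytic (holomorphic if `𝕜 = ℂ`) symplectic form on the manifold `M`: a closed,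
non-degenerate analytic 2-form. -/
structure SymplecticForm where
  /-- the underlying field of alternating forms -/
  form : (x : M) → TangentSpace 𝓘(𝕜, E) x [⋀^Fin 2]→L[𝕜] 𝕜
  analytic : ∀ x₀ : M, AnalyticOnNhd 𝕜 (localForm 𝕜 form x₀) (extChartAt 𝓘(𝕜, E) x₀).target
  closed : ∀ x₀ : M, ∀ y ∈ (extChartAt 𝓘(𝕜, E) x₀).target, extDeriv (localForm 𝕜 form x₀) y = 0
  nondegenerate : ∀ (x : M) (v : TangentSpace 𝓘(𝕜, E) x), (∀ w, form x ![v, w] = 0) → v = 0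

variable {𝕜}

namespace SymplecticForm

variable (Ω : SymplecticForm 𝕜 E M)

/-- The symplectic form at `x` as a bilinear form on the tangent space. -/
def bilin (x : M) : LinearMap.BilinForm 𝕜 (TangentSpace 𝓘(𝕜, E) x) :=
  LinearMap.mk₂ 𝕜 (fun v w => Ω.form x ![v, w])
    (fun v v' w => by
      have e (u : TangentSpace 𝓘(𝕜, E) x) : Function.update ![v, w] 0 u = ![u, w] := by
        funext i; fin_cases i <;> rfl
      simpa only [e] using (Ω.form x).map_update_add ![v, w] 0 v v')
    (fun c v w => by
      have e (u : TangentSpace 𝓘(𝕜, E) x) : Function.update ![v, w] 0 u = ![u, w] := by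
        funext i; fin_cases i <;> rfl
      simpa only [e] using (Ω.form x).map_update_smul ![v, w] 0 c v)
    (fun v w w' => by
      have e (u : TangentSpace 𝓘(𝕜, E) x) : Function.update ![v, w] 1 u = ![v, u] := by
        funext i; fin_cases i <;> rfl
      simpa only [e] using (Ω.form x).map_update_add ![v, w] 1 w w')
    (fun c v w => by
      have e (u : TangentSpace 𝓘(𝕜, E) x) : Function.update ![v, w] 1 u = ![v, u] := by
        funext i; fin_cases i <;> rfl
      simpa only [e] using (Ω.form x).map_update_smul ![v, w] 1 c w)

theorem form_swap (x : M) (v w : TangentSpace 𝓘(𝕜, E) x) :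
    Ω.form x ![v, w] = -Ω.form x ![w, v] := by
  have h := (Ω.form x).toAlternatingMap.map_swap ![w, v] (i := 0) (j := 1) (by decide)
  have e : (![w, v] ∘ Equiv.swap (0 : Fin 2) 1) = ![v, w] := by
    funext i; fin_cases i <;> simp
  rw [e] at h
  simpa using h

theorem bilin_nondegenerate (x : M) : (Ω.bilin x).Nondegenerate :=
  ⟨fun v hv => Ω.nondegenerate x v hv, fun v hv => Ω.nondegenerate x v fun w => by
    rw [Ω.form_swap]
    exact neg_eq_zero.mpr (hv w)⟩

variable [FiniteDimensional 𝕜 E]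

/-- The hamiltonian vector `H_f(x)`, determined by `Ω (H_f(x), w) = df_x (w)` for all `w`. -/
def hamiltonian (f : M → 𝕜) (x : M) : TangentSpace 𝓘(𝕜, E) x :=
  haveI : FiniteDimensional 𝕜 (TangentSpace 𝓘(𝕜, E) x) := inferInstanceAs (FiniteDimensional 𝕜 E)
  ((Ω.bilin x).toDual (Ω.bilin_nondegenerate x)).symm
    (mfderiv 𝓘(𝕜, E) 𝓘(𝕜, 𝕜) f x).toLinearMap

/-- The Poisson bracket `{f, g} = Ω (H_f, H_g)`. -/
def poisson (f g : M → 𝕜) (x : M) : 𝕜 :=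
  Ω.form x ![Ω.hamiltonian f x, Ω.hamiltonian g x]

end SymplecticForm

end Symplectic

section Subvarieties

variable (𝕜 : Type*) [RCLike 𝕜]
  (E : Type*) [NormedAddCommGroup E] [NormedSpace 𝕜 E]
  {M : Type*} [TopologicalSpace M] [ChartedSpace E M]

/-- `L` is an analytic subset of the open set `U`: around each point of `U` it is the common zero
set of finitely many analytic functions. -/
def IsAnalyticSubset (U L : Set M) : Prop :=
  L ⊆ U ∧ ∀ x ∈ U, ∃ V : Set M, IsOpen V ∧ x ∈ V ∧ V ⊆ U ∧
    ∃ (N : ℕ) (f : Fin N → M → 𝕜),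
      (∀ i, ContMDiffOn 𝓘(𝕜, E) 𝓘(𝕜, 𝕜) ω (f i) V) ∧
      ∀ y ∈ V, (y ∈ L ↔ ∀ i, f i y = 0)

/-- `L` contains a `d`-dimensional analytic submanifold of `M`, given by a parametrization near
the origin of `𝕜^d`. -/
def ContainsSubmanifold (L : Set M) (d : ℕ) : Prop :=
  ∃ φ : (Fin d → 𝕜) → M,
    ContMDiffAt 𝓘(𝕜, Fin d → 𝕜) 𝓘(𝕜, E) ω φ 0 ∧
    Function.Injective (mfderiv 𝓘(𝕜, Fin d → 𝕜) 𝓘(𝕜, E) φ 0) ∧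
    ∀ᶠ t in 𝓝 0, φ t ∈ L

/-- The analytic set `L` has dimension `n`: this is the largest dimension of an analytic
submanifold contained in `L`. -/
def HasDimension (L : Set M) (n : ℕ) : Prop :=
  IsGreatest {d : ℕ | ContainsSubmanifold 𝕜 E L d} n

/-- The algebra of functions that are analytic at `p`. (Only their germs at `p` will matter.) -/
def analyticFunctions (p : M) : Subalgebra 𝕜 (M → 𝕜) where
  carrier := {f | ContMDiffAt 𝓘(𝕜, E) 𝓘(𝕜, 𝕜) ω f p}
  mul_mem' hf hg := ContMDiffAt.mul hf hg
  add_mem' hf hg := ContMDiffAt.add hf hg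
  algebraMap_mem' _ := contMDiffAt_const

/-- The functions, analytic at `p`, that vanish on `L` near `p`. -/
def vanishingIdeal (L : Set M) (p : M) : Ideal (analyticFunctions 𝕜 E p) where
  carrier := {f | ∀ᶠ x in 𝓝 p, x ∈ L → f.1 x = 0}
  zero_mem' := by simp
  add_mem' {f g} hf hg := by
    filter_upwards [hf, hg] with x hf hg hx
    simp [hf hx, hg hx]
  smul_mem' c f hf := by
    filter_upwards [hf] with x hf hx
    simp [hf hx]

/-- The local ring `𝒪_{L,p}` of the reduced analytic space `L`: germs at `p` of analytic functions
on `M`, modulo those vanishing on `L`. (Functions with the same germ at `p` are identified, since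
their difference vanishes near `p`.) -/
abbrev LocalRingAt (L : Set M) (p : M) : Type _ :=
  analyticFunctions 𝕜 E p ⧸ vanishingIdeal 𝕜 E L p

/-- The ideal of functions that are analytic at `p` and vanish at `p`. -/
def pointIdeal (p : M) : Ideal (analyticFunctions 𝕜 E p) where
  carrier := {f | f.1 p = 0}
  zero_mem' := rfl
  add_mem' {f g} (hf : f.1 p = 0) (hg : g.1 p = 0) := by simp [hf, hg]
  smul_mem' c f (hf : f.1 p = 0) := by simp [hf]

/-- The maximal ideal `𝔪_p` of `𝒪_{L,p}` (for `p ∈ L`): the classes of functions vanishing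
at `p`. -/
def maxIdealAt (L : Set M) (p : M) : Ideal (LocalRingAt 𝕜 E L p) :=
  (pointIdeal 𝕜 E p).map (Ideal.Quotient.mk (vanishingIdeal 𝕜 E L p))

/-- The embedding dimension `dim_𝕜 (𝔪_p / 𝔪_p²)` of `L` at `p`. -/
def edim (L : Set M) (p : M) : ℕ :=
  Module.finrank 𝕜 (Ideal.Cotangent (R := LocalRingAt 𝕜 E L p) (maxIdealAt 𝕜 E L p))

/-- The set `S^L_k` of points of `L`, in an ambient space of dimension `2n`, whose embedding
dimension is `2n - k`. -/
def stratum (n : ℕ) (L : Set M) (k : ℕ) : Set M :=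
  {p | p ∈ L ∧ edim 𝕜 E L p + k = 2 * n}

variable {𝕜 E} in
/-- `L` is a lagrangian subvariety of the open subset `U` of the symplectic manifold `(M, Ω)` of
dimension `2n`: a reduced analytic subspace of dimension `n` whose ideal sheaf (the sheaf of all
analytic functions vanishing on `L`) is involutive. -/
structure IsLagrangian [FiniteDimensional 𝕜 E] (Ω : SymplecticForm 𝕜 E M) (n : ℕ)
    (U L : Set M) : Prop where
  isAnalytic : IsAnalyticSubset 𝕜 E U L
  hasDimension : HasDimension 𝕜 E L n
  involutive : ∀ V : Set M, IsOpen V → V ⊆ U → ∀ f g : M → 𝕜,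
    ContMDiffOn 𝓘(𝕜, E) 𝓘(𝕜, 𝕜) ω f V → ContMDiffOn 𝓘(𝕜, E) 𝓘(𝕜, 𝕜) ω g V →
    (∀ x ∈ V ∩ L, f x = 0) → (∀ x ∈ V ∩ L, g x = 0) → ∀ x ∈ V ∩ L, Ω.poisson f g x = 0

variable (E' : Type*) [NormedAddCommGroup E'] [NormedSpace 𝕜 E']
  {M' : Type*} [TopologicalSpace M'] [ChartedSpace E' M']

/-- The germs of reduced analytic spaces `(L, p)` and `(L', p')` are isomorphic: there are
mutually inverse germs of maps between them, induced by analytic maps of the ambient spaces. -/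
def GermIso (L : Set M) (p : M) (L' : Set M') (p' : M') : Prop :=
  ∃ (F : M → M') (G : M' → M),
    ContMDiffAt 𝓘(𝕜, E) 𝓘(𝕜, E') ω F p ∧ ContMDiffAt 𝓘(𝕜, E') 𝓘(𝕜, E) ω G p' ∧
    F p = p' ∧ G p' = p ∧
    (∀ᶠ x in 𝓝 p, x ∈ L → F x ∈ L' ∧ G (F x) = x) ∧
    (∀ᶠ y in 𝓝 p', y ∈ L' → G y ∈ L ∧ F (G y) = y)

end Subvarieties

section Standard

variable (𝕜 : Type*) [RCLike 𝕜]

/-- The space `𝕜^{2m}`, with coordinates `(x₁, …, x_m; y₁, …, y_m)`. -/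
abbrev StdSpace (m : ℕ) : Type _ := (Fin m → 𝕜) × (Fin m → 𝕜)

/-- The alternating form `∑ i, dx_i ∧ dy_i` on `𝕜^{2m}`. -/
def stdAlt (m : ℕ) : StdSpace 𝕜 m [⋀^Fin 2]→L[𝕜] 𝕜 where
  toFun v := ∑ i, ((v 0).1 i * (v 1).2 i - (v 1).1 i * (v 0).2 i)
  map_update_add' := by
    intro _ v j x y
    rw [← Finset.sum_add_distrib]
    refine Finset.sum_congr rfl fun i _ => ?_
    fin_cases j <;> simp [Function.update] <;> ring
  map_update_smul' := by
    intro _ v j c x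
    rw [smul_eq_mul, Finset.mul_sum]
    refine Finset.sum_congr rfl fun i _ => ?_
    fin_cases j <;> simp [Function.update] <;> ring
  cont := by fun_prop
  map_eq_zero_of_eq' := by
    intro v i j h hij
    have h01 : v 0 = v 1 := by
      fin_cases i <;> fin_cases j <;> simp_all
    simp [h01]

theorem localForm_const {E : Type*} [NormedAddCommGroup E] [NormedSpace 𝕜 E]
    (a : E [⋀^Fin 2]→L[𝕜] 𝕜) (x₀ : E) :
    localForm 𝕜 (M := E) (fun _ => a) x₀ = fun _ => a := by
  funext y
  have h : mfderiv 𝓘(𝕜, E) 𝓘(𝕜, E) (extChartAt 𝓘(𝕜, E) x₀).symm y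
      = ContinuousLinearMap.id 𝕜 E := by
    rw [extChartAt_model_space_eq_id]
    exact mfderiv_id
  unfold localForm
  rw [h]
  rfl

/-- The standard symplectic form `∑ i, dx_i ∧ dy_i` on `𝕜^{2m}`. -/
def stdForm (m : ℕ) : SymplecticForm 𝕜 (StdSpace 𝕜 m) (StdSpace 𝕜 m) where
  form _ := stdAlt 𝕜 m
  analytic x₀ := by
    rw [localForm_const 𝕜 (stdAlt 𝕜 m) x₀]
    exact fun _ _ => analyticAt_const
  closed x₀ y _ := by
    rw [localForm_const 𝕜 (stdAlt 𝕜 m) x₀]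
    simp only [extDeriv, fderiv_fun_const, Pi.zero_apply]
    exact map_zero (ContinuousAlternatingMap.alternatizeUncurryFinCLM 𝕜 (StdSpace 𝕜 m) 𝕜)
  nondegenerate _ v hv := by
    change ∀ w : StdSpace 𝕜 m, ∑ i, (v.1 i * w.2 i - w.1 i * v.2 i) = 0 at hv
    refine Prod.ext (funext fun j => ?_) (funext fun j => ?_)
    · have h : v.1 j = 0 := by simpa [Pi.single_apply] using hv (0, Pi.single j 1)
      exact h
    · have h : v.2 j = 0 := by simpa [Pi.single_apply] using hv (Pi.single j 1, 0)
      exact h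

end Standard

end LagrangianGerm

end

-- The embedding dimension of `L` at `p` and the dimension of its conormal space (the differentials
-- at `p` of functions vanishing on `L`) add up to `2n`, so `k` is the dimension of the conormal
-- space. As `k > 0`, some `f` vanishing on `L` near `p` has `df ≠ 0` at `p`. Involutivity says that
-- the hamiltonian field `X_f` maps functions vanishing on `L` to functions vanishing on `L`, so `L`
-- is a union of pieces of flow lines of `X_f`.
--
-- In coordinates `(t, s, z)` with `f = s`, `X_f = ∂ₜ`, and the form on `{s = 0}` equal to the
-- pullback of the standard form in `z`, this means that near `p` the set `L` is `{s = 0, z ∈ L'}`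
-- with `t` free: the desired product. Such coordinates come from flowing out a slice along `X_f`
-- (`exists_reduction`) and applying Darboux to the reduced form (`exists_isReductionChart`);
-- Darboux itself follows by induction from the same construction. The flow must be analytic over
-- both fields, which `exists_flow` obtains from the inverse function theorem on a Banach space of
-- curves.
--
-- It remains to see that `L'` is lagrangian and to compute its stratum. Functions vanishing on `L'`
-- pull back to functions vanishing on `L`, with compatible hamiltonian vectors, so `L'` is
-- involutive. The conormal space of `L` is that of `L'` plus the line of `ds`, so `k` drops by one.
-- A submanifold of `L'` times the `t`-line lies in `L`, so `dim L' ≤ n - 1`. Conversely,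
-- involutivity makes conormal spaces isotropic, of dimension at most `n - 1`, and at a point where
-- this dimension is maximal `L'` contains a submanifold of the complementary dimension, which is at
-- least `n - 1`.

open scoped Manifold ContDiff Topology

noncomputable section

namespace LagrangianGerm

-- Analytic operations on the Banach space of continuous curves

section Flow

open ContinuousMap

variable {𝕜 : Type*} [RCLike 𝕜] {E : Type*} [NormedAddCommGroup E] [NormedSpace 𝕜 E]
  {F : Type*} [NormedAddCommGroup F] [NormedSpace 𝕜 F]

/-- The pointwise action of a continuous multilinear map on continuous curves. -/
def curveMultilinear {k : ℕ} (A : E [×k]→L[𝕜] F) :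
    C(unitInterval, E) [×k]→L[𝕜] C(unitInterval, F) :=
  MultilinearMap.mkContinuous
    { toFun := fun u => ⟨fun t => A fun i => u i t, by fun_prop⟩
      map_update_add' := by
        intro _ m i x y
        ext t
        have e (z : C(unitInterval, E)) : (fun j => (Function.update m i z) j t)
            = Function.update (fun j => m j t) i (z t) := by
          funext j
          by_cases h : j = i
          · subst h; simp
          · simp [h]
        simp only [ContinuousMap.coe_mk, ContinuousMap.add_apply]
        erw [e, e, e]
        simp
      map_update_smul' := by
        intro _ m i c x
        ext t
        have e (z : C(unitInterval, E)) : (fun j => (Function.update m i z) j t)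
            = Function.update (fun j => m j t) i (z t) := by
          funext j
          by_cases h : j = i
          · subst h; simp
          · simp [h]
        simp only [ContinuousMap.coe_mk, ContinuousMap.smul_apply]
        erw [e, e]
        simp }
    ‖A‖ (fun u => by
      rw [ContinuousMap.norm_le _ (by positivity)]
      intro t
      refine (A.le_opNorm _).trans ?_
      gcongr with i
      exact (u i).norm_coe_le_norm t)

theorem norm_curveMultilinear_le {k : ℕ} (A : E [×k]→L[𝕜] F) : ‖curveMultilinear A‖ ≤ ‖A‖ :=
  MultilinearMap.mkContinuous_norm_le _ (norm_nonneg _) _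

/-- Composition with an analytic map is an analytic operation on continuous curves. -/
theorem exists_analyticAt_comp_curve [CompleteSpace F] {X : E → F} {p : E}
    (hX : ContDiffAt 𝕜 ω X p) :
    ∃ N : C(unitInterval, E) → C(unitInterval, F), ∃ r > 0,
      ContDiffAt 𝕜 ω N (ContinuousMap.const _ p) ∧
      ∀ u : C(unitInterval, E), (∀ t, ‖u t - p‖ < r) → ∀ t, N u t = X (u t) := by
  obtain ⟨P, R, hP⟩ := hX.analyticAt
  obtain ⟨r, hr0, hrR⟩ := ENNReal.lt_iff_exists_nnreal_btwn.1 hP.r_pos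
  -- The Taylor series of `X` at `p`, applied pointwise in `t`. Passing to curves does not increase
  -- the norms of the coefficients, so the radius of convergence does not shrink.
  let Q : FormalMultilinearSeries 𝕜 C(unitInterval, E) C(unitInterval, F) :=
    fun k => curveMultilinear (P k)
  have hrad : P.radius ≤ Q.radius :=
    FormalMultilinearSeries.radius_le_of_le fun k => norm_curveMultilinear_le _
  have hQ : 0 < Q.radius := hP.r_pos.trans_le (hP.r_le.trans hrad)
  have hball := Q.hasFPowerSeriesOnBall hQ
  refine ⟨fun u => Q.sum (u - ContinuousMap.const _ p), r, by exact_mod_cast hr0, ?_, ?_⟩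
  · have h : ContDiffAt 𝕜 ω Q.sum (ContinuousMap.const unitInterval p - ContinuousMap.const _ p) := by
      rw [sub_self]
      exact hball.analyticAt.contDiffAt
    exact ContDiffAt.comp (f := fun u => u - ContinuousMap.const _ p)
      (ContinuousMap.const unitInterval p) h (by fun_prop)
  · intro u hu t
    have hlt : ‖u - ContinuousMap.const _ p‖ < r := by
      rw [ContinuousMap.norm_lt_iff _ (by exact_mod_cast hr0)]
      exact hu
    have h1 : HasSum (fun k => Q k fun _ => u - ContinuousMap.const _ p)
        (Q.sum (u - ContinuousMap.const _ p)) := by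
      refine Q.hasSum ?_
      rw [mem_eball_zero_iff]
      refine lt_of_lt_of_le ?_ (hrR.le.trans (hP.r_le.trans hrad))
      rw [enorm_eq_nnnorm, ENNReal.coe_lt_coe]
      exact hlt
    have h2 := (ContinuousMap.evalCLM 𝕜 t).hasSum h1
    have h3 : HasSum (fun k => P k fun _ => u t - p) (X (p + (u t - p))) := by
      refine hP.hasSum ?_
      rw [mem_eball_zero_iff]
      refine lt_of_lt_of_le ?_ hrR.le
      rw [enorm_eq_nnnorm, ENNReal.coe_lt_coe]
      exact hu t
    rw [add_sub_cancel] at h3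
    exact h2.unique h3

variable (𝕜 E) in
/-- The constant curves. -/
def constCurve : E →L[𝕜] C(unitInterval, E) := LinearMap.mkContinuous
  { toFun := fun x => ContinuousMap.const _ x
    map_add' := fun _ _ => rfl
    map_smul' := fun _ _ => rfl } 1 (fun x => by
      rw [ContinuousMap.norm_le _ (by positivity)]
      intro t
      exact (one_mul ‖x‖).ge)

variable [NormedSpace ℝ E] [IsScalarTower ℝ 𝕜 E]

variable (𝕜) in
/-- The antiderivative, vanishing at `0`, of a continuous curve. -/
def curveIntegral : C(unitInterval, E) →L[𝕜] C(unitInterval, E) :=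
  LinearMap.mkContinuous
    -- `Set.projIcc` extends the curve by constants to the whole line, so that interval integrals
    -- make sense.
    { toFun := fun u => ⟨fun t => ∫ s in (0 : ℝ)..t, u (Set.projIcc 0 1 zero_le_one s), by
          have : Continuous fun t : ℝ => ∫ s in (0 : ℝ)..t, u (Set.projIcc 0 1 zero_le_one s) :=
            intervalIntegral.continuous_primitive
              (fun a b => (Continuous.intervalIntegrable (by fun_prop) a b)) 0
          exact this.comp continuous_subtype_val⟩
      map_add' := by
        intro u v
        ext t
        exact intervalIntegral.integral_add (Continuous.intervalIntegrable (by fun_prop) _ _)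
          (Continuous.intervalIntegrable (by fun_prop) _ _)
      map_smul' := by
        intro c u
        ext t
        exact intervalIntegral.integral_smul c _ }
    1 (fun u => by
      rw [ContinuousMap.norm_le _ (by positivity)]
      intro t
      have h := intervalIntegral.norm_integral_le_of_norm_le_const (a := (0 : ℝ)) (b := t)
        (f := fun s => u (Set.projIcc 0 1 zero_le_one s)) (C := ‖u‖)
        (fun s _ => u.norm_coe_le_norm _)
      refine h.trans ?_
      have h0 := t.2.1
      have h1 := t.2.2
      rw [sub_zero, abs_of_nonneg h0]
      nlinarith [norm_nonneg u])

theorem curveIntegral_apply (u : C(unitInterval, E)) (t : unitInterval) :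
    curveIntegral 𝕜 u t = ∫ s in (0 : ℝ)..t, u (Set.projIcc 0 1 zero_le_one s) := rfl

end Flow

-- Parameter-dependent fixed points by the inverse function theorem

section FixedPoint

variable {𝕜 : Type*} [RCLike 𝕜] {E : Type*} [NormedAddCommGroup E] [NormedSpace 𝕜 E]
  {C : Type*} [NormedAddCommGroup C] [NormedSpace 𝕜 C] [CompleteSpace E] [CompleteSpace C]

/-- The equation `u = c x + ε • K u`, for an analytic map `K`, has a locally unique solution `u`
depending analytically on `(ε, x)`. -/
theorem exists_contDiffAt_fixedPoint (c : E →L[𝕜] C) {K : C → C} {p : E}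
    (hK : ContDiffAt 𝕜 ω K (c p)) :
    ∃ u : 𝕜 × E → C, ContDiffAt 𝕜 ω u (0, p) ∧ u (0, p) = c p ∧
      (∀ᶠ q in 𝓝 ((0 : 𝕜), p), u q = c q.2 + q.1 • K (u q)) ∧
      ∀ᶠ z in 𝓝 (((0 : 𝕜), p), c p), z.2 = c z.1.2 + z.1.1 • K z.2 → u z.1 = z.2 := by
  let a : (𝕜 × E) × C := ((0, p), c p)
  -- Solutions of the equation are the points where the last component of `Ψ` vanishes, so the
  -- inverse of `Ψ` on `C = 0` gives existence, and its left-inverse property gives uniqueness.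
  let Ψ : (𝕜 × E) × C → (𝕜 × E) × C := fun z => (z.1, z.2 - c z.1.2 - z.1.1 • K z.2)
  have hKa : ContDiffAt 𝕜 ω (fun z : (𝕜 × E) × C => K z.2) a :=
    ContDiffAt.comp a (g := K) (f := fun z : (𝕜 × E) × C => z.2) hK (by fun_prop)
  have hcd : ContDiffAt 𝕜 ω Ψ a := by fun_prop
  -- The derivative of `Ψ` at `a` is unipotent: since `ε = 0` there, the derivative of `K` does not
  -- contribute.
  let T : ((𝕜 × E) × C) ≃L[𝕜] ((𝕜 × E) × C) := ContinuousLinearEquiv.equivOfInverse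
    ((ContinuousLinearMap.fst 𝕜 (𝕜 × E) C).prod (ContinuousLinearMap.snd 𝕜 (𝕜 × E) C
      - c ∘L (ContinuousLinearMap.snd 𝕜 𝕜 E) ∘L (ContinuousLinearMap.fst 𝕜 (𝕜 × E) C)
      - ((ContinuousLinearMap.fst 𝕜 𝕜 E) ∘L
          (ContinuousLinearMap.fst 𝕜 (𝕜 × E) C)).smulRight (K (c p))))
    ((ContinuousLinearMap.fst 𝕜 (𝕜 × E) C).prod (ContinuousLinearMap.snd 𝕜 (𝕜 × E) C
      + c ∘L (ContinuousLinearMap.snd 𝕜 𝕜 E) ∘L (ContinuousLinearMap.fst 𝕜 (𝕜 × E) C)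
      + ((ContinuousLinearMap.fst 𝕜 𝕜 E) ∘L
          (ContinuousLinearMap.fst 𝕜 (𝕜 × E) C)).smulRight (K (c p))))
    (fun z => by refine Prod.ext rfl ?_; simp; abel)
    (fun z => by refine Prod.ext rfl ?_; simp; abel)
  have hder : HasFDerivAt Ψ (T : ((𝕜 × E) × C) →L[𝕜] ((𝕜 × E) × C)) a := by
    have h1 : HasFDerivAt (fun z : (𝕜 × E) × C => z.1.1)
      ((ContinuousLinearMap.fst 𝕜 𝕜 E) ∘L (ContinuousLinearMap.fst 𝕜 (𝕜 × E) C)) a :=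
      ((ContinuousLinearMap.fst 𝕜 𝕜 E) ∘L (ContinuousLinearMap.fst 𝕜 (𝕜 × E) C)).hasFDerivAt
    have h2 := h1.fun_smul (hKa.differentiableAt (by simp)).hasFDerivAt
    have h3 : HasFDerivAt (fun z : (𝕜 × E) × C => z.2 - c z.1.2)
      (ContinuousLinearMap.snd 𝕜 (𝕜 × E) C
      - c ∘L (ContinuousLinearMap.snd 𝕜 𝕜 E) ∘L (ContinuousLinearMap.fst 𝕜 (𝕜 × E) C)) a :=
      (ContinuousLinearMap.snd 𝕜 (𝕜 × E) C
      - c ∘L (ContinuousLinearMap.snd 𝕜 𝕜 E) ∘L (ContinuousLinearMap.fst 𝕜 (𝕜 × E) C)).hasFDerivAt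
    have h4 := (ContinuousLinearMap.fst 𝕜 (𝕜 × E) C).hasFDerivAt (x := a) |>.prodMk (h3.fun_sub h2)
    convert! h4 using 1
    ext z <;> simp [T, a]
  have hΨa : Ψ a = ((0, p), 0) := by
    simp only [Ψ, a]
    simp
  have hω : (ω : WithTop ℕ∞) ≠ 0 := by simp
  let G := hcd.localInverse hder hω
  have hstr := hcd.hasStrictFDerivAt' hder hω
  have hG : ContDiffAt 𝕜 ω G ((0, p), 0) := by
    have := hcd.to_localInverse hder hω
    rwa [hΨa] at this
  have hGa : G ((0, p), 0) = a := by
    rw [← hΨa]; exact hcd.localInverse_apply_image hder hω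
  have hr1 : ∀ᶠ y in 𝓝 ((((0 : 𝕜), p), (0 : C))), Ψ (G y) = y := by
    rw [← hΨa]; exact hstr.eventually_right_inverse
  have hl1 : ∀ᶠ z in 𝓝 a, G (Ψ z) = z := hstr.eventually_left_inverse
  have hu : ContDiffAt 𝕜 ω (fun q : 𝕜 × E => (q, (0 : C))) (0, p) := by fun_prop
  refine ⟨fun q => (G (q, 0)).2, ?_, ?_, ?_, ?_⟩
  · exact (ContDiffAt.comp (0, p) (g := G) hG hu).snd
  · simp [hGa, a]
  · filter_upwards [hu.continuousAt.eventually hr1] with q hq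
    have e1 : (G (q, 0)).1 = q := congrArg Prod.fst hq
    have e2 := congrArg Prod.snd hq
    simp only [Ψ, e1] at e2
    rwa [sub_sub, sub_eq_zero] at e2
  · refine hl1.mono fun z hz h => ?_
    have : Ψ z = (z.1, 0) := by
      refine Prod.ext rfl ?_
      simp only [Ψ]
      rwa [sub_sub, sub_eq_zero]
    rw [this] at hz
    simp [hz]

end FixedPoint

-- Analytic local flows

section Flow

variable {𝕜 : Type*} [RCLike 𝕜] {E : Type*} [NormedAddCommGroup E] [NormedSpace 𝕜 E]

/-- The curve `t ↦ u (s t)`. -/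
def rescaleCurve (s : unitInterval) (u : C(unitInterval, E)) : C(unitInterval, E) :=
  ⟨fun t => u (s * t), by fun_prop⟩

@[simp]
theorem rescaleCurve_apply (s t : unitInterval) (u : C(unitInterval, E)) :
    rescaleCurve s u t = u (s * t) := rfl

variable (𝕜) in
theorem norm_rescaleCurve_sub_le (s : unitInterval) (u : C(unitInterval, E)) (p : E) :
    ‖rescaleCurve s u - constCurve 𝕜 E p‖ ≤ ‖u - constCurve 𝕜 E p‖ := by
  rw [ContinuousMap.norm_le _ (norm_nonneg _)]
  intro t
  exact (u - constCurve 𝕜 E p).norm_coe_le_norm (s * t)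

theorem smul_curveIntegral_rescaleCurve [NormedSpace ℝ E] [IsScalarTower ℝ 𝕜 E]
    (s : unitInterval) (w : C(unitInterval, E)) :
    ((s : ℝ) : 𝕜) • curveIntegral 𝕜 (rescaleCurve s w) = rescaleCurve s (curveIntegral 𝕜 w) := by
  ext t
  rw [ContinuousMap.smul_apply, rescaleCurve_apply, curveIntegral_apply, curveIntegral_apply,
    ← RCLike.real_smul_eq_coe_smul (K := 𝕜)]
  have h := intervalIntegral.smul_integral_comp_mul_left (a := 0) (b := (t : ℝ))
    (fun r => w (Set.projIcc 0 1 zero_le_one r)) (s : ℝ)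
  rw [mul_zero] at h
  rw [Set.Icc.coe_mul, ← h]
  congr 1
  refine intervalIntegral.integral_congr fun r hr => ?_
  rw [Set.uIcc_of_le t.2.1] at hr
  have hr1 : r ∈ Set.Icc (0 : ℝ) 1 := ⟨hr.1, hr.2.trans t.2.2⟩
  have hr2 : (s : ℝ) * r ∈ Set.Icc (0 : ℝ) 1 :=
    ⟨mul_nonneg s.2.1 hr.1, mul_le_one₀ s.2.2 hr.1 hr1.2⟩
  simp only [rescaleCurve_apply]
  rw [Set.projIcc_of_mem _ hr1, Set.projIcc_of_mem _ hr2]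
  rfl

theorem hasDerivAt_curveIntegral [NormedSpace ℝ E] [CompleteSpace E]
    (w : C(unitInterval, E)) (s : ℝ) :
    HasDerivAt (fun s : ℝ => ∫ r in (0 : ℝ)..s, w (Set.projIcc 0 1 zero_le_one r))
      (w (Set.projIcc 0 1 zero_le_one s)) s :=
  (Continuous.integral_hasStrictDerivAt (by fun_prop) 0 s).hasDerivAt

/-- The curve `u (ε, x)` solves `u(s) = x + ε ∫₀ˢ X(u)`, so it is the flow of `ε X` in real time
`s`, and `φ (ε, x)` is its value at `s = 1`. The scaling relation `φ (sε, x) = u (ε, x) s` turns the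
`s`-derivative into a derivative of `φ` in the `𝕜`-time direction. This yields the flow equation
multiplied by `ε`, hence the restriction to `ε ≠ 0`. -/
theorem exists_flow_aux [NormedSpace ℝ E] [IsScalarTower ℝ 𝕜 E] [CompleteSpace E]
    {X : E → E} {p : E} (hX : ContDiffAt 𝕜 ω X p) :
    ∃ φ : 𝕜 × E → E, ContDiffAt 𝕜 ω φ (0, p) ∧ (∀ᶠ x in 𝓝 p, φ (0, x) = x) ∧
      ∀ᶠ q in 𝓝 ((0 : 𝕜), p), q.1 ≠ 0 → fderiv 𝕜 φ q (1, 0) = X (φ q) := by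
  obtain ⟨N, r, hr, hN, hNX⟩ := exists_analyticAt_comp_curve hX
  have hK : ContDiffAt 𝕜 ω (fun v => curveIntegral 𝕜 (N v)) (constCurve 𝕜 E p) :=
    (curveIntegral 𝕜 (E := E)).contDiff.contDiffAt.comp _ hN
  obtain ⟨u, hu, hu0, hfix, huniq⟩ := exists_contDiffAt_fixedPoint (constCurve 𝕜 E) hK
  have hφ : ContDiffAt 𝕜 ω (fun q => u q 1) (0, p) :=
    (ContinuousMap.evalCLM 𝕜 (M := E) (1 : unitInterval)).contDiff.contDiffAt.comp (0, p) hu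
  obtain ⟨δ, hδ, hball⟩ := Metric.eventually_nhds_iff.1 huniq
  -- the curves `u q` are close to the constant curve
  have hclose : ∀ᶠ q in 𝓝 ((0 : 𝕜), p), ‖u q - constCurve 𝕜 E p‖ < min r δ := by
    have := hu.continuousAt.eventually (Metric.ball_mem_nhds (u (0, p)) (lt_min hr hδ))
    filter_upwards [this] with q hq
    rwa [hu0, dist_eq_norm] at hq
  have hX' (v : C(unitInterval, E)) (hv : ‖v - constCurve 𝕜 E p‖ < min r δ) (t : unitInterval) :
      N v t = X (v t) :=
    hNX v (fun t => ((v - constCurve 𝕜 E p).norm_coe_le_norm t).trans_lt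
      (hv.trans_le (min_le_left _ _))) t
  -- The rescaled curve solves the equation with parameter `s ε`, and it is no farther from the
  -- constant curve than `u`, so local uniqueness applies.
  have hscale : ∀ᶠ q in 𝓝 ((0 : 𝕜), p), ∀ s : unitInterval,
      u (((s : ℝ) : 𝕜) * q.1, q.2) 1 = u q s := by
    filter_upwards [hclose, hfix, Metric.ball_mem_nhds ((0 : 𝕜), p) hδ] with q hq hf hqδ s
    have hv : ‖rescaleCurve s (u q) - constCurve 𝕜 E p‖ < min r δ :=
      (norm_rescaleCurve_sub_le 𝕜 s (u q) p).trans_lt hq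
    have hNv : N (rescaleCurve s (u q)) = rescaleCurve s (N (u q)) := by
      ext t
      rw [hX' _ hv, rescaleCurve_apply, rescaleCurve_apply, hX' _ hq]
    have key := hball (y := ((((s : ℝ) : 𝕜) * q.1, q.2), rescaleCurve s (u q))) (by
      rw [Prod.dist_eq, Prod.dist_eq]
      rw [mem_ball_iff_norm, Prod.norm_def] at hqδ
      have h1 : ‖q.1 - 0‖ < δ := (le_max_left _ _).trans_lt hqδ
      have h2 : ‖q.2 - p‖ < δ := (le_max_right _ _).trans_lt hqδ
      refine max_lt (max_lt ?_ ?_) ?_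
      · rw [sub_zero] at h1
        rw [dist_zero_right, norm_mul, RCLike.norm_ofReal, abs_of_nonneg s.2.1]
        exact (mul_le_of_le_one_left (norm_nonneg _) s.2.2).trans_lt h1
      · rwa [dist_eq_norm]
      · rw [dist_eq_norm]
        exact hv.trans_le (min_le_right _ _)) (by
      simp only
      rw [hNv, mul_comm, mul_smul, smul_curveIntegral_rescaleCurve]
      nth_rewrite 1 [hf]
      rfl)
    have := congrArg (fun v : C(unitInterval, E) => v 1) key
    simpa using this
  have hu_int : ∀ᶠ q in 𝓝 ((0 : 𝕜), p), ∀ s : unitInterval,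
      u q s = q.2 + q.1 • ∫ r in (0 : ℝ)..s, N (u q) (Set.projIcc 0 1 zero_le_one r) := by
    filter_upwards [hfix] with q hf s
    conv_lhs => rw [hf]
    rfl
  refine ⟨fun q => u q 1, hφ, ?_, ?_⟩
  · have hc : Filter.Tendsto (fun x : E => ((0 : 𝕜), x)) (𝓝 p) (𝓝 (0, p)) :=
      Continuous.tendsto (by fun_prop) p
    filter_upwards [hc.eventually hu_int] with x hx
    simpa using hx 1
  -- The two derivatives in `s` are compared at the interior point `1 / 2`, because the curve is
  -- only controlled on `[0, 1]` and a two-sided derivative is needed. Doubling `ε` afterwards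
  -- reaches `φ q` itself.
  · have hhalf : ∀ᶠ q in 𝓝 ((0 : 𝕜), p), q.1 ≠ 0 →
        fderiv 𝕜 (fun q => u q 1) (((1 / 2 : ℝ) : 𝕜) * q.1, q.2) (1, 0)
          = X (u (((1 / 2 : ℝ) : 𝕜) * q.1, q.2) 1) := by
      have hc : Filter.Tendsto (fun q : 𝕜 × E => (((1 / 2 : ℝ) : 𝕜) * q.1, q.2))
          (𝓝 (0, p)) (𝓝 (0, p)) := by
        have : Continuous (fun q : 𝕜 × E => (((1 / 2 : ℝ) : 𝕜) * q.1, q.2)) := by fun_prop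
        simpa using this.tendsto (0, p)
      have hdiff : ∀ᶠ q in 𝓝 ((0 : 𝕜), p), DifferentiableAt 𝕜 (fun q => u q 1) q :=
        (hφ.eventually (by simp)).mono fun q hq => hq.differentiableAt (by simp)
      filter_upwards [hclose, hscale, hu_int, hc.eventually hdiff] with q hq hs hi hd hq0
      let h : unitInterval := ⟨1 / 2, by norm_num, by norm_num⟩
      have d1 : HasDerivAt (fun s : ℝ => u ((s : 𝕜) * q.1, q.2) 1) (q.1 • X (u q h)) (1 / 2) := by
        have d := ((hasDerivAt_curveIntegral (N (u q)) (1 / 2)).const_smul q.1).const_add q.2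
        rw [Set.projIcc_of_mem _ h.2, hX' _ hq] at d
        refine d.congr_of_eventuallyEq ?_
        filter_upwards [Icc_mem_nhds (show (0 : ℝ) < 1 / 2 by norm_num)
          (show (1 / 2 : ℝ) < 1 by norm_num)] with s hs'
        have e1 := hs ⟨s, hs'⟩
        rw [hi] at e1
        exact e1
      have d2 : HasDerivAt (fun s : ℝ => u ((s : 𝕜) * q.1, q.2) 1)
          (fderiv 𝕜 (fun q => u q 1) (((1 / 2 : ℝ) : 𝕜) * q.1, q.2) (q.1, 0)) (1 / 2) := by
        have d := hd.hasFDerivAt.restrictScalars ℝ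
        have d3 : HasDerivAt (fun s : ℝ => ((s : 𝕜) * q.1, q.2)) (q.1, 0) (1 / 2) := by
          refine HasDerivAt.prodMk ?_ (hasDerivAt_const _ _)
          have := (RCLike.ofRealCLM (K := 𝕜)).hasDerivAt (x := (1 / 2 : ℝ)) |>.mul_const q.1
          simpa using this
        exact d.comp_hasDerivAt (1 / 2 : ℝ) d3
      have e := d1.unique d2
      have e2 : ((q.1, 0) : 𝕜 × E) = q.1 • ((1, 0) : 𝕜 × E) := by simp
      rw [e2, map_smul] at e
      have e3 := (smul_right_injective E hq0) e
      rw [← e3, ← hs h]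
    have hc : Filter.Tendsto (fun q : 𝕜 × E => (2 * q.1, q.2)) (𝓝 (0, p)) (𝓝 (0, p)) := by
      have : Continuous (fun q : 𝕜 × E => (2 * q.1, q.2)) := by fun_prop
      simpa using this.tendsto (0, p)
    filter_upwards [hc.eventually hhalf] with q hq hq0
    have e : ((1 / 2 : ℝ) : 𝕜) * (2 * q.1) = q.1 := by
      push_cast
      ring
    have := hq (by simpa using hq0)
    rwa [e] at this

/-- The local flow of an analytic vector field is analytic. -/
theorem exists_flow [CompleteSpace E] {X : E → E} {p : E} (hX : ContDiffAt 𝕜 ω X p) :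
    ∃ φ : 𝕜 × E → E, ContDiffAt 𝕜 ω φ (0, p) ∧ (∀ᶠ x in 𝓝 p, φ (0, x) = x) ∧
      ∀ᶠ q in 𝓝 ((0 : 𝕜), p), fderiv 𝕜 φ q (1, 0) = X (φ q) := by
  let _ : NormedSpace ℝ E := NormedSpace.restrictScalars ℝ 𝕜 E
  have : IsScalarTower ℝ 𝕜 E := RestrictScalars.isScalarTower ℝ 𝕜 E
  obtain ⟨φ, hφ, h0, hne⟩ := exists_flow_aux hX
  refine ⟨φ, hφ, h0, ?_⟩
  have hφ0 : φ (0, p) = p := h0.self_of_nhds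
  have hXφ : ContDiffAt 𝕜 ω (fun q => X (φ q)) (0, p) :=
    ContDiffAt.comp (0, p) (by rwa [hφ0]) hφ
  filter_upwards [hne.eventually_nhds, hφ.eventually (by simp), hXφ.eventually (by simp)]
    with q h1 h2 h3
  -- At time zero both sides are continuous in time and agree at nonzero times.
  by_cases hq : q.1 = 0
  · have hc : ContinuousAt (fun t : 𝕜 => (t, q.2)) 0 := by fun_prop
    have hq' : ((0 : 𝕜), q.2) = q := Prod.ext hq.symm rfl
    have hA : ContinuousAt (fun t : 𝕜 => fderiv 𝕜 φ (t, q.2) (1, 0)) 0 := by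
      have h4 : ContinuousAt (fderiv 𝕜 φ) ((0 : 𝕜), q.2) := by
        rw [hq']
        exact (h2.fderiv_right (m := 0) (by simp)).continuousAt
      have h5 := ContinuousAt.comp (f := fun t : 𝕜 => (t, q.2)) h4 hc
      exact h5.clm_apply continuousAt_const
    have hB : ContinuousAt (fun t : 𝕜 => X (φ (t, q.2))) 0 := by
      have h4 : ContinuousAt (fun q => X (φ q)) ((0 : 𝕜), q.2) := by
        rw [hq']; exact h3.continuousAt
      exact ContinuousAt.comp (f := fun t : 𝕜 => (t, q.2)) h4 hc
    have := (hA.eventuallyEq_nhds_iff_eventuallyEq_nhdsNE hB).1 (by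
      have hc' : Filter.Tendsto (fun t : 𝕜 => (t, q.2)) (𝓝 0) (𝓝 q) := by
        have := hc.tendsto
        rwa [hq'] at this
      filter_upwards [nhdsWithin_le_nhds (hc'.eventually h1), self_mem_nhdsWithin] with t ht ht0
      exact ht ht0)
    have := this.self_of_nhds
    simp only at this
    rwa [hq'] at this
  · exact h1.self_of_nhds hq

end Flow

-- Germs of closed 2-forms and their pullbacks

section ClosedGerm

variable {𝕜 : Type*} [RCLike 𝕜]
  {E : Type*} [NormedAddCommGroup E] [NormedSpace 𝕜 E]
  {F : Type*} [NormedAddCommGroup F] [NormedSpace 𝕜 F]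
  {G : Type*} [NormedAddCommGroup G] [NormedSpace 𝕜 G]

/-- Near `p`, the field `B` of bilinear forms is a closed analytic 2-form. -/
structure IsClosedGerm (B : E → E →L[𝕜] E →L[𝕜] 𝕜) (p : E) : Prop where
  contDiffAt : ContDiffAt 𝕜 ω B p
  alt : ∀ᶠ x in 𝓝 p, ∀ u, B x u u = 0
  closed : ∀ᶠ x in 𝓝 p, ∀ u v w,
    fderiv 𝕜 B x u v w + fderiv 𝕜 B x v w u + fderiv 𝕜 B x w u v = 0

/-- A bilinear form without left kernel. -/
def IsNondegenerateForm (b : E →L[𝕜] E →L[𝕜] 𝕜) : Prop := ∀ u, (∀ v, b u v = 0) → u = 0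

/-- The pullback of a field of bilinear forms. -/
def pullbackForm (B : E → E →L[𝕜] E →L[𝕜] 𝕜) (Φ : F → E) : F → F →L[𝕜] F →L[𝕜] 𝕜 :=
  fun y => (B (Φ y)).bilinearComp (fderiv 𝕜 Φ y) (fderiv 𝕜 Φ y)

@[simp]
theorem pullbackForm_apply (B : E → E →L[𝕜] E →L[𝕜] 𝕜) (Φ : F → E) (y u v : F) :
    pullbackForm B Φ y u v = B (Φ y) (fderiv 𝕜 Φ y u) (fderiv 𝕜 Φ y v) := rfl

theorem pullbackForm_comp {B : E → E →L[𝕜] E →L[𝕜] 𝕜} {Φ : F → E} {Θ : G → F} {z : G}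
    (hΦ : DifferentiableAt 𝕜 Φ (Θ z)) (hΘ : DifferentiableAt 𝕜 Θ z) :
    pullbackForm B (Φ ∘ Θ) z = pullbackForm (pullbackForm B Φ) Θ z := by
  ext u v
  simp [fderiv_comp z hΦ hΘ]

theorem form_swap_of_alt {b : E →L[𝕜] E →L[𝕜] 𝕜} (h : ∀ u, b u u = 0) (u v : E) :
    b u v = -b v u := by
  have := h (u + v)
  simp only [map_add, add_apply, h, zero_add, add_zero] at this
  exact eq_neg_of_add_eq_zero_right this

theorem ContDiffAt.clm_flip {g : F → E →L[𝕜] G →L[𝕜] 𝕜} {y : F} (hg : ContDiffAt 𝕜 ω g y) :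
    ContDiffAt 𝕜 ω (fun y => (g y).flip) y := by
  have h : IsBoundedLinearMap 𝕜 fun l : E →L[𝕜] G →L[𝕜] 𝕜 => l.flip :=
    ⟨⟨fun _ _ => rfl, fun _ _ => rfl⟩, 1, one_pos, fun l => by simp⟩
  have h' : ContDiff 𝕜 ω fun l : E →L[𝕜] G →L[𝕜] 𝕜 => l.flip := IsBoundedLinearMap.contDiff h
  exact h'.contDiffAt.comp y hg

theorem ContDiffAt.pullbackForm {B : E → E →L[𝕜] E →L[𝕜] 𝕜} {Φ : F → E} {y : F}
    (hB : ContDiffAt 𝕜 ω B (Φ y)) (hΦ : ContDiffAt 𝕜 ω Φ y) :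
    ContDiffAt 𝕜 ω (pullbackForm B Φ) y := by
  have h1 : ContDiffAt 𝕜 ω (fderiv 𝕜 Φ) y := hΦ.fderiv_right (by simp)
  have h2 : ContDiffAt 𝕜 ω (fun y => B (Φ y)) y := hB.comp y hΦ
  exact ContDiffAt.clm_flip ((ContDiffAt.clm_flip (h2.clm_comp h1)).clm_comp h1)

theorem fderiv_pullbackForm {B : E → E →L[𝕜] E →L[𝕜] 𝕜} {Φ : F → E} {y : F}
    (hB : ContDiffAt 𝕜 ω B (Φ y)) (hΦ : ContDiffAt 𝕜 ω Φ y) (a u v : F) :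
    fderiv 𝕜 (pullbackForm B Φ) y a u v =
      fderiv 𝕜 B (Φ y) (fderiv 𝕜 Φ y a) (fderiv 𝕜 Φ y u) (fderiv 𝕜 Φ y v)
      + B (Φ y) (fderiv 𝕜 (fderiv 𝕜 Φ) y a u) (fderiv 𝕜 Φ y v)
      + B (Φ y) (fderiv 𝕜 Φ y u) (fderiv 𝕜 (fderiv 𝕜 Φ) y a v) := by
  have h1 : HasFDerivAt (fderiv 𝕜 Φ) (fderiv 𝕜 (fderiv 𝕜 Φ) y) y :=
    ((hΦ.fderiv_right (m := ω) (by simp)).differentiableAt (by simp)).hasFDerivAt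
  have h2 : HasFDerivAt (fun y => B (Φ y)) (fderiv 𝕜 B (Φ y) ∘L fderiv 𝕜 Φ y) y :=
    (hB.differentiableAt (by simp)).hasFDerivAt.comp y (hΦ.differentiableAt (by simp)).hasFDerivAt
  have h3 : HasFDerivAt (pullbackForm B Φ) (fderiv 𝕜 (pullbackForm B Φ) y) y :=
    ((ContDiffAt.pullbackForm hB hΦ).differentiableAt (by simp)).hasFDerivAt
  have h4 := (h3.clm_apply (hasFDerivAt_const u y)).clm_apply (hasFDerivAt_const v y)
  have h5 := (h2.clm_apply (h1.clm_apply (hasFDerivAt_const u y))).clm_apply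
    (h1.clm_apply (hasFDerivAt_const v y))
  have h6 := congrArg (fun L => L a) (h4.unique h5)
  simp at h6
  rw [h6]
  ring

/-- In the cyclic sum, the six terms with second derivatives of `Φ` cancel in pairs, by symmetry of
the second derivative and alternation of `B`. What remains is closedness of `B` on the image
vectors. -/
theorem IsClosedGerm.pullbackForm {B : E → E →L[𝕜] E →L[𝕜] 𝕜} {Φ : F → E} {y : F}
    (hB : IsClosedGerm B (Φ y)) (hΦ : ContDiffAt 𝕜 ω Φ y) :
    IsClosedGerm (pullbackForm B Φ) y where
  contDiffAt := ContDiffAt.pullbackForm hB.contDiffAt hΦ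
  alt := (hΦ.continuousAt.eventually hB.alt).mono fun x hx u => hx _
  closed := by
    filter_upwards [hΦ.continuousAt.eventually (hB.contDiffAt.eventually (by simp)),
      hΦ.continuousAt.eventually hB.alt, hΦ.continuousAt.eventually hB.closed,
      hΦ.eventually (by simp)] with x h1 h2 h3 h4 u v w
    rw [fderiv_pullbackForm h1 h4, fderiv_pullbackForm h1 h4, fderiv_pullbackForm h1 h4]
    have hs : IsSymmSndFDerivAt 𝕜 Φ x := h4.isSymmSndFDerivAt (by simp)
    have h5 := h3 (fderiv 𝕜 Φ x u) (fderiv 𝕜 Φ x v) (fderiv 𝕜 Φ x w)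
    rw [hs.eq u v, hs.eq v w, hs.eq w u]
    rw [form_swap_of_alt h2 (fderiv 𝕜 Φ x v) (fderiv 𝕜 (fderiv 𝕜 Φ) x u w),
      form_swap_of_alt h2 (fderiv 𝕜 Φ x w) (fderiv 𝕜 (fderiv 𝕜 Φ) x v u),
      form_swap_of_alt h2 (fderiv 𝕜 Φ x u) (fderiv 𝕜 (fderiv 𝕜 Φ) x w v)]
    linear_combination h5

/-- A function with vanishing derivative in the first direction does not depend on the first
variable. -/
theorem eventually_eq_of_fderiv_fst_eq_zero {g : 𝕜 × F → G}
    (hg : ∀ᶠ q in 𝓝 (0 : 𝕜 × F), DifferentiableAt 𝕜 g q)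
    (h0 : ∀ᶠ q in 𝓝 (0 : 𝕜 × F), fderiv 𝕜 g q (1, 0) = 0) :
    ∀ᶠ q in 𝓝 (0 : 𝕜 × F), g q = g (0, q.2) := by
  obtain ⟨δ, hδ, h⟩ := Metric.eventually_nhds_iff.1 (hg.and h0)
  filter_upwards [Metric.ball_mem_nhds (0 : 𝕜 × F) hδ] with q hq
  rw [mem_ball_zero_iff, Prod.norm_def] at hq
  have hq1 : ‖q.1‖ < δ := (le_max_left _ _).trans_lt hq
  have hq2 : ‖q.2‖ < δ := (le_max_right _ _).trans_lt hq
  have hd (t : 𝕜) (ht : t ∈ Metric.ball (0 : 𝕜) δ) :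
      HasDerivAt (fun t => g (t, q.2)) 0 t := by
    rw [mem_ball_zero_iff] at ht
    obtain ⟨h1, h2⟩ := h (y := (t, q.2)) (by
      rw [dist_zero_right, Prod.norm_def]; exact max_lt ht hq2)
    have h3 : HasDerivAt (fun t : 𝕜 => (t, q.2)) (1, 0) t :=
      (hasDerivAt_id t).prodMk (hasDerivAt_const t q.2)
    have h4 := h1.hasFDerivAt.comp_hasDerivAt t h3
    rwa [h2] at h4
  exact Metric.isOpen_ball.is_const_of_deriv_eq_zero
    (𝕜 := 𝕜) (f := fun t => g (t, q.2)) (s := Metric.ball (0 : 𝕜) δ)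
    (by
      let _ := NormedSpace.restrictScalars ℝ 𝕜 𝕜
      exact (convex_ball (0 : 𝕜) δ).isPreconnected)
    (fun t ht => (hd t ht).differentiableAt.differentiableWithinAt)
    (fun t ht => (hd t ht).deriv) (by simpa using hq1) (by simpa using hδ)

/-- A closed 2-form whose contraction with `∂ₜ` is constant does not depend on `t`. -/
theorem IsClosedGerm.eventually_eq_of_contraction {B : 𝕜 × F → (𝕜 × F) →L[𝕜] (𝕜 × F) →L[𝕜] 𝕜}
    (hB : IsClosedGerm B 0) (l : (𝕜 × F) →L[𝕜] 𝕜) (hl : ∀ᶠ q in 𝓝 0, B q (1, 0) = l) :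
    ∀ᶠ q in 𝓝 (0 : 𝕜 × F), B q = B (0, q.2) := by
  have hd : ∀ᶠ q in 𝓝 (0 : 𝕜 × F), DifferentiableAt 𝕜 B q :=
    (hB.contDiffAt.eventually (by simp)).mono fun q hq => hq.differentiableAt (by simp)
  refine eventually_eq_of_fderiv_fst_eq_zero hd ?_
  filter_upwards [hd, hB.alt.eventually_nhds, hB.closed, hl.eventually_nhds] with q h1 h2 h3 h4
  have h5 : HasFDerivAt (fun q => B q (1, 0)) (0 : (𝕜 × F) →L[𝕜] (𝕜 × F) →L[𝕜] 𝕜) q :=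
    (hasFDerivAt_const l q).congr_of_eventuallyEq h4
  have h6 (w v : 𝕜 × F) : fderiv 𝕜 B q w (1, 0) v = 0 := by
    have := h5.unique (h1.hasFDerivAt.clm_apply (hasFDerivAt_const ((1 : 𝕜), (0 : F)) q))
    have := congrArg (fun L => L w v) this
    simpa using this.symm
  have h7 (w u v : 𝕜 × F) : fderiv 𝕜 B q w u v = - fderiv 𝕜 B q w v u := by
    have e : (fun q => B q u v) =ᶠ[𝓝 q] fun q => -B q v u :=
      h2.mono fun x hx => form_swap_of_alt hx u v
    have d (u v : 𝕜 × F) := (h1.hasFDerivAt.clm_apply (hasFDerivAt_const u q)).clm_apply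
      (hasFDerivAt_const v q)
    have := (d u v).unique ((d v u).neg.congr_of_eventuallyEq e)
    have := congrArg (fun L => L w) this
    simpa using this
  refine ContinuousLinearMap.ext fun u => ContinuousLinearMap.ext fun v => ?_
  -- Two of the three cyclic terms differentiate the constant contraction with `∂ₜ`, so they vanish;
  -- the third is the `t`-derivative of `B`.
  have := h3 (1, 0) u v
  rw [h6, h7 u, h6] at this
  simpa using this

end ClosedGerm

-- Straightening a hamiltonian vector field

section Reduction

variable {𝕜 : Type*} [RCLike 𝕜]
  {E : Type*} [NormedAddCommGroup E] [NormedSpace 𝕜 E] [FiniteDimensional 𝕜 E]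
  {W : Type*} [NormedAddCommGroup W] [NormedSpace 𝕜 W]
  {Z : Type*} [NormedAddCommGroup Z] [NormedSpace 𝕜 Z] [FiniteDimensional 𝕜 Z]

/-- The hamiltonian vector field of an analytic function is analytic. -/
theorem exists_contDiffAt_hamiltonian {B : E → E →L[𝕜] E →L[𝕜] 𝕜} {p : E}
    (hB : ContDiffAt 𝕜 ω B p) (hnd : IsNondegenerateForm (B p)) {f : E → 𝕜}
    (hf : ContDiffAt 𝕜 ω f p) :
    ∃ X : E → E, ContDiffAt 𝕜 ω X p ∧ ∀ᶠ x in 𝓝 p, B x (X x) = fderiv 𝕜 f x := by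
  have : CompleteSpace E := FiniteDimensional.complete 𝕜 E
  have hinj : Function.Injective (B p).toLinearMap := by
    rw [← LinearMap.ker_eq_bot, LinearMap.ker_eq_bot']
    intro u hu
    exact hnd u fun v => by
      have := congrArg (fun l : E →L[𝕜] 𝕜 => l v) hu
      simpa using this
  have hrank : Module.finrank 𝕜 E = Module.finrank 𝕜 (E →L[𝕜] 𝕜) := by
    rw [← (LinearMap.toContinuousLinearMap (𝕜 := 𝕜) (E := E) (F' := 𝕜)).finrank_eq]
    exact (Subspace.dual_finrank_eq (K := 𝕜) (V := E)).symm
  let e : E ≃L[𝕜] (E →L[𝕜] 𝕜) :=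
    (LinearEquiv.ofInjectiveOfFinrankEq (B p).toLinearMap hinj hrank).toContinuousLinearEquiv
  have he : (e : E →L[𝕜] (E →L[𝕜] 𝕜)) = B p := by
    ext u v; rfl
  refine ⟨fun x => (B x).inverse (fderiv 𝕜 f x), ?_, ?_⟩
  · have h1 : ContDiffAt 𝕜 ω (fun x => (B x).inverse) p := by
      refine ContDiffAt.comp p (g := ContinuousLinearMap.inverse) ?_ hB
      rw [← he]
      exact contDiffAt_map_inverse e
    exact h1.clm_apply (hf.fderiv_right (by simp))
  · have h2 : Set.range ((↑) : (E ≃L[𝕜] (E →L[𝕜] 𝕜)) → E →L[𝕜] (E →L[𝕜] 𝕜)) ∈ 𝓝 (B p) := by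
      rw [← he]
      exact ContinuousLinearEquiv.nhds e
    filter_upwards [hB.continuousAt.eventually h2] with x hx
    obtain ⟨e', he'⟩ := hx
    rw [← he', ContinuousLinearMap.inverse_equiv]
    simp

/-- Flowing out a slice `ι` along the hamiltonian vector field of `f`. -/
theorem exists_flowout {B : E → E →L[𝕜] E →L[𝕜] 𝕜} {p : E}
    (hB : IsClosedGerm B p) (hnd : IsNondegenerateForm (B p)) {f : E → 𝕜}
    (hf : ContDiffAt 𝕜 ω f p) {ι : W → E} (hι : ContDiffAt 𝕜 ω ι 0) (hι0 : ι 0 = p) :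
    ∃ Φ : 𝕜 × W → E, ContDiffAt 𝕜 ω Φ 0 ∧ Φ 0 = p ∧ (∀ᶠ w in 𝓝 0, Φ (0, w) = ι w) ∧
      (∀ᶠ q in 𝓝 0, B (Φ q) (fderiv 𝕜 Φ q (1, 0)) = fderiv 𝕜 f (Φ q)) ∧
      (∀ᶠ q in 𝓝 0, f (Φ q) = f (ι q.2)) := by
  have : CompleteSpace E := FiniteDimensional.complete 𝕜 E
  obtain ⟨X, hX, hXf⟩ := exists_contDiffAt_hamiltonian hB.contDiffAt hnd hf
  obtain ⟨φ, hφ, hφ0, hφX⟩ := exists_flow hX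
  have hφp : φ (0, p) = p := hφ0.self_of_nhds
  let σ : 𝕜 × W → 𝕜 × E := fun q => (q.1, ι q.2)
  have hι' : ContDiffAt 𝕜 ω (fun q : 𝕜 × W => ι q.2) 0 :=
    ContDiffAt.comp (g := ι) (f := Prod.snd) (0 : 𝕜 × W) hι (by fun_prop)
  have hσ : ContDiffAt 𝕜 ω σ 0 := by fun_prop
  have hσ0 : σ 0 = (0, p) := by simp [σ, hι0]
  rw [← hσ0] at hφ hφX
  have hΦ : ContDiffAt 𝕜 ω (fun q => φ (σ q)) 0 := hφ.comp 0 hσ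
  have hΦ0 : φ (σ 0) = p := by rw [hσ0, hφp]
  have hder : ∀ᶠ q in 𝓝 (0 : 𝕜 × W), fderiv 𝕜 (fun q => φ (σ q)) q (1, 0) = X (φ (σ q)) := by
    filter_upwards [hσ.continuousAt.eventually hφX,
      hσ.continuousAt.eventually (hφ.eventually (by simp)), hι'.eventually (by simp)]
      with q h1 h2 h3
    have hd : HasFDerivAt σ ((ContinuousLinearMap.fst 𝕜 𝕜 W).prod
        (fderiv 𝕜 (fun q : 𝕜 × W => ι q.2) q)) q :=
      HasFDerivAt.prodMk (ContinuousLinearMap.fst 𝕜 𝕜 W).hasFDerivAt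
        (h3.differentiableAt (by simp)).hasFDerivAt
    have h4 := (h2.differentiableAt (by simp)).hasFDerivAt.comp q hd
    have h5 : fderiv 𝕜 (fun q : 𝕜 × W => ι q.2) q (1, 0) = 0 := by
      have hc : HasDerivAt (fun t : 𝕜 => (t, q.2)) (1, 0) q.1 :=
        (hasDerivAt_id q.1).prodMk (hasDerivAt_const q.1 q.2)
      have h6 := ((h3.differentiableAt (by simp)).hasFDerivAt).comp_hasDerivAt q.1 hc
      exact h6.unique (hasDerivAt_const q.1 (ι q.2))
    have h7 : fderiv 𝕜 (fun q => φ (σ q)) q = _ := h4.fderiv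
    rw [h7, ← h1]
    simp [h5]
  have hΦc : Filter.Tendsto (fun q => φ (σ q)) (𝓝 0) (𝓝 p) := by
    have := hΦ.continuousAt.tendsto
    rwa [hΦ0] at this
  have hι2 : Filter.Tendsto ι (𝓝 0) (𝓝 p) := by
    have := hι.continuousAt.tendsto
    rwa [hι0] at this
  have h0 : ∀ᶠ w in 𝓝 (0 : W), φ (σ (0, w)) = ι w := hι2.eventually hφ0
  refine ⟨fun q => φ (σ q), hΦ, hΦ0, h0, ?_, ?_⟩
  · filter_upwards [hder, hΦc.eventually hXf] with q h1 h2
    rw [h1, h2]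
  · have hfΦ : ContDiffAt 𝕜 ω (fun q => f (φ (σ q))) 0 :=
      ContDiffAt.comp (g := f) 0 (by rwa [hΦ0]) hΦ
    -- `f` is constant along its own flow, since `df(X) = B(X, X) = 0`.
    have := eventually_eq_of_fderiv_fst_eq_zero (g := fun q => f (φ (σ q)))
      ((hfΦ.eventually (by simp)).mono fun q hq => hq.differentiableAt (by simp)) (by
        filter_upwards [hder, hΦc.eventually hXf, hΦc.eventually hB.alt,
          hΦ.eventually (by simp), hΦc.eventually (hf.eventually (by simp))] with q h1 h2 h3 h4 h5
        have := (h5.differentiableAt (by simp)).hasFDerivAt.comp q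
          (h4.differentiableAt (by simp)).hasFDerivAt
        have h7 : fderiv 𝕜 (fun q => f (φ (σ q))) q = _ := this.fderiv
        rw [h7, ContinuousLinearMap.comp_apply, h1, ← h2, h3])
    have hs : Filter.Tendsto (fun q : 𝕜 × W => q.2) (𝓝 0) (𝓝 0) := continuous_snd.tendsto' _ _ rfl
    filter_upwards [this, hs.eventually h0] with q h1 h2
    rw [h1, ← h2]

/-- Linear coordinates adapted to a covector `l` and a nonzero vector in its kernel. -/
theorem exists_linearEquiv_adapted (hdim : Module.finrank 𝕜 E = Module.finrank 𝕜 Z + 2)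
    (l : E →L[𝕜] 𝕜) (hl : l ≠ 0) (x : E) (hx : x ≠ 0) (hlx : l x = 0) :
    ∃ A : E ≃L[𝕜] 𝕜 × (𝕜 × Z), A x = (1, 0) ∧ ∀ v, (A v).2.1 = l v := by
  obtain ⟨a, ha⟩ : ∃ a : E →ₗ[𝕜] 𝕜, a x = 1 :=
    Module.Projective.exists_dual_eq_one 𝕜 hx
  obtain ⟨y, hly, hay⟩ : ∃ y, l y = 1 ∧ a y = 0 := by
    obtain ⟨y, hy⟩ : ∃ y, l y ≠ 0 := by
      by_contra! h
      exact hl (ContinuousLinearMap.ext h)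
    refine ⟨(l y)⁻¹ • y - a ((l y)⁻¹ • y) • x, ?_, ?_⟩
    · simp [hlx, hy]
    · simp [ha]
  let P : E →ₗ[𝕜] 𝕜 × 𝕜 := a.prod l.toLinearMap
  have hP : Function.Surjective P := fun c => ⟨c.1 • x + c.2 • y, by
    simp [P, ha, hay, hlx, hly]⟩
  have hker : Module.finrank 𝕜 (LinearMap.ker P) = Module.finrank 𝕜 Z := by
    have h1 := LinearMap.finrank_range_add_finrank_ker P
    rw [LinearMap.range_eq_top.2 hP, finrank_top, Module.finrank_prod, Module.finrank_self] at h1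
    omega
  let g := LinearEquiv.ofFinrankEq _ _ hker
  let π : E →ₗ[𝕜] LinearMap.ker P := LinearMap.codRestrict _
    (LinearMap.id - a.smulRight x - l.toLinearMap.smulRight y) (fun v => by
      simp [P, ha, hay, hlx, hly])
  have hπ' (v : E) : (π v : E) = v - a v • x - l v • y := rfl
  let A : E →ₗ[𝕜] 𝕜 × (𝕜 × Z) := a.prod (l.toLinearMap.prod (g.toLinearMap ∘ₗ π))
  have hA : Function.Injective A := by
    rw [← LinearMap.ker_eq_bot, LinearMap.ker_eq_bot']
    intro v hv
    have h1 : a v = 0 := congrArg Prod.fst hv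
    have h2 : l v = 0 := congrArg (fun z => z.2.1) hv
    have h3 : π v = 0 := g.injective (by
      rw [map_zero]
      exact congrArg (fun z => z.2.2) hv)
    simpa [hπ', h1, h2] using congrArg Subtype.val h3
  have hr : Module.finrank 𝕜 E = Module.finrank 𝕜 (𝕜 × (𝕜 × Z)) := by
    rw [Module.finrank_prod, Module.finrank_prod, Module.finrank_self]
    omega
  refine ⟨(LinearEquiv.ofInjectiveOfFinrankEq A hA hr).toContinuousLinearEquiv, ?_, fun v => rfl⟩
  change A x = _
  have hπ : π x = 0 := by
    apply Subtype.ext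
    rw [hπ', ha, hlx]
    simp
  have h3 : (g.toLinearMap ∘ₗ π) x = 0 := by rw [LinearMap.comp_apply, hπ, map_zero]
  exact Prod.ext ha (Prod.ext hlx h3)

/-- Coordinates `(t, s, z)` in which `f = s` and the hamiltonian vector field of `f` is `∂ₜ`. -/
theorem exists_reduction (hdim : Module.finrank 𝕜 E = Module.finrank 𝕜 Z + 2)
    {B : E → E →L[𝕜] E →L[𝕜] 𝕜} {p : E}
    (hB : IsClosedGerm B p) (hnd : IsNondegenerateForm (B p)) {f : E → 𝕜}
    (hf : ContDiffAt 𝕜 ω f p) (hfp : f p = 0) (hf' : fderiv 𝕜 f p ≠ 0) :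
    ∃ Φ : 𝕜 × (𝕜 × Z) → E, ContDiffAt 𝕜 ω Φ 0 ∧ Φ 0 = p ∧
      Function.Bijective (fderiv 𝕜 Φ 0) ∧ (∀ᶠ q in 𝓝 0, f (Φ q) = q.2.1) ∧
      ∀ᶠ q in 𝓝 0, ∀ v, pullbackForm B Φ q (1, 0) v = v.2.1 := by
  have : CompleteSpace E := FiniteDimensional.complete 𝕜 E
  obtain ⟨X, -, hX⟩ := exists_contDiffAt_hamiltonian hB.contDiffAt hnd hf
  have hXp : B p (X p) = fderiv 𝕜 f p := hX.self_of_nhds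
  have hX0 : X p ≠ 0 := fun h => hf' (by rw [← hXp, h, map_zero])
  obtain ⟨A, hAx, hAl⟩ := exists_linearEquiv_adapted (Z := Z) hdim _ hf' (X p) hX0
    (by rw [← hXp]; exact hB.alt.self_of_nhds _)
  -- The linear coordinates `A` with `s` replaced by `f`. As `A` already has `df` at `p` as its
  -- `s`-coordinate, the derivative stays `A`; the slice `t = 0` is transverse to `X p`, which `A`
  -- sends to `∂ₜ`.
  let Q : E → 𝕜 × (𝕜 × Z) := fun x => ((A (x - p)).1, (f x, (A (x - p)).2.2))
  have hQ : ContDiffAt 𝕜 ω Q p := by fun_prop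
  have hQp : Q p = 0 := by simp [Q, hfp]
  have hQd : HasFDerivAt Q (A : E →L[𝕜] 𝕜 × (𝕜 × Z)) p := by
    have h1 : HasFDerivAt (fun x => A (x - p)) (A : E →L[𝕜] 𝕜 × (𝕜 × Z)) p :=
      A.hasFDerivAt.comp p ((hasFDerivAt_id p).sub_const p)
    have h2 := (hf.differentiableAt (by simp)).hasFDerivAt
    have h3 := h1.fst.prodMk (h2.prodMk h1.snd.snd)
    convert! h3 using 1
    ext v <;> simp [hAl]
  have hω : (ω : WithTop ℕ∞) ≠ 0 := by simp
  let R := hQ.localInverse hQd hω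
  have hstr := hQ.hasStrictFDerivAt' hQd hω
  have hR : ContDiffAt 𝕜 ω R 0 := by
    have := hQ.to_localInverse hQd hω
    rwa [hQp] at this
  have hR0 : R 0 = p := by
    rw [← hQp]; exact hQ.localInverse_apply_image hQd hω
  have hRd : HasFDerivAt R (A.symm : 𝕜 × (𝕜 × Z) →L[𝕜] E) 0 := by
    have := hstr.to_localInverse.hasFDerivAt
    rwa [hQp] at this
  have hQR : ∀ᶠ y in 𝓝 (0 : 𝕜 × (𝕜 × Z)), Q (R y) = y := by
    rw [← hQp]; exact hstr.eventually_right_inverse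
  have hinc : HasFDerivAt (fun w : 𝕜 × Z => ((0 : 𝕜), w))
    (ContinuousLinearMap.inr 𝕜 𝕜 (𝕜 × Z)) 0 := (ContinuousLinearMap.inr 𝕜 𝕜 (𝕜 × Z)).hasFDerivAt
  have hι : ContDiffAt 𝕜 ω (fun w : 𝕜 × Z => R (0, w)) 0 :=
    ContDiffAt.comp (g := R) (0 : 𝕜 × Z) hR (by fun_prop)
  obtain ⟨Φ, hΦ, hΦ0, hΦι, hΦB, hΦf⟩ := exists_flowout hB hnd hf hι hR0
  have hfs : ∀ᶠ q in 𝓝 (0 : 𝕜 × (𝕜 × Z)), f (Φ q) = q.2.1 := by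
    have hs : Filter.Tendsto (fun q : 𝕜 × (𝕜 × Z) => ((0 : 𝕜), q.2)) (𝓝 0) (𝓝 0) :=
      Continuous.tendsto' (by fun_prop) _ _ rfl
    filter_upwards [hΦf, hs.eventually hQR] with q h1 h2
    rw [h1]
    exact congrArg (fun z => z.2.1) h2
  refine ⟨Φ, hΦ, hΦ0, ?_, hfs, ?_⟩
  · have hd := (hΦ.differentiableAt (by simp)).hasFDerivAt
    have h1 : fderiv 𝕜 Φ 0 (1, 0) = X p := by
      have h2 := hΦB.self_of_nhds
      rw [hΦ0, ← hXp] at h2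
      rw [← sub_eq_zero]
      refine hnd _ fun v => ?_
      have h3 := congrArg (fun l : E →L[𝕜] 𝕜 => l v) h2
      simp only [map_sub, sub_apply]
      exact sub_eq_zero.2 h3
    have h2 (w : 𝕜 × Z) : fderiv 𝕜 Φ 0 (0, w) = A.symm (0, w) := by
      have d1 := HasFDerivAt.comp (0 : 𝕜 × Z) (g := R) hRd hinc
      have d2 := HasFDerivAt.comp (0 : 𝕜 × Z) (g := Φ) hd hinc
      have := d1.unique (d2.congr_of_eventuallyEq (hΦι.mono fun w hw => hw.symm))
      have := congrArg (fun l => l w) this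
      simpa using this.symm
    -- The flowout agrees to first order with `A⁻¹`: along `∂ₜ` it moves with velocity `X p`, and on
    -- the slice it is `R`.
    have h3 : fderiv 𝕜 Φ 0 = (A.symm : 𝕜 × (𝕜 × Z) →L[𝕜] E) := by
      refine ContinuousLinearMap.ext fun v => ?_
      have hv : v = v.1 • ((1 : 𝕜), (0 : 𝕜 × Z)) + (0, v.2) := by simp
      have e : A.symm (1, 0) = X p := by rw [← hAx, A.symm_apply_apply]
      rw [hv, map_add, map_smul, h1, h2]
      simp only [map_add, map_smul, ContinuousLinearEquiv.coe_coe, e]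
    rw [h3]
    exact A.symm.bijective
  · have hfc : Filter.Tendsto Φ (𝓝 0) (𝓝 p) := by
      have := hΦ.continuousAt.tendsto
      rwa [hΦ0] at this
    filter_upwards [hΦB, hfs.eventually_nhds, hΦ.eventually (by simp),
      hfc.eventually (hf.eventually (by simp))] with q h1 h2 h3 h4 v
    -- The pulled-back form contracted with `∂ₜ` is `df ∘ DΦ = d(f ∘ Φ) = ds`.
    rw [pullbackForm_apply, h1]
    have d1 := (h4.differentiableAt (by simp)).hasFDerivAt.comp q
      (h3.differentiableAt (by simp)).hasFDerivAt
    have d2 : HasFDerivAt (fun q : 𝕜 × (𝕜 × Z) => q.2.1) (ContinuousLinearMap.fst 𝕜 𝕜 Z ∘L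
      ContinuousLinearMap.snd 𝕜 𝕜 (𝕜 × Z)) q := (ContinuousLinearMap.fst 𝕜 𝕜 Z ∘L
      ContinuousLinearMap.snd 𝕜 𝕜 (𝕜 × Z)).hasFDerivAt
    have := congrArg (fun l => l v) (d2.unique (d1.congr_of_eventuallyEq
      (h2.mono fun q hq => hq.symm)))
    simpa using this.symm

end Reduction

-- Symplectic reduction charts and the analytic Darboux theorem

section Darboux

variable {𝕜 : Type*} [RCLike 𝕜]
  {E : Type*} [NormedAddCommGroup E] [NormedSpace 𝕜 E]

theorem stdAlt_apply (m : ℕ) (u v : StdSpace 𝕜 m) :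
    stdAlt 𝕜 m ![u, v] = ∑ i, (u.1 i * v.2 i - v.1 i * u.2 i) := rfl

theorem stdAlt_nondegenerate (m : ℕ) (u : StdSpace 𝕜 m) (hu : ∀ v, stdAlt 𝕜 m ![u, v] = 0) :
    u = 0 :=
  (stdForm 𝕜 m).nondegenerate 0 u hu

theorem finrank_stdSpace (m : ℕ) : Module.finrank 𝕜 (StdSpace 𝕜 m) = 2 * m := by
  simp [two_mul]

variable (𝕜) in
/-- Every symplectic germ on `𝕜^{2m}` is isomorphic to the standard one. -/
def DarbouxProperty (m : ℕ) : Prop :=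
  ∀ (B : StdSpace 𝕜 m → StdSpace 𝕜 m →L[𝕜] StdSpace 𝕜 m →L[𝕜] 𝕜) (p : StdSpace 𝕜 m),
    IsClosedGerm B p → IsNondegenerateForm (B p) →
    ∃ Φ : StdSpace 𝕜 m → StdSpace 𝕜 m, ContDiffAt 𝕜 ω Φ 0 ∧ Φ 0 = p ∧
      ∀ᶠ y in 𝓝 0, ∀ u v, pullbackForm B Φ y u v = stdAlt 𝕜 m ![u, v]

/-- `Φ` gives coordinates `(t, s, z)` around `p` in which `f = s`, the hamiltonian vector field of
`f` is `∂ₜ`, and the form induced on the symplectic reduction of `{f = 0}` is the standard one. -/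
structure IsReductionChart (m : ℕ) (B : E → E →L[𝕜] E →L[𝕜] 𝕜) (p : E) (f : E → 𝕜)
    (Φ : 𝕜 × (𝕜 × StdSpace 𝕜 m) → E) : Prop where
  contDiffAt : ContDiffAt 𝕜 ω Φ 0
  map_zero : Φ 0 = p
  bijective : Function.Bijective (fderiv 𝕜 Φ 0)
  eq_snd : ∀ᶠ q in 𝓝 0, f (Φ q) = q.2.1
  contraction : ∀ᶠ q in 𝓝 0, ∀ v, pullbackForm B Φ q (1, 0) v = v.2.1
  reduced : ∀ᶠ z in 𝓝 0, ∀ u v, pullbackForm B Φ (0, (0, z)) (0, (0, u)) (0, (0, v))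
    = stdAlt 𝕜 m ![u, v]

/-- The form induced on the slice `t = s = 0` is again closed and nondegenerate, so Darboux in
dimension `2m` normalizes it. The resulting change of the `z`-coordinates leaves `t` and `s` alone
and so keeps the contraction with `∂ₜ`. Taking Darboux as a hypothesis lets this lemma serve as the
inductive step of its proof. -/
theorem exists_isReductionChart [FiniteDimensional 𝕜 E] {m : ℕ} (hD : DarbouxProperty 𝕜 m)
    (hdim : Module.finrank 𝕜 E = 2 * (m + 1))
    {B : E → E →L[𝕜] E →L[𝕜] 𝕜} {p : E}
    (hB : IsClosedGerm B p) (hnd : IsNondegenerateForm (B p)) {f : E → 𝕜}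
    (hf : ContDiffAt 𝕜 ω f p) (hfp : f p = 0) (hf' : fderiv 𝕜 f p ≠ 0) :
    ∃ Φ, IsReductionChart m B p f Φ := by
  obtain ⟨Φ, hΦ, hΦ0, hbij, hs, hc⟩ := exists_reduction (Z := StdSpace 𝕜 m)
    (by rw [finrank_stdSpace]; omega) hB hnd hf hfp hf'
  let j : StdSpace 𝕜 m →L[𝕜] 𝕜 × (𝕜 × StdSpace 𝕜 m) :=
    ContinuousLinearMap.inr 𝕜 𝕜 (𝕜 × StdSpace 𝕜 m) ∘L ContinuousLinearMap.inr 𝕜 𝕜 (StdSpace 𝕜 m)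
  have hj (z) : j z = (0, (0, z)) := rfl
  have hB1 : IsClosedGerm (pullbackForm B Φ) 0 := by
    rw [← hΦ0] at hB
    exact hB.pullbackForm hΦ
  have hB0 : IsClosedGerm (pullbackForm (pullbackForm B Φ) j) 0 :=
    IsClosedGerm.pullbackForm (by simpa using hB1) j.contDiff.contDiffAt
  have halt := hB1.alt.self_of_nhds
  have hnd1 : IsNondegenerateForm (pullbackForm B Φ 0) := by
    intro u hu
    apply hbij.injective
    rw [_root_.map_zero]
    refine hnd _ fun v => ?_
    obtain ⟨w, rfl⟩ := hbij.surjective v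
    rw [← hΦ0]
    exact hu w
  have hnd0 : IsNondegenerateForm (pullbackForm (pullbackForm B Φ) j 0) := by
    intro u hu
    have hu' (v) : pullbackForm B Φ 0 (0, (0, u)) (0, (0, v)) = 0 := by
      have := hu v
      rw [pullbackForm_apply, j.fderiv, _root_.map_zero] at this
      exact this
    have hc0 := hc.self_of_nhds
    -- The multiple of `∂ₜ` that makes `τ ∂ₜ + u` orthogonal to `∂ₛ`. If `u` is in the kernel of the
    -- reduced form, this vector is in the kernel of the whole form, hence zero.
    let τ : 𝕜 := - pullbackForm B Φ 0 (0, (0, u)) (0, (1, 0))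
    have h := hnd1 (τ • ((1 : 𝕜), (0 : 𝕜 × StdSpace 𝕜 m)) + (0, (0, u))) (fun v => by
      have hv : v = v.1 • ((1 : 𝕜), (0 : 𝕜 × StdSpace 𝕜 m)) + v.2.1 • (0, ((1 : 𝕜), 0))
          + (0, (0, v.2.2)) := by
        refine Prod.ext ?_ (Prod.ext ?_ ?_) <;> simp
      rw [map_add, map_smul, add_apply, smul_apply, hc0]
      rw [hv, map_add, map_add, map_smul, map_smul, hu', form_swap_of_alt halt _ (1, 0), hc0]
      simp [τ]
      ring)
    have := congrArg (fun z => z.2.2) h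
    simpa using this
  obtain ⟨Ψ, hΨ, hΨ0, hΨB⟩ := hD _ 0 hB0 hnd0
  -- `DarbouxProperty` does not demand a local isomorphism: this is automatic, since the pullback by
  -- `Ψ` is nondegenerate.
  have hΨinj : Function.Injective (fderiv 𝕜 Ψ 0) := by
    refine (injective_iff_map_eq_zero _).2 fun u hu => stdAlt_nondegenerate m u fun v => ?_
    rw [← hΨB.self_of_nhds, pullbackForm_apply, hu, _root_.map_zero, zero_apply]
  have hΨbij : Function.Bijective (fderiv 𝕜 Ψ 0) :=
    ⟨hΨinj, LinearMap.surjective_of_injective (f := (fderiv 𝕜 Ψ 0).toLinearMap) hΨinj⟩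
  let θ : 𝕜 × (𝕜 × StdSpace 𝕜 m) → 𝕜 × (𝕜 × StdSpace 𝕜 m) := fun q => (q.1, (q.2.1, Ψ q.2.2))
  have hΨ2 : ContDiffAt 𝕜 ω (fun q : 𝕜 × (𝕜 × StdSpace 𝕜 m) => Ψ q.2.2) 0 :=
    ContDiffAt.comp (g := Ψ) (f := fun q : 𝕜 × (𝕜 × StdSpace 𝕜 m) => q.2.2) 0 hΨ (by fun_prop)
  have hθ : ContDiffAt 𝕜 ω θ 0 := by fun_prop
  have hθ0 : θ 0 = 0 := by simp [θ, hΨ0]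
  have hθd (q : 𝕜 × (𝕜 × StdSpace 𝕜 m)) (hq : DifferentiableAt 𝕜 Ψ q.2.2) :
      HasFDerivAt θ ((ContinuousLinearMap.id 𝕜 𝕜).prodMap ((ContinuousLinearMap.id 𝕜 𝕜).prodMap
        (fderiv 𝕜 Ψ q.2.2))) q :=
    HasFDerivAt.prodMap q (hasFDerivAt_id q.1) (HasFDerivAt.prodMap q.2 (hasFDerivAt_id q.2.1)
      hq.hasFDerivAt)
  have hΨd : ∀ᶠ z in 𝓝 0, DifferentiableAt 𝕜 Ψ z :=
    (hΨ.eventually (by simp)).mono fun z hz => hz.differentiableAt (by simp)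
  have hΦd : ∀ᶠ q in 𝓝 0, DifferentiableAt 𝕜 Φ q :=
    (hΦ.eventually (by simp)).mono fun z hz => hz.differentiableAt (by simp)
  have hzt : Filter.Tendsto (fun q : 𝕜 × (𝕜 × StdSpace 𝕜 m) => q.2.2) (𝓝 0) (𝓝 0) :=
    Continuous.tendsto' (by fun_prop) _ _ rfl
  have hθt : Filter.Tendsto θ (𝓝 0) (𝓝 0) := by
    have := hθ.continuousAt.tendsto
    rwa [hθ0] at this
  have hjt : Filter.Tendsto j (𝓝 0) (𝓝 0) := j.continuous.tendsto' _ _ (by simp)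
  have hpull : ∀ᶠ q in 𝓝 0, ∀ u v : 𝕜 × (𝕜 × StdSpace 𝕜 m), pullbackForm B (Φ ∘ θ) q u v =
      pullbackForm B Φ (θ q) (u.1, (u.2.1, fderiv 𝕜 Ψ q.2.2 u.2.2))
        (v.1, (v.2.1, fderiv 𝕜 Ψ q.2.2 v.2.2)) := by
    filter_upwards [hzt.eventually hΨd, hθt.eventually hΦd] with q h1 h2 u v
    rw [pullbackForm_comp h2 (hθd q h1).differentiableAt, pullbackForm_apply, (hθd q h1).fderiv]
    rfl
  refine ⟨Φ ∘ θ, ⟨?_, ?_, ?_, ?_, ?_, ?_⟩⟩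
  · exact ContDiffAt.comp 0 (by rwa [hθ0]) hθ
  · simp [hθ0, hΦ0]
  · rw [fderiv_comp 0 (by rw [hθ0]; exact hΦd.self_of_nhds)
      (hθd 0 hΨd.self_of_nhds).differentiableAt, (hθd 0 hΨd.self_of_nhds).fderiv, hθ0]
    exact hbij.comp (Function.bijective_id.prodMap (Function.bijective_id.prodMap hΨbij))
  · filter_upwards [hθt.eventually hs] with q hq
    exact hq
  · filter_upwards [hpull, hθt.eventually hc] with q h1 h2 v
    rw [h1]
    have : fderiv 𝕜 Ψ q.2.2 (0 : StdSpace 𝕜 m) = 0 := _root_.map_zero _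
    simp only [Prod.snd_zero, Prod.fst_zero, this]
    exact h2 _
  · filter_upwards [hjt.eventually hpull, hΨB] with z h1 h2 u v
    have h3 := h1 (0, (0, u)) (0, (0, v))
    rw [hj] at h3
    rw [h3, ← h2, pullbackForm_apply _ Ψ, pullbackForm_apply _ j, j.fderiv]
    rfl

theorem IsReductionChart.isClosedGerm {m : ℕ} {B : E → E →L[𝕜] E →L[𝕜] 𝕜} {p : E} {f : E → 𝕜}
    {Φ : 𝕜 × (𝕜 × StdSpace 𝕜 m) → E} (h : IsReductionChart m B p f Φ) (hB : IsClosedGerm B p) :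
    IsClosedGerm (pullbackForm B Φ) 0 := by
  rw [← h.map_zero] at hB
  exact hB.pullbackForm h.contDiffAt

/-- On the hypersurface `s = 0`, the form is the pullback of the standard form. -/
theorem IsReductionChart.form_eq {m : ℕ} {B : E → E →L[𝕜] E →L[𝕜] 𝕜} {p : E} {f : E → 𝕜}
    {Φ : 𝕜 × (𝕜 × StdSpace 𝕜 m) → E} (h : IsReductionChart m B p f Φ) (hB : IsClosedGerm B p) :
    ∀ᶠ q in 𝓝 (0 : 𝕜 × StdSpace 𝕜 m), ∀ (a b : 𝕜) (u v : StdSpace 𝕜 m),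
      pullbackForm B Φ (q.1, (0, q.2)) (a, (0, u)) (b, (0, v)) = stdAlt 𝕜 m ![u, v] := by
  have hB1 := h.isClosedGerm hB
  -- The form does not depend on `t`, so it may be computed at `t = 0`; the `∂ₜ` components pair to
  -- `ds`, which vanishes on the vectors considered.
  have hind := hB1.eventually_eq_of_contraction
    (ContinuousLinearMap.fst 𝕜 𝕜 (StdSpace 𝕜 m) ∘L ContinuousLinearMap.snd 𝕜 𝕜 _)
    (h.contraction.mono fun q hq => ContinuousLinearMap.ext hq)
  have hit : Filter.Tendsto (fun q : 𝕜 × StdSpace 𝕜 m => (q.1, ((0 : 𝕜), q.2))) (𝓝 0) (𝓝 0) :=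
    Continuous.tendsto' (by fun_prop) _ _ rfl
  have hzt : Filter.Tendsto (fun q : 𝕜 × StdSpace 𝕜 m => q.2) (𝓝 0) (𝓝 0) :=
    Continuous.tendsto' (by fun_prop) _ _ rfl
  filter_upwards [hit.eventually hind, hit.eventually h.contraction, hit.eventually hB1.alt,
    hzt.eventually h.reduced] with q h1 h2 h3 h4 a b u v
  have hv (b : 𝕜) (v : StdSpace 𝕜 m) : (b, ((0 : 𝕜), v))
      = b • ((1 : 𝕜), (0 : 𝕜 × StdSpace 𝕜 m)) + (0, (0, v)) := by simp
  rw [hv a u, map_add, map_smul, add_apply, smul_apply, h2, hv b v, map_add, map_smul,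
    form_swap_of_alt h3 _ (1, 0), h2, h1, h4]
  simp

variable (𝕜) in
/-- Analytic Darboux theorem. -/
theorem darbouxProperty (m : ℕ) : DarbouxProperty 𝕜 m := by
  induction m with
  | zero =>
    intro B p _ _
    refine ⟨fun _ => p, contDiffAt_const, rfl, Filter.Eventually.of_forall fun y u v => ?_⟩
    rw [stdAlt_apply, Subsingleton.elim u 0]
    simp
  | succ m ih =>
    intro B p hB hnd
    -- The proof only uses that this linear form is nonzero.
    let l : StdSpace 𝕜 (m + 1) →L[𝕜] 𝕜 :=
      ContinuousLinearMap.proj (0 : Fin (m + 1)) ∘L ContinuousLinearMap.fst 𝕜 _ _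
    have hl : l ≠ 0 := fun h => by
      have := congrArg (fun l' => l' ((fun _ => 1, 0) : StdSpace 𝕜 (m + 1))) h
      simp [l] at this
    have hlf : fderiv 𝕜 (fun x => l (x - p)) p = l :=
      (l.hasFDerivAt.comp p ((hasFDerivAt_id p).sub_const p)).fderiv
    obtain ⟨Φ, hΦ⟩ := exists_isReductionChart ih (finrank_stdSpace (m + 1)) hB hnd
      (f := fun x => l (x - p)) (by fun_prop) (by simp) (by rwa [hlf])
    have hB1 := hΦ.isClosedGerm hB
    have hnd1 : IsNondegenerateForm (pullbackForm B Φ 0) := by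
      intro u hu
      apply hΦ.bijective.injective
      rw [_root_.map_zero]
      refine hnd _ fun v => ?_
      obtain ⟨w, rfl⟩ := hΦ.bijective.surjective v
      rw [← hΦ.map_zero]
      exact hu w
    let ι : 𝕜 × StdSpace 𝕜 m →L[𝕜] 𝕜 × (𝕜 × StdSpace 𝕜 m) :=
      (ContinuousLinearMap.fst 𝕜 _ _).prod
        ((0 : 𝕜 × StdSpace 𝕜 m →L[𝕜] 𝕜).prod (ContinuousLinearMap.snd 𝕜 _ _))
    have hι (w) : ι w = (w.1, (0, w.2)) := rfl
    -- The hypersurface `s = 0` is flowed out along the hamiltonian field of `t`. The time of this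
    -- flow and `t` become the first conjugate pair; the time replaces `s`.
    obtain ⟨Θ, hΘ, hΘ0, hΘι, hΘB, hΘf⟩ := exists_flowout hB1 hnd1 (f := Prod.fst) (by fun_prop)
      (ι := ι) ι.contDiff.contDiffAt (by simp)
    have hΘt : Filter.Tendsto Θ (𝓝 0) (𝓝 0) := by
      have := hΘ.continuousAt.tendsto
      rwa [hΘ0] at this
    have hΘd : ∀ᶠ q in 𝓝 0, DifferentiableAt 𝕜 Θ q :=
      (hΘ.eventually (by simp)).mono fun z hz => hz.differentiableAt (by simp)
    have hB2 : IsClosedGerm (pullbackForm (pullbackForm B Φ) Θ) 0 := by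
      rw [← hΘ0] at hB1
      exact hB1.pullbackForm hΘ
    have hc : ∀ᶠ q in 𝓝 0, pullbackForm (pullbackForm B Φ) Θ q (1, 0) =
        ContinuousLinearMap.fst 𝕜 𝕜 (StdSpace 𝕜 m) ∘L ContinuousLinearMap.snd 𝕜 𝕜 _ := by
      filter_upwards [hΘB, hΘf.eventually_nhds, hΘd] with q h1 h2 h3
      refine ContinuousLinearMap.ext fun v => ?_
      rw [pullbackForm_apply, h1]
      have d1 := HasFDerivAt.comp q (hasFDerivAt_fst (𝕜 := 𝕜) (p := Θ q)) h3.hasFDerivAt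
      have d2 := (ContinuousLinearMap.fst 𝕜 𝕜 (StdSpace 𝕜 m) ∘L
        ContinuousLinearMap.snd 𝕜 𝕜 (𝕜 × StdSpace 𝕜 m)).hasFDerivAt (x := q)
      have := congrArg (fun l => l v) (d2.unique (d1.congr_of_eventuallyEq
        (h2.mono fun q hq => hq.symm)))
      rw [hasFDerivAt_fst.fderiv]
      exact this.symm
    have hind := hB2.eventually_eq_of_contraction _ hc
    have hwt : Filter.Tendsto (fun q : 𝕜 × (𝕜 × StdSpace 𝕜 m) => q.2) (𝓝 0) (𝓝 0) :=
      Continuous.tendsto' (by fun_prop) _ _ rfl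
    have hw0t : Filter.Tendsto (fun q : 𝕜 × (𝕜 × StdSpace 𝕜 m) => ((0 : 𝕜), q.2)) (𝓝 0) (𝓝 0) :=
      Continuous.tendsto' (by fun_prop) _ _ rfl
    -- Contraction with the new flow direction is the constant covector `dt`, so the form is
    -- independent of the flow time and is determined on `s = 0`, where `IsReductionChart.form_eq`
    -- gives it.
    have hform : ∀ᶠ q in 𝓝 (0 : 𝕜 × (𝕜 × StdSpace 𝕜 m)), ∀ u v,
        pullbackForm (pullbackForm B Φ) Θ q u v
          = u.1 * v.2.1 - v.1 * u.2.1 + stdAlt 𝕜 m ![u.2.2, v.2.2] := by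
      filter_upwards [hind, hc, hB2.alt, hwt.eventually (hΦ.form_eq hB),
        hwt.eventually hΘι.eventually_nhds, hw0t.eventually hΘd] with q h1 h2 h3 h4 h5 h6 u v
      have hd (w : 𝕜 × StdSpace 𝕜 m) : fderiv 𝕜 Θ (0, q.2) (0, w) = (w.1, (0, w.2)) := by
        have d1 := HasFDerivAt.comp q.2 (f := fun w => ((0 : 𝕜), w)) h6.hasFDerivAt
          (ContinuousLinearMap.inr 𝕜 𝕜 (𝕜 × StdSpace 𝕜 m)).hasFDerivAt
        have := (ι.hasFDerivAt (x := q.2)).unique (d1.congr_of_eventuallyEq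
          (h5.mono fun w hw => hw.symm))
        exact (congrArg (fun l => l w) this).symm
      have h7 : Θ (0, q.2) = (q.2.1, (0, q.2.2)) := h5.self_of_nhds
      have h8 (w w' : 𝕜 × StdSpace 𝕜 m) : pullbackForm (pullbackForm B Φ) Θ q (0, w) (0, w')
          = stdAlt 𝕜 m ![w.2, w'.2] := by
        rw [h1, pullbackForm_apply _ Θ, hd, hd, h7, h4]
      have hu (u : 𝕜 × (𝕜 × StdSpace 𝕜 m)) : u
          = u.1 • ((1 : 𝕜), (0 : 𝕜 × StdSpace 𝕜 m)) + (0, u.2) := by simp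
      rw [hu u, map_add, map_smul, add_apply, smul_apply, h2, hu v, map_add, map_smul,
        map_add, map_smul, form_swap_of_alt h3 _ (1, 0), h2, h8]
      simp
      ring
    let T : StdSpace 𝕜 (m + 1) →L[𝕜] 𝕜 × (𝕜 × StdSpace 𝕜 m) := LinearMap.toContinuousLinearMap
      { toFun := fun x => (x.1 0, (x.2 0, (fun i => x.1 i.succ, fun i => x.2 i.succ)))
        map_add' := fun _ _ => rfl
        map_smul' := fun _ _ => rfl }
    have hT (x) : T x = (x.1 0, (x.2 0, (fun i => x.1 i.succ, fun i => x.2 i.succ))) := rfl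
    have hTt : Filter.Tendsto T (𝓝 0) (𝓝 0) := T.continuous.tendsto' _ _ (by simp)
    refine ⟨Φ ∘ (Θ ∘ T), ?_, ?_, ?_⟩
    · refine ContDiffAt.comp 0 ?_ (ContDiffAt.comp 0 ?_ T.contDiff.contDiffAt)
      · simpa [hΘ0] using hΦ.contDiffAt
      · simpa using hΘ
    · simp [hΘ0, hΦ.map_zero]
    · have hΦd : ∀ᶠ q in 𝓝 0, DifferentiableAt 𝕜 Φ q :=
        (hΦ.contDiffAt.eventually (by simp)).mono fun z hz => hz.differentiableAt (by simp)
      filter_upwards [hTt.eventually hform, hTt.eventually hΘd,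
        (hΘt.comp hTt).eventually hΦd] with x h1 h2 h3 u v
      rw [pullbackForm_comp (Θ := Θ ∘ T) h3 (h2.comp x T.differentiableAt),
        pullbackForm_comp h2 T.differentiableAt, pullbackForm_apply _ T, T.fderiv, h1, hT, hT,
        stdAlt_apply, stdAlt_apply, Fin.sum_univ_succ]

end Darboux

-- Hadamard's lemma

section Hadamard

variable {𝕜 : Type*} [RCLike 𝕜]
  {E : Type*} [NormedAddCommGroup E] [NormedSpace 𝕜 E]

/-- Hadamard's lemma for analytic functions. -/
theorem exists_eq_add_apply_sub {k : E → 𝕜} {a : E} (hk : ContDiffAt 𝕜 ω k a) :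
    ∃ g : E → E →L[𝕜] 𝕜, ContDiffAt 𝕜 ω g a ∧ g a = fderiv 𝕜 k a ∧
      ∀ᶠ y in 𝓝 a, k y = k a + g y (y - a) := by
  obtain ⟨P, hP⟩ := hk.analyticAt
  have hrad : 0 < P.shift.radius := by
    rw [P.radius_shift]
    exact hP.radius_pos
  have h1 := (P.shift.hasFPowerSeriesOnBall hrad)
  have h2 : HasFPowerSeriesOnBall (fun y => P.shift.sum (y - a)) P.shift a P.shift.radius := by
    simpa using h1.comp_sub a
  have h3 := (h2.unshift (z := k a)).hasFPowerSeriesAt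
  -- The shift frees one argument in each Taylor term of positive degree. Evaluating it at `y - a`
  -- and adding the constant `k a` recovers the original series.
  have h4 : P.shift.unshift (k a) = P := by
    funext n
    cases n with
    | zero =>
      ext v
      exact (hP.coeff_zero v).symm
    | succ n =>
      exact (continuousMultilinearCurryRightEquiv' 𝕜 n E 𝕜).symm_apply_apply (P (n + 1))
  rw [h4] at h3
  have h5 : k =ᶠ[𝓝 a] fun y => k a + P.shift.sum (y - a) (y - a) := by
    filter_upwards [HasFPowerSeriesAt.eventually_hasSum_sub hP,
      HasFPowerSeriesAt.eventually_hasSum_sub h3] with y hy1 hy2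
    exact hy1.unique hy2
  have hg : ContDiffAt 𝕜 ω (fun y => P.shift.sum (y - a)) a := h2.analyticAt.contDiffAt
  refine ⟨fun y => P.shift.sum (y - a), hg, ?_, h5⟩
  have h6 := ((hg.differentiableAt (by simp)).hasFDerivAt.clm_apply
    ((hasFDerivAt_id a).sub_const a)).const_add (k a)
  have h7 := (h6.congr_of_eventuallyEq h5).fderiv
  rw [h7]
  ext v
  simp

end Hadamard

-- Cotangent spaces of quotients, and embedding dimension

section Cotangent

variable {𝕜 R V : Type*} [Field 𝕜] [CommRing R] [Algebra 𝕜 R] [AddCommGroup V] [Module 𝕜 V]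
  [FiniteDimensional 𝕜 V]

/-- The cotangent space of the ideal induced by `P` in `R / I`, computed by means of a
"differential" `d`. -/
theorem finrank_cotangent_quotient_add (P I : Ideal R) (hIP : I ≤ P) (d : R →ₗ[𝕜] V)
    (hd : ∀ v, ∃ f ∈ P, d f = v) (hsq : ∀ f ∈ P ^ 2, d f = 0)
    (hker : ∀ f ∈ P, d f = 0 → ∃ g ∈ P ^ 2, g - f ∈ I) :
    Module.finrank 𝕜 (P.map (Ideal.Quotient.mk I)).Cotangent
      + Module.finrank 𝕜 ((I.restrictScalars 𝕜).map d) = Module.finrank 𝕜 V := by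
  let m := P.map (Ideal.Quotient.mk I)
  let C := (I.restrictScalars 𝕜).map d
  have hmem (f : P.restrictScalars 𝕜) : Ideal.Quotient.mk I f.1 ∈ m := Ideal.mem_map_of_mem _ f.2
  let T : (P.restrictScalars 𝕜) →ₗ[𝕜] m.Cotangent :=
    { toFun := fun f => m.toCotangent ⟨Ideal.Quotient.mk I f.1, hmem f⟩
      map_add' := fun f g => by
        rw [← map_add]
        rfl
      map_smul' := fun c f => by
        rw [RingHom.id_apply, ← algebraMap_smul (R ⧸ I) c (m.toCotangent _), ← map_smul]
        congr 1
        apply Subtype.ext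
        change Ideal.Quotient.mk I (c • f.1) = algebraMap 𝕜 (R ⧸ I) c * _
        rw [Algebra.smul_def, map_mul]
        rfl }
  have hT : Function.Surjective T := by
    intro y
    obtain ⟨⟨x, hx⟩, rfl⟩ := m.toCotangent_surjective y
    obtain ⟨f, hf, rfl⟩ := (Ideal.mem_map_iff_of_surjective _ Ideal.Quotient.mk_surjective).1 hx
    exact ⟨⟨f, hf⟩, rfl⟩
  let S : (P.restrictScalars 𝕜) →ₗ[𝕜] V ⧸ C := C.mkQ ∘ₗ d ∘ₗ (P.restrictScalars 𝕜).subtype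
  have hS : Function.Surjective S := by
    refine (Submodule.mkQ_surjective _).comp fun v => ?_
    obtain ⟨f, hf, rfl⟩ := hd v
    exact ⟨⟨f, hf⟩, rfl⟩
  -- For `f ∈ P`, both kernels say that `f` lies in `I + P²`: for `T` by definition, for `S` because
  -- `d` kills `P²` and an element of `P` killed by `d` is in `P²` modulo `I`. Hence `𝔪/𝔪²` is `V /
  -- d(I)`.
  have hTS : LinearMap.ker T = LinearMap.ker S := by
    ext ⟨f, hf⟩
    have h1 : (⟨f, hf⟩ : P.restrictScalars 𝕜) ∈ LinearMap.ker T ↔ ∃ g ∈ P ^ 2, g - f ∈ I := by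
      rw [LinearMap.mem_ker]
      change m.toCotangent ⟨Ideal.Quotient.mk I f, _⟩ = 0 ↔ _
      rw [Ideal.toCotangent_eq_zero]
      change Ideal.Quotient.mk I f ∈ (P.map (Ideal.Quotient.mk I)) ^ 2 ↔ _
      rw [← Ideal.map_pow, Ideal.mem_map_iff_of_surjective _ Ideal.Quotient.mk_surjective]
      simp only [Ideal.Quotient.eq]
    have h2 : (⟨f, hf⟩ : P.restrictScalars 𝕜) ∈ LinearMap.ker S ↔ ∃ g ∈ I, d g = d f := by
      rw [LinearMap.mem_ker]
      change C.mkQ (d f) = 0 ↔ _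
      rw [Submodule.mkQ_apply, Submodule.Quotient.mk_eq_zero]
      rfl
    rw [h1, h2]
    constructor
    · rintro ⟨g, hg, hgf⟩
      refine ⟨f - g, ?_, ?_⟩
      · rw [← neg_sub]
        exact neg_mem hgf
      · rw [map_sub, hsq g hg, sub_zero]
    · rintro ⟨g, hg, hgf⟩
      obtain ⟨k, hk, hkf⟩ := hker (f - g) (sub_mem hf (hIP hg)) (by rw [map_sub, hgf, sub_self])
      refine ⟨k, hk, ?_⟩
      have : k - f = (k - (f - g)) - g := by ring
      rw [this]
      exact sub_mem hkf hg
  have e := (T.quotKerEquivOfSurjective hT).symm.trans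
    ((Submodule.quotEquivOfEq _ _ hTS).trans (S.quotKerEquivOfSurjective hS))
  rw [e.finrank_eq]
  exact Submodule.finrank_quotient_add_finrank C

end Cotangent

section EmbeddingDimension

variable {𝕜 : Type*} [RCLike 𝕜]
  {E : Type*} [NormedAddCommGroup E] [NormedSpace 𝕜 E]
  {M : Type*} [TopologicalSpace M] [ChartedSpace E M]

variable (𝕜 E) in
/-- The differential at `p`. -/
def differentialAt (p : M) : analyticFunctions 𝕜 E p →ₗ[𝕜] (E →L[𝕜] 𝕜) where
  toFun f := mfderiv 𝓘(𝕜, E) 𝓘(𝕜, 𝕜) f.1 p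
  map_add' f g := mfderiv_add (f.2.mdifferentiableAt (by simp)) (g.2.mdifferentiableAt (by simp))
  map_smul' c f := const_smul_mfderiv (f.2.mdifferentiableAt (by simp)) c

variable (𝕜 E) in
/-- The conormal space of `L` at `p`: the differentials of the functions vanishing on `L`. -/
def conormal (L : Set M) (p : M) : Submodule 𝕜 (E →L[𝕜] 𝕜) :=
  ((vanishingIdeal 𝕜 E L p).restrictScalars 𝕜).map (differentialAt 𝕜 E p)

theorem vanishingIdeal_le_pointIdeal {L : Set M} {p : M} (hp : p ∈ L) :
    vanishingIdeal 𝕜 E L p ≤ pointIdeal 𝕜 E p := fun f hf =>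
  (show ∀ᶠ x in 𝓝 p, x ∈ L → f.1 x = 0 from hf).self_of_nhds hp

theorem differentialAt_eq_zero_of_mem_sq {p : M} {f : analyticFunctions 𝕜 E p}
    (hf : f ∈ pointIdeal 𝕜 E p ^ 2) : differentialAt 𝕜 E p f = 0 := by
  rw [pow_two] at hf
  refine Submodule.mul_induction_on hf (fun g hg h hh => ?_) (fun g h hg hh => ?_)
  · have h1 : g.1 p = 0 := hg
    have h2 : h.1 p = 0 := hh
    have h3 := ((g.2.mdifferentiableAt (by simp)).hasMFDerivAt.mul
      (h.2.mdifferentiableAt (by simp)).hasMFDerivAt).mfderiv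
    change mfderiv 𝓘(𝕜, E) 𝓘(𝕜, 𝕜) (g.1 * h.1) p = 0
    have h4 (A B : E →L[𝕜] 𝕜) : (0 : 𝕜) • A + (0 : 𝕜) • B = 0 :=
      ContinuousLinearMap.ext fun v => by
        change (0 : 𝕜) * A v + 0 * B v = 0
        ring
    rw [h3, h1, h2]
    exact h4 _ _
  · rw [map_add, hg, hh, add_zero]

variable [IsManifold 𝓘(𝕜, E) ω M]

/-- In a chart, Hadamard's lemma writes `f = ∑ (xᵢ - xᵢ(p)) gᵢ`, and `gᵢ(p) = ∂ᵢ f(p) = 0`, so every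
summand is a product of two functions vanishing at `p`. -/
theorem exists_mem_sq_of_differentialAt_eq_zero [FiniteDimensional 𝕜 E] {p : M} {f : analyticFunctions 𝕜 E p}
    (hf : f ∈ pointIdeal 𝕜 E p) (hd : differentialAt 𝕜 E p f = 0) :
    ∃ g ∈ pointIdeal 𝕜 E p ^ 2, f.1 =ᶠ[𝓝 p] g.1 := by
  let e := extChartAt 𝓘(𝕜, E) p
  have he : ContMDiffAt 𝓘(𝕜, E) 𝓘(𝕜, E) ω e p := contMDiffAt_extChartAt
  have hes : ContMDiffAt 𝓘(𝕜, E) 𝓘(𝕜, E) ω e.symm (e p) :=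
    (contMDiffOn_extChartAt_symm p).contMDiffAt (extChartAt_target_mem_nhds p)
  have hep : e.symm (e p) = p := extChartAt_to_inv p
  have hf2 : ContMDiffAt 𝓘(𝕜, E) 𝓘(𝕜, 𝕜) ω f.1 (e.symm (e p)) := by rw [hep]; exact f.2
  have hk : ContDiffAt 𝕜 ω (f.1 ∘ e.symm) (e p) := (hf2.comp (e p) hes).contDiffAt
  have hk' : fderiv 𝕜 (f.1 ∘ e.symm) (e p) = 0 := by
    rw [← mfderiv_eq_fderiv, mfderiv_comp (e p) (hf2.mdifferentiableAt (by simp))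
      (hes.mdifferentiableAt (by simp)), hep]
    have : mfderiv 𝓘(𝕜, E) 𝓘(𝕜, 𝕜) f.1 p = 0 := hd
    rw [this]
    exact ContinuousLinearMap.zero_comp _
  obtain ⟨g, hg, hga, hgk⟩ := exists_eq_add_apply_sub hk
  let b := Module.finBasis 𝕜 E
  let u (i) : analyticFunctions 𝕜 E p := ⟨fun x => (b.coord i).toContinuousLinearMap (e x - e p),
    ((b.coord i).toContinuousLinearMap.contMDiff.contMDiffAt).comp p (he.sub contMDiffAt_const)⟩
  let v (i) : analyticFunctions 𝕜 E p := ⟨fun x => g (e x) (b i), by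
    have h1 : ContDiffAt 𝕜 ω (fun y => g y (b i)) (e p) := hg.clm_apply contDiffAt_const
    exact h1.contMDiffAt.comp p he⟩
  refine ⟨∑ i, u i * v i, Ideal.sum_mem _ fun i _ => ?_, ?_⟩
  · rw [pow_two]
    refine Ideal.mul_mem_mul ?_ ?_
    · change (b.coord i).toContinuousLinearMap (e p - e p) = 0
      simp
    · change g (e p) (b i) = 0
      rw [hga, hk']
      rfl
  · filter_upwards [he.continuousAt.eventually hgk, extChartAt_source_mem_nhds (I := 𝓘(𝕜, E)) p]
      with x hx hxs
    have h0 : f.1 p = 0 := hf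
    have hx' : e.symm (e x) = x := e.left_inv hxs
    simp only [Function.comp_apply, hx', hep, h0, zero_add] at hx
    rw [hx]
    have hs : e x - e p = ∑ i, b.coord i (e x - e p) • b i := (b.sum_repr _).symm
    conv_lhs => rw [hs, map_sum]
    simp only [AddSubmonoidClass.coe_finsetSum, Finset.sum_apply, map_smul]
    rfl

theorem exists_differentialAt_eq (p : M) (l : E →L[𝕜] 𝕜) :
    ∃ f ∈ pointIdeal 𝕜 E p, differentialAt 𝕜 E p f = l := by
  let e := chartAt E p
  have hm : e.MDifferentiable 𝓘(𝕜, E) 𝓘(𝕜, E) :=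
    have : IsManifold 𝓘(𝕜, E) 1 M := IsManifold.of_le (n := ω) (by simp)
    mdifferentiable_chart p
  have he : ContMDiffAt 𝓘(𝕜, E) 𝓘(𝕜, E) ω e p := contMDiffAt_extChartAt
  let l' : E →L[𝕜] 𝕜 := l.comp (mfderiv 𝓘(𝕜, E) 𝓘(𝕜, E) e.symm (e p))
  have hl : HasFDerivAt (fun y => l' (y - e p)) l' (e p) :=
    l'.hasFDerivAt.comp (e p) ((hasFDerivAt_id (e p)).sub_const (e p))
  have hlc : ContDiffAt 𝕜 ω (fun y => l' (y - e p)) (e p) := by fun_prop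
  refine ⟨⟨fun x => l' (e x - e p), hlc.contMDiffAt.comp p he⟩, ?_, ?_⟩
  · change l' (e p - e p) = 0
    simp
  · have h1 := (hl.hasMFDerivAt.comp p (he.mdifferentiableAt (by simp)).hasMFDerivAt).mfderiv
    have h2 := hm.symm_comp_deriv (mem_chart_source E p)
    change mfderiv 𝓘(𝕜, E) 𝓘(𝕜, 𝕜) ((fun y => l' (y - e p)) ∘ e) p = l
    rw [h1]
    ext v
    exact congrArg l (congrArg (fun A => A v) h2)

/-- The differential identifies `𝔪_p/𝔪_p²` with the dual of the tangent space modulo the conormal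
space. Thus the index `k` of a stratum counts independent differentials of functions vanishing on
`L`. -/
theorem edim_add_finrank_conormal [FiniteDimensional 𝕜 E] {L : Set M} {p : M} (hp : p ∈ L) :
    edim 𝕜 E L p + Module.finrank 𝕜 (conormal 𝕜 E L p) = Module.finrank 𝕜 E := by
  have h := finrank_cotangent_quotient_add (pointIdeal 𝕜 E p) (vanishingIdeal 𝕜 E L p)
    (vanishingIdeal_le_pointIdeal hp) (differentialAt 𝕜 E p) (exists_differentialAt_eq p)
    (fun f hf => differentialAt_eq_zero_of_mem_sq hf) (fun f hf hd => by
      obtain ⟨k, hk, hkf⟩ := exists_mem_sq_of_differentialAt_eq_zero hf hd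
      refine ⟨k, hk, ?_⟩
      change ∀ᶠ x in 𝓝 p, x ∈ L → (k - f).1 x = 0
      filter_upwards [hkf] with x hx _
      change k.1 x - f.1 x = 0
      rw [hx, sub_self])
  refine Eq.trans h ?_
  rw [← (LinearMap.toContinuousLinearMap (𝕜 := 𝕜) (E := E) (F' := 𝕜)).finrank_eq]
  exact Subspace.dual_finrank_eq (K := 𝕜) (V := E)

end EmbeddingDimension

theorem exists_linearIndependent_mem {K V : Type*} [Field K] [AddCommGroup V] [Module K V]
    [FiniteDimensional K V] (C : Submodule K V) :
    ∃ b : Fin (Module.finrank K C) → V, LinearIndependent K b ∧ ∀ i, b i ∈ C :=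
  ⟨fun i => Module.finBasis K C i,
    (Module.finBasis K C).linearIndependent.map' _ (Submodule.ker_subtype _), fun _ => Subtype.prop _⟩

theorem span_range_eq_of_finrank_le {K V : Type*} [Field K] [AddCommGroup V] [Module K V]
    [FiniteDimensional K V] {C : Submodule K V} {r : ℕ} {b : Fin r → V}
    (hb : LinearIndependent K b) (hbC : ∀ i, b i ∈ C) (hr : Module.finrank K C ≤ r) :
    Submodule.span K (Set.range b) = C := by
  refine Submodule.eq_of_le_of_finrank_le (Submodule.span_le.2 ?_) ?_
  · rintro _ ⟨i, rfl⟩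
    exact hbC i
  · rwa [finrank_span_eq_card hb, Fintype.card_fin]

-- Lower bound for the dimension of an involutive set

section Dimension

variable {𝕜 : Type*} [RCLike 𝕜]

/-- The identity theorem, for a function given together with its higher derivatives. -/
theorem eq_zero_of_forall_hasDerivAt {T : Set 𝕜} (hT : IsOpen T) (hTc : IsPreconnected T)
    {G : ℕ → 𝕜 → 𝕜} (hG : ∀ n, ∀ t ∈ T, HasDerivAt (G n) (G (n + 1) t) t)
    (hA : AnalyticOnNhd 𝕜 (G 0) T) {t₀ : 𝕜} (ht₀ : t₀ ∈ T) (h0 : ∀ n, G n t₀ = 0) :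
    ∀ t ∈ T, G 0 t = 0 := by
  have hit (n : ℕ) : ∀ t ∈ T, iteratedDeriv n (G 0) t = G n t := by
    induction n with
    | zero => simp
    | succ n ih =>
      intro t ht
      rw [iteratedDeriv_succ, ← (hG n t ht).deriv]
      exact Filter.EventuallyEq.deriv_eq (Filter.mem_of_superset (hT.mem_nhds ht) ih)
  have hord : analyticOrderAt (G 0) t₀ = ⊤ :=
    ENat.eq_top_iff_forall_ge.2 fun n =>
      (natCast_le_analyticOrderAt_iff_iteratedDeriv_eq_zero (hA t₀ ht₀)).2
        fun i _ => by rw [hit i t₀ ht₀, h0]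
  exact hA.eqOn_zero_of_preconnected_of_eventuallyEq_zero hTc ht₀ (analyticOrderAt_eq_top.1 hord)

theorem isPreconnected_ball (a : 𝕜) (r : ℝ) : IsPreconnected (Metric.ball a r) := by
  let _ := NormedSpace.restrictScalars ℝ 𝕜 𝕜
  exact (convex_ball a r).isPreconnected

variable {E : Type*} [NormedAddCommGroup E] [NormedSpace 𝕜 E]

theorem fderiv_mem_conormal {L : Set E} {x : E} {g : E → 𝕜} (hg : ContDiffAt 𝕜 ω g x)
    (hv : ∀ᶠ y in 𝓝 x, y ∈ L → g y = 0) : fderiv 𝕜 g x ∈ conormal 𝕜 E L x :=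
  ⟨⟨g, hg.contMDiffAt⟩, hv, mfderiv_eq_fderiv⟩

/-- A functional vanishing on a proper range would be a linear relation among the `b i`. -/
theorem surjective_pi_of_linearIndependent {r : ℕ} {b : Fin r → E →L[𝕜] 𝕜}
    (hb : LinearIndependent 𝕜 b) : Function.Surjective (ContinuousLinearMap.pi b) := by
  by_contra hns
  have hlt : LinearMap.range (ContinuousLinearMap.pi b).toLinearMap < ⊤ := by
    rw [lt_top_iff_ne_top]
    intro h
    exact hns (LinearMap.range_eq_top.1 h)
  obtain ⟨c, hc0, hc⟩ := Submodule.exists_le_ker_of_lt_top _ hlt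
  apply hc0
  have hci (i : Fin r) : c (Pi.single i 1) = 0 := by
    refine Fintype.linearIndependent_iff.1 hb (fun i => c (Pi.single i 1)) ?_ i
    ext v
    have h1 : c (ContinuousLinearMap.pi b v) = 0 := hc ⟨v, rfl⟩
    rw [pi_eq_sum_univ' (ContinuousLinearMap.pi b v), map_sum] at h1
    simp only [map_smul, ContinuousLinearMap.pi_apply] at h1
    rw [sum_apply, zero_apply, ← h1]
    refine Finset.sum_congr rfl fun i _ => ?_
    simp only [smul_apply, smul_eq_mul]
    rw [mul_comm]
  refine LinearMap.pi_ext' fun i => LinearMap.ext_ring ?_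
  simpa using hci i

variable [FiniteDimensional 𝕜 E]

/-- Where the conormal space has maximal dimension, an analytic set is a manifold. -/
theorem containsSubmanifold_of_finrank_conormal_le {U L : Set E} (hL : IsAnalyticSubset 𝕜 E U L)
    {q : E} (hq : q ∈ L)
    (hmax : ∀ x ∈ L, Module.finrank 𝕜 (conormal 𝕜 E L x) ≤ Module.finrank 𝕜 (conormal 𝕜 E L q)) :
    ContainsSubmanifold 𝕜 E L
      (Module.finrank 𝕜 E - Module.finrank 𝕜 (conormal 𝕜 E L q)) := by
  have : CompleteSpace E := FiniteDimensional.complete 𝕜 E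
  set r := Module.finrank 𝕜 (conormal 𝕜 E L q) with hr
  obtain ⟨b, hb, hbC⟩ := exists_linearIndependent_mem (conormal 𝕜 E L q)
  choose f' hf'I hf'd using hbC
  let f : Fin r → E → 𝕜 := fun i => (f' i).1
  have hf (i) : ContDiffAt 𝕜 ω (f i) q := (f' i).2.contDiffAt
  have hfI (i) : ∀ᶠ x in 𝓝 q, x ∈ L → f i x = 0 := hf'I i
  have hfd (i) : fderiv 𝕜 (f i) q = b i := by
    rw [← mfderiv_eq_fderiv]
    exact hf'd i
  have hfq (i) : f i q = 0 := (hfI i).self_of_nhds hq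
  let DF : E →L[𝕜] Fin r → 𝕜 := ContinuousLinearMap.pi b
  have hDF : Function.Surjective DF := surjective_pi_of_linearIndependent hb
  let K := LinearMap.ker DF.toLinearMap
  have hKdim : Module.finrank 𝕜 K = Module.finrank 𝕜 E - r := by
    have h1 := LinearMap.finrank_range_add_finrank_ker DF.toLinearMap
    rw [LinearMap.range_eq_top.2 hDF, finrank_top, Module.finrank_fin_fun] at h1
    rw [← h1, Nat.add_sub_cancel_left]
  obtain ⟨π, hπ⟩ := K.subtype.exists_leftInverse_of_injective (Submodule.ker_subtype _)
  let π' : E →L[𝕜] K := π.toContinuousLinearMap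
  let A : E →L[𝕜] (Fin r → 𝕜) × K := DF.prod π'
  have hAinj : Function.Injective A.toLinearMap := by
    rw [← LinearMap.ker_eq_bot, LinearMap.ker_eq_bot']
    intro v hv
    have h1 : v ∈ K := congrArg Prod.fst hv
    have h2 : π v = 0 := congrArg Prod.snd hv
    have h3 : π (K.subtype ⟨v, h1⟩) = ⟨v, h1⟩ := congrArg (fun l => l ⟨v, h1⟩) hπ
    have h4 : (⟨v, h1⟩ : K) = 0 := by rw [← h3]; exact h2
    exact congrArg Subtype.val h4
  have hAdim : Module.finrank 𝕜 E = Module.finrank 𝕜 ((Fin r → 𝕜) × K) := by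
    have h1 := LinearMap.finrank_range_add_finrank_ker DF.toLinearMap
    rw [LinearMap.range_eq_top.2 hDF, finrank_top] at h1
    rw [Module.finrank_prod, h1]
  let Ae : E ≃L[𝕜] (Fin r → 𝕜) × K :=
    (LinearEquiv.ofInjectiveOfFinrankEq A.toLinearMap hAinj hAdim).toContinuousLinearEquiv
  have hAe : (Ae : E →L[𝕜] (Fin r → 𝕜) × K) = A := rfl
  -- Local coordinates whose first block is `f`. With inverse `R`, the map `κ ↦ R (0, κ)`
  -- parametrizes the zero set of `f`, and the aim is to show that this zero set lies in `L` near
  -- `q`.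
  let Q : E → (Fin r → 𝕜) × K := fun x => (fun i => f i x, π' (x - q))
  have hF : ContDiffAt 𝕜 ω (fun x i => f i x) q := contDiffAt_pi.2 hf
  have hQ : ContDiffAt 𝕜 ω Q q := by fun_prop
  have hQq : Q q = 0 := by
    refine Prod.ext (funext hfq) ?_
    simp [Q]
  have hQd : HasFDerivAt Q (Ae : E →L[𝕜] (Fin r → 𝕜) × K) q := by
    rw [hAe]
    refine HasFDerivAt.prodMk (hasFDerivAt_pi.2 fun i => ?_) ?_
    · rw [← hfd]
      exact ((hf i).differentiableAt (by simp)).hasFDerivAt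
    · exact π'.hasFDerivAt.comp q ((hasFDerivAt_id q).sub_const q)
  have hω : (ω : WithTop ℕ∞) ≠ 0 := by simp
  let R := hQ.localInverse hQd hω
  have hstr := hQ.hasStrictFDerivAt' hQd hω
  have hR : ContDiffAt 𝕜 ω R 0 := by
    have := hQ.to_localInverse hQd hω
    rwa [hQq] at this
  have hR0 : R 0 = q := by
    rw [← hQq]; exact hQ.localInverse_apply_image hQd hω
  have hRd : HasFDerivAt R (Ae.symm : (Fin r → 𝕜) × K →L[𝕜] E) 0 := by
    have := hstr.to_localInverse.hasFDerivAt
    rwa [hQq] at this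
  have hQR : ∀ᶠ y in 𝓝 (0 : (Fin r → 𝕜) × K), Q (R y) = y := by
    rw [← hQq]; exact hstr.eventually_right_inverse
  have hRQ : ∀ᶠ x in 𝓝 q, R (Q x) = x := hstr.eventually_left_inverse
  have hQt : Filter.Tendsto Q (𝓝 q) (𝓝 0) := by
    have := hQ.continuousAt.tendsto
    rwa [hQq] at this
  have hRt : Filter.Tendsto R (𝓝 0) (𝓝 q) := by
    have := hR.continuousAt.tendsto
    rwa [hR0] at this
  obtain ⟨V, hV, hqV, -, N, h, hh, hLV⟩ := hL.2 q (hL.1 hq)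
  have hli : ∀ᶠ x in 𝓝 q, LinearIndependent 𝕜 fun i => fderiv 𝕜 (f i) x := by
    have hc : ContinuousAt (fun x i => fderiv 𝕜 (f i) x) q :=
      continuousAt_pi.2 fun i => ((hf i).fderiv_right (m := 0) (by simp)).continuousAt
    refine hc.eventually (LinearIndependent.eventually ?_)
    simpa only [hfd] using hb
  have hall : ∀ᶠ x in 𝓝 q, x ∈ V ∧ (∀ i, ContDiffAt 𝕜 ω (f i) x) ∧
      (∀ i, ∀ᶠ y in 𝓝 x, y ∈ L → f i y = 0) ∧ (LinearIndependent 𝕜 fun i => fderiv 𝕜 (f i) x) ∧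
      ContDiffAt 𝕜 ω Q x ∧ ContDiffAt 𝕜 ω R (Q x) ∧ (∀ᶠ y in 𝓝 (Q x), Q (R y) = y) ∧
      R (Q x) = x :=
    (hV.eventually_mem hqV).and <| (Filter.eventually_all.2 fun i => (hf i).eventually (by simp)).and <|
      (Filter.eventually_all.2 fun i => (hfI i).eventually_nhds).and <| hli.and <|
      (hQ.eventually (by simp)).and <| (hQt.eventually (hR.eventually (by simp))).and <|
      (hQt.eventually hQR.eventually_nhds).and hRQ
  obtain ⟨V₀, hV₀, hV₀o, hqV₀⟩ := eventually_nhds_iff.1 hall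
  -- tangential derivatives of functions vanishing on `L` vanish on `L`
  let D (κ : K) (g : E → 𝕜) : E → 𝕜 := fun x => fderiv 𝕜 g x (fderiv 𝕜 R (Q x) (0, κ))
  let S : Set (E → 𝕜) := {g | (∀ x ∈ V₀, ContDiffAt 𝕜 ω g x) ∧ ∀ x ∈ V₀, x ∈ L → g x = 0}
  have hDS (κ : K) (g : E → 𝕜) (hg : g ∈ S) : D κ g ∈ S := by
    refine ⟨fun x hx => ?_, fun x hx hxL => ?_⟩
    · obtain ⟨-, -, -, -, h5, h6, -, -⟩ := hV₀ x hx
      have h7 : ContDiffAt 𝕜 ω (fun x => fderiv 𝕜 R (Q x)) x :=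
        ContDiffAt.comp x (h6.fderiv_right (by simp)) h5
      exact ((hg.1 x hx).fderiv_right (by simp)).clm_apply (h7.clm_apply contDiffAt_const)
    · obtain ⟨-, h2, h3, h4, h5, h6, h7, h8⟩ := hV₀ x hx
      have h9 : fderiv 𝕜 g x ∈ conormal 𝕜 E L x := fderiv_mem_conormal (hg.1 x hx)
        (Filter.mem_of_superset (hV₀o.mem_nhds hx) hg.2)
      -- The `df i` stay independent near `q`, and maximality of the rank at `q` prevents further
      -- conormal directions. So `dg` is a combination of the `df i`, which annihilate the
      -- directions tangent to the fibres of `f`.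
      have h10 : Submodule.span 𝕜 (Set.range fun i => fderiv 𝕜 (f i) x) = conormal 𝕜 E L x :=
        span_range_eq_of_finrank_le h4 (fun i => fderiv_mem_conormal (h2 i) (h3 i)) (hmax x hxL)
      rw [← h10] at h9
      change fderiv 𝕜 g x (fderiv 𝕜 R (Q x) (0, κ)) = 0
      generalize fderiv 𝕜 g x = l at h9
      induction h9 using Submodule.span_induction with
      | mem l hl =>
        obtain ⟨i, rfl⟩ := hl
        have d1 : HasFDerivAt (fun y => f i (R y)) _ (Q x) := HasFDerivAt.comp (Q x)
          (by rw [h8]; exact ((h2 i).differentiableAt (by simp)).hasFDerivAt)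
          (h6.differentiableAt (by simp)).hasFDerivAt
        have d2 : HasFDerivAt (fun y : (Fin r → 𝕜) × K => y.1 i)
          (ContinuousLinearMap.proj i ∘L ContinuousLinearMap.fst 𝕜 (Fin r → 𝕜) K) (Q x) :=
          (ContinuousLinearMap.proj i ∘L ContinuousLinearMap.fst 𝕜 (Fin r → 𝕜) K).hasFDerivAt
        have := d2.unique (d1.congr_of_eventuallyEq
          (h7.mono fun y hy => (congrArg (fun z => z.1 i) hy).symm))
        exact (congrArg (fun l => l (0, κ)) this).symm
      | zero => rfl
      | add l l' _ _ hl hl' => rw [add_apply, hl, hl', add_zero]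
      | smul c l _ hl => rw [smul_apply, hl, smul_zero]
  have hball : ∀ᶠ y in 𝓝 (0 : (Fin r → 𝕜) × K), R y ∈ V₀ ∧ Q (R y) = y ∧ ContDiffAt 𝕜 ω R y :=
    (hRt.eventually (hV₀o.mem_nhds hqV₀)).and (hQR.and (hR.eventually (by simp)))
  obtain ⟨δ, hδ, hball⟩ := Metric.eventually_nhds_iff.1 hball
  have hb' (κ : K) (hκ : ‖κ‖ < δ) := hball (y := (0, κ)) (by
    rw [dist_zero_right, Prod.norm_def]
    exact max_lt (by simpa using hδ) hκ)
  -- Along `t ↦ R (0, t κ)`, all derivatives of `g` at `t = 0` are values at `q ∈ L` of iterated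
  -- tangential derivatives, hence zero, and the identity theorem applies. The bound `δ / 2` lets
  -- `t` range over a disc of radius `2`, which contains `t = 1`.
  have hzero (g : E → 𝕜) (hg : g ∈ S) (κ : K) (hκ : ‖κ‖ < δ / 2) : g (R (0, κ)) = 0 := by
    let G : ℕ → 𝕜 → 𝕜 := fun n t => ((D κ)^[n] g) (R (0, t • κ))
    have hGS (n : ℕ) : (D κ)^[n] g ∈ S := by
      induction n with
      | zero => exact hg
      | succ n ih =>
        rw [Function.iterate_succ_apply']
        exact hDS κ _ ih
    have htκ (t : 𝕜) (ht : t ∈ Metric.ball (0 : 𝕜) 2) : ‖t • κ‖ < δ := by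
      rw [mem_ball_zero_iff] at ht
      rw [norm_smul]
      nlinarith [norm_nonneg t, norm_nonneg κ]
    have hinc (t : 𝕜) : HasDerivAt (fun t : 𝕜 => ((0 : Fin r → 𝕜), t • κ)) (0, κ) t := by
      refine (hasDerivAt_const t _).prodMk ?_
      simpa using (hasDerivAt_id t).smul_const κ
    have key := eq_zero_of_forall_hasDerivAt Metric.isOpen_ball (isPreconnected_ball (0 : 𝕜) 2)
      (G := G) (fun n t ht => by
        obtain ⟨h1, h2, h3⟩ := hb' _ (htκ t ht)
        have d1 := ((hGS n).1 _ h1).differentiableAt (by simp) |>.hasFDerivAt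
        have d2 := (h3.differentiableAt (by simp)).hasFDerivAt
        have d3 := d1.comp_hasDerivAt t (d2.comp_hasDerivAt t (hinc t))
        have e : G (n + 1) t = fderiv 𝕜 ((D κ)^[n] g) (R (0, t • κ))
            (fderiv 𝕜 R (0, t • κ) (0, κ)) := by
          simp only [G]
          rw [Function.iterate_succ_apply']
          simp only [D]
          rw [h2]
        rw [e]
        exact d3)
      (fun t ht => by
        obtain ⟨h1, h2, h3⟩ := hb' _ (htκ t ht)
        have h4 : ContDiffAt 𝕜 ω (fun t : 𝕜 => R (0, t • κ)) t :=
          ContDiffAt.comp (f := fun t : 𝕜 => ((0 : Fin r → 𝕜), t • κ)) t h3 (by fun_prop)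
        exact (ContDiffAt.comp t (hg.1 _ h1) h4).analyticAt)
      (t₀ := 0) (by simp) (fun n => by
        simp only [G]
        rw [zero_smul]
        have : R ((0 : Fin r → 𝕜), (0 : K)) = q := hR0
        rw [this]
        exact (hGS n).2 q hqV₀ hq)
      1 (by simp)
    simpa [G] using key
  have hinL (κ : K) (hκ : ‖κ‖ < δ / 2) : R (0, κ) ∈ L := by
    have h1 := (hb' κ (by linarith)).1
    refine (hLV _ (hV₀ _ h1).1).2 fun j => hzero (h j) ⟨fun x hx => ?_, fun x hx hxL => ?_⟩ κ hκ
    · exact ((hh j).contMDiffAt (hV.mem_nhds (hV₀ x hx).1)).contDiffAt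
    · exact (hLV x (hV₀ x hx).1).1 hxL j
  rw [← hKdim]
  let e : (Fin (Module.finrank 𝕜 K) → 𝕜) ≃L[𝕜] K :=
    (Module.finBasis 𝕜 K).equivFun.symm.toContinuousLinearEquiv
  let j : (Fin (Module.finrank 𝕜 K) → 𝕜) →L[𝕜] (Fin r → 𝕜) × K :=
    ContinuousLinearMap.inr 𝕜 _ _ ∘L (e : _ →L[𝕜] K)
  have hj0 : j 0 = 0 := map_zero j
  refine ⟨fun t => R (j t), ?_, ?_, ?_⟩
  · refine ContDiffAt.contMDiffAt (ContDiffAt.comp 0 ?_ j.contDiff.contDiffAt)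
    rwa [hj0]
  · have d : HasFDerivAt (fun t => R (j t)) ((Ae.symm : (Fin r → 𝕜) × K →L[𝕜] E) ∘L j) 0 :=
      HasFDerivAt.comp 0 (by rwa [hj0]) j.hasFDerivAt
    rw [mfderiv_eq_fderiv, d.fderiv]
    exact Ae.symm.injective.comp ((Prod.mk_right_injective _).comp e.injective)
  · have hc : Filter.Tendsto (fun t => ‖e t‖) (𝓝 0) (𝓝 0) :=
      Continuous.tendsto' (by fun_prop) _ _ (by simp)
    filter_upwards [hc.eventually_lt_const (half_pos hδ)] with t ht
    exact hinL (e t) ht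

/-- An isotropic subspace lies in its orthogonal, which has complementary dimension. -/
theorem two_mul_finrank_le_of_isotropic {K V : Type*} [Field K] [AddCommGroup V] [Module K V]
    [FiniteDimensional K V] {B : LinearMap.BilinForm K V} (hB : B.Nondegenerate)
    {W : Submodule K V} (hW : ∀ u ∈ W, ∀ v ∈ W, B u v = 0) :
    2 * Module.finrank K W ≤ Module.finrank K V := by
  have h1 : W ≤ B.orthogonal W := fun v hv u hu => hW u hu v hv
  have h2 := Submodule.finrank_mono h1
  rw [LinearMap.BilinForm.finrank_orthogonal hB] at h2
  have h3 := Submodule.finrank_le W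
  omega

/-- The conormal spaces of an involutive analytic set are isotropic. -/
theorem two_mul_finrank_conormal_le {M : Type*} [TopologicalSpace M] [ChartedSpace E M]
    [IsManifold 𝓘(𝕜, E) ω M] (Ω : SymplecticForm 𝕜 E M) {U L : Set M} (hU : IsOpen U)
    (hinv : ∀ V : Set M, IsOpen V → V ⊆ U → ∀ f g : M → 𝕜,
      ContMDiffOn 𝓘(𝕜, E) 𝓘(𝕜, 𝕜) ω f V → ContMDiffOn 𝓘(𝕜, E) 𝓘(𝕜, 𝕜) ω g V →
      (∀ x ∈ V ∩ L, f x = 0) → (∀ x ∈ V ∩ L, g x = 0) → ∀ x ∈ V ∩ L, Ω.poisson f g x = 0)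
    {q : M} (hq : q ∈ L) (hqU : q ∈ U) :
    2 * Module.finrank 𝕜 (conormal 𝕜 E L q) ≤ Module.finrank 𝕜 E := by
  have : FiniteDimensional 𝕜 (TangentSpace 𝓘(𝕜, E) q) := inferInstanceAs (FiniteDimensional 𝕜 E)
  -- `T` sends `df` to the hamiltonian vector of `f`, so isotropy of the image of the conormal space
  -- is the vanishing of `{f, g}` at `q`.
  let T : (E →L[𝕜] 𝕜) →ₗ[𝕜] TangentSpace 𝓘(𝕜, E) q :=
    ((Ω.bilin q).toDual (Ω.bilin_nondegenerate q)).symm.toLinearMap ∘ₗ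
      ContinuousLinearMap.coeLM 𝕜
  have hT : Function.Injective T :=
    (LinearEquiv.injective ((Ω.bilin q).toDual (Ω.bilin_nondegenerate q)).symm).comp
      ContinuousLinearMap.coe_injective
  rw [LinearEquiv.finrank_eq (Submodule.equivMapOfInjective T hT (conormal 𝕜 E L q))]
  refine two_mul_finrank_le_of_isotropic (Ω.bilin_nondegenerate q) ?_
  · rintro _ ⟨_, ⟨f, hf, rfl⟩, rfl⟩ _ ⟨_, ⟨g, hg, rfl⟩, rfl⟩
    obtain ⟨V, hV, hVo, hqV⟩ := eventually_nhds_iff.1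
      (((contMDiffAt_iff_contMDiffAt_nhds (by simp)).1 f.2).and
        (((contMDiffAt_iff_contMDiffAt_nhds (by simp)).1 g.2).and
        ((show ∀ᶠ x in 𝓝 q, x ∈ L → f.1 x = 0 from hf).and
          ((show ∀ᶠ x in 𝓝 q, x ∈ L → g.1 x = 0 from hg).and (hU.eventually_mem hqU)))))
    exact hinv V hVo (fun x hx => (hV x hx).2.2.2.2) f.1 g.1
      (fun x hx => (hV x hx).1.contMDiffWithinAt) (fun x hx => (hV x hx).2.1.contMDiffWithinAt)
      (fun x hx => (hV x hx.1).2.2.1 hx.2) (fun x hx => (hV x hx.1).2.2.2.1 hx.2) q ⟨hqV, hq⟩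

/-- A nonempty involutive analytic set has at least half the dimension of the ambient space. -/
theorem exists_containsSubmanifold_of_involutive (Ω : SymplecticForm 𝕜 E E) {U L : Set E}
    (hU : IsOpen U) (hL : IsAnalyticSubset 𝕜 E U L) (hne : L.Nonempty)
    (hinv : ∀ V : Set E, IsOpen V → V ⊆ U → ∀ f g : E → 𝕜,
      ContMDiffOn 𝓘(𝕜, E) 𝓘(𝕜, 𝕜) ω f V → ContMDiffOn 𝓘(𝕜, E) 𝓘(𝕜, 𝕜) ω g V →
      (∀ x ∈ V ∩ L, f x = 0) → (∀ x ∈ V ∩ L, g x = 0) → ∀ x ∈ V ∩ L, Ω.poisson f g x = 0) :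
    ∃ d, Module.finrank 𝕜 E ≤ 2 * d ∧ ContainsSubmanifold 𝕜 E L d := by
  have hle (x : E) (hx : x ∈ L) := two_mul_finrank_conormal_le Ω hU hinv hx (hL.1 hx)
  have hfin : ((fun x => Module.finrank 𝕜 (conormal 𝕜 E L x)) '' L).Finite :=
    (Set.finite_Iic (Module.finrank 𝕜 E)).subset (by
      rintro _ ⟨x, hx, rfl⟩
      have := hle x hx
      simp only [Set.mem_Iic]
      omega)
  -- At a point of maximal conormal rank `r` there is a submanifold of dimension `dim E - r`, and
  -- `2r ≤ dim E` by isotropy.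
  obtain ⟨_, ⟨q, hq, rfl⟩, hmax⟩ := hfin.exists_maximal (hne.image _)
  refine ⟨_, ?_, containsSubmanifold_of_finrank_conormal_le hL hq fun x hx => ?_⟩
  · have := hle q hq
    omega
  · by_contra! h
    exact absurd (hmax ⟨x, hx, rfl⟩ h.le) (not_le.2 h)

end Dimension

-- Hamiltonian vectors and Poisson brackets

section Hamiltonian

variable {𝕜 : Type*} [RCLike 𝕜]
  {E : Type*} [NormedAddCommGroup E] [NormedSpace 𝕜 E] [FiniteDimensional 𝕜 E]
  {M : Type*} [TopologicalSpace M] [ChartedSpace E M]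

namespace SymplecticForm

theorem form_hamiltonian (Ω : SymplecticForm 𝕜 E M) (f : M → 𝕜) (x : M)
    (w : TangentSpace 𝓘(𝕜, E) x) :
    Ω.form x ![Ω.hamiltonian f x, w] = mfderiv 𝓘(𝕜, E) 𝓘(𝕜, 𝕜) f x w :=
  haveI : FiniteDimensional 𝕜 (TangentSpace 𝓘(𝕜, E) x) := inferInstanceAs (FiniteDimensional 𝕜 E)
  LinearMap.BilinForm.apply_toDual_symm_apply (hB := Ω.bilin_nondegenerate x)
    (mfderiv 𝓘(𝕜, E) 𝓘(𝕜, 𝕜) f x).toLinearMap w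

theorem hamiltonian_eq (Ω : SymplecticForm 𝕜 E M) {f : M → 𝕜} {x : M}
    {a : TangentSpace 𝓘(𝕜, E) x}
    (ha : ∀ w, Ω.form x ![a, w] = mfderiv 𝓘(𝕜, E) 𝓘(𝕜, 𝕜) f x w) : Ω.hamiltonian f x = a := by
  refine sub_eq_zero.1 (Ω.nondegenerate x _ fun w => ?_)
  have h : Ω.bilin x (Ω.hamiltonian f x - a) w = 0 := by
    rw [map_sub, LinearMap.sub_apply, sub_eq_zero]
    exact (Ω.form_hamiltonian f x w).trans (ha w).symm
  exact h

theorem poisson_eq (Ω : SymplecticForm 𝕜 E M) (f g : M → 𝕜) (x : M) :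
    Ω.poisson f g x = -mfderiv 𝓘(𝕜, E) 𝓘(𝕜, 𝕜) g x (Ω.hamiltonian f x) := by
  rw [poisson, form_swap, form_hamiltonian]
  rfl

end SymplecticForm

end Hamiltonian

-- The product decomposition in reduced coordinates

section ReductionBox

variable {𝕜 : Type*} [RCLike 𝕜]

/-- `Λ` is an involutive analytic subset of a ball in the space with coordinates `(t, s, z)`, on
which the coordinate `s` vanishes; with respect to `b`, the hamiltonian vector field of `s` is
`∂ₜ`, and the form induced by `b` on the reduction of `{s = 0}` is the standard one. -/
structure IsReductionBox {m : ℕ}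
    (b : 𝕜 × (𝕜 × StdSpace 𝕜 m) → 𝕜 × (𝕜 × StdSpace 𝕜 m) →L[𝕜]
      𝕜 × (𝕜 × StdSpace 𝕜 m) →L[𝕜] 𝕜)
    (ρ : ℝ) (Λ : Set (𝕜 × (𝕜 × StdSpace 𝕜 m))) : Prop where
  zero_mem : 0 ∈ Λ
  subset : Λ ⊆ Metric.ball 0 ρ
  exists_eq_zeros : ∃ (N : ℕ) (h : Fin N → 𝕜 × (𝕜 × StdSpace 𝕜 m) → 𝕜),
    (∀ i, ∀ q ∈ Metric.ball 0 ρ, ContDiffAt 𝕜 ω (h i) q) ∧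
      ∀ q ∈ Metric.ball 0 ρ, (q ∈ Λ ↔ ∀ i, h i q = 0)
  snd_fst_eq_zero : ∀ q ∈ Λ, q.2.1 = 0
  involutive : ∀ W : Set (𝕜 × (𝕜 × StdSpace 𝕜 m)), IsOpen W → W ⊆ Metric.ball 0 ρ →
    ∀ g h : 𝕜 × (𝕜 × StdSpace 𝕜 m) → 𝕜, (∀ q ∈ W, ContDiffAt 𝕜 ω g q) →
    (∀ q ∈ W, ContDiffAt 𝕜 ω h q) → (∀ q ∈ W, q ∈ Λ → g q = 0) → (∀ q ∈ W, q ∈ Λ → h q = 0) →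
    ∀ q ∈ W, q ∈ Λ → ∀ a, (∀ w, b q a w = fderiv 𝕜 g q w) → fderiv 𝕜 h q a = 0
  contraction : ∀ q ∈ Metric.ball 0 ρ, ∀ v, b q (1, 0) v = v.2.1
  form_eq : ∀ q ∈ Metric.ball 0 ρ, q.2.1 = 0 → ∀ (a c : 𝕜) (u v : StdSpace 𝕜 m),
    b q (a, (0, u)) (c, (0, v)) = stdAlt 𝕜 m ![u, v]

/-- The points of `Λ` with `t = s = 0`. -/
def reducedSet {m : ℕ} (Λ : Set (𝕜 × (𝕜 × StdSpace 𝕜 m))) : Set (StdSpace 𝕜 m) :=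
  {z | ((0 : 𝕜), ((0 : 𝕜), z)) ∈ Λ}

theorem mem_ball_prod_iff {m : ℕ} {ρ : ℝ} {q : 𝕜 × (𝕜 × StdSpace 𝕜 m)} :
    q ∈ Metric.ball 0 ρ ↔ ‖q.1‖ < ρ ∧ ‖q.2.1‖ < ρ ∧ ‖q.2.2‖ < ρ := by
  rw [mem_ball_zero_iff, Prod.norm_def, Prod.norm_def, max_lt_iff, max_lt_iff]

theorem fderiv_comp_snd_snd {m : ℕ} {k : StdSpace 𝕜 m → 𝕜} {q : 𝕜 × (𝕜 × StdSpace 𝕜 m)}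
    (hk : ContDiffAt 𝕜 ω k q.2.2) :
    fderiv 𝕜 (fun q : 𝕜 × (𝕜 × StdSpace 𝕜 m) => k q.2.2) q = fderiv 𝕜 k q.2.2 ∘L
      ContinuousLinearMap.snd 𝕜 𝕜 (StdSpace 𝕜 m) ∘L ContinuousLinearMap.snd 𝕜 𝕜 _ := by
  have h1 : HasFDerivAt (fun q : 𝕜 × (𝕜 × StdSpace 𝕜 m) => q.2.2)
    (ContinuousLinearMap.snd 𝕜 𝕜 (StdSpace 𝕜 m) ∘L ContinuousLinearMap.snd 𝕜 𝕜 _) q :=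
    (ContinuousLinearMap.snd 𝕜 𝕜 (StdSpace 𝕜 m) ∘L ContinuousLinearMap.snd 𝕜 𝕜 _).hasFDerivAt
  exact (HasFDerivAt.comp q (hk.differentiableAt (by simp)).hasFDerivAt h1).fderiv

theorem fderiv_snd_fst {m : ℕ} (q : 𝕜 × (𝕜 × StdSpace 𝕜 m)) :
    fderiv 𝕜 (fun q : 𝕜 × (𝕜 × StdSpace 𝕜 m) => q.2.1) q =
      ContinuousLinearMap.fst 𝕜 𝕜 (StdSpace 𝕜 m) ∘L ContinuousLinearMap.snd 𝕜 𝕜 _ :=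
  (ContinuousLinearMap.fst 𝕜 𝕜 (StdSpace 𝕜 m) ∘L ContinuousLinearMap.snd 𝕜 𝕜 _).fderiv

theorem finrank_map_top_prod {K V W : Type*} [Field K] [AddCommGroup V] [Module K V]
    [FiniteDimensional K V] [AddCommGroup W] [Module K W] {S : K × V →ₗ[K] W}
    (hS : Function.Injective S) (C : Submodule K V) :
    Module.finrank K (((⊤ : Submodule K K).prod C).map S) = Module.finrank K C + 1 := by
  rw [← LinearEquiv.finrank_eq (Submodule.equivMapOfInjective S hS _)]
  have e : ((⊤ : Submodule K K).prod C) ≃ₗ[K] K × C :=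
    { toFun := fun x => (x.1.1, ⟨x.1.2, x.2.2⟩)
      invFun := fun x => ⟨(x.1, x.2.1), trivial, x.2.2⟩
      left_inv := fun _ => rfl
      right_inv := fun _ => rfl
      map_add' := fun _ _ => rfl
      map_smul' := fun _ _ => rfl }
  rw [e.finrank_eq, Module.finrank_prod, Module.finrank_self, add_comm]

namespace IsReductionBox

variable {m : ℕ} {b : 𝕜 × (𝕜 × StdSpace 𝕜 m) → 𝕜 × (𝕜 × StdSpace 𝕜 m) →L[𝕜]
    𝕜 × (𝕜 × StdSpace 𝕜 m) →L[𝕜] 𝕜} {ρ : ℝ} {Λ : Set (𝕜 × (𝕜 × StdSpace 𝕜 m))}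

theorem pos (h : IsReductionBox b ρ Λ) : 0 < ρ := by
  simpa using h.subset h.zero_mem

/-- The coordinate `s` vanishes on `Λ` and its hamiltonian vector is `∂ₜ`, so this is involutivity
applied to the pair `s`, `g`. -/
theorem fderiv_eq_zero (h : IsReductionBox b ρ Λ) {W : Set (𝕜 × (𝕜 × StdSpace 𝕜 m))}
    (hW : IsOpen W) (hWO : W ⊆ Metric.ball 0 ρ) {g : 𝕜 × (𝕜 × StdSpace 𝕜 m) → 𝕜}
    (hg : ∀ q ∈ W, ContDiffAt 𝕜 ω g q) (hgΛ : ∀ q ∈ W, q ∈ Λ → g q = 0)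
    {q : 𝕜 × (𝕜 × StdSpace 𝕜 m)} (hq : q ∈ W) (hqΛ : q ∈ Λ) : fderiv 𝕜 g q (1, 0) = 0 := by
  refine h.involutive W hW hWO (fun q => q.2.1) g (fun q _ => by fun_prop) hg
    (fun q _ => h.snd_fst_eq_zero q) hgΛ q hq hqΛ (1, 0) fun w => ?_
  rw [h.contraction q (hWO hq)]
  rw [fderiv_snd_fst]
  rfl

/-- By `fderiv_eq_zero`, all iterated `t`-derivatives of the equations of `Λ` vanish on `Λ`. By the
identity theorem, an equation then vanishes on the whole `t`-disc through a point of `Λ`. -/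
theorem mem_of_mem (h : IsReductionBox b ρ Λ) {t t' : 𝕜} {y : 𝕜 × StdSpace 𝕜 m}
    (ht : (t, y) ∈ Λ) (ht' : ‖t'‖ < ρ) : (t', y) ∈ Λ := by
  obtain ⟨N, g, hg, hΛ⟩ := h.exists_eq_zeros
  have hb := mem_ball_prod_iff.1 (h.subset ht)
  have hy (r : 𝕜) (hr : r ∈ Metric.ball (0 : 𝕜) ρ) : (r, y) ∈ Metric.ball (0 : 𝕜 × (𝕜 × _)) ρ :=
    mem_ball_prod_iff.2 ⟨by simpa using hr, hb.2⟩
  refine (hΛ _ (hy t' (by simpa using ht'))).2 fun i => ?_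
  let D (g : 𝕜 × (𝕜 × StdSpace 𝕜 m) → 𝕜) : 𝕜 × (𝕜 × StdSpace 𝕜 m) → 𝕜 :=
    fun q => fderiv 𝕜 g q (1, 0)
  have hD (n : ℕ) : (∀ q ∈ Metric.ball 0 ρ, ContDiffAt 𝕜 ω (D^[n] (g i)) q) ∧
      ∀ q ∈ Metric.ball 0 ρ, q ∈ Λ → D^[n] (g i) q = 0 := by
    induction n with
    | zero => exact ⟨hg i, fun q hq hqΛ => (hΛ q hq).1 hqΛ i⟩
    | succ n ih =>
      rw [Function.iterate_succ_apply']
      exact ⟨fun q hq => ((ih.1 q hq).fderiv_right (by simp)).clm_apply contDiffAt_const,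
        fun q hq hqΛ => h.fderiv_eq_zero Metric.isOpen_ball le_rfl ih.1 ih.2 hq hqΛ⟩
  have hinc (r : 𝕜) : HasDerivAt (fun r : 𝕜 => (r, y)) (1, 0) r :=
    (hasDerivAt_id r).prodMk (hasDerivAt_const r y)
  refine eq_zero_of_forall_hasDerivAt Metric.isOpen_ball (isPreconnected_ball (0 : 𝕜) ρ)
    (G := fun n r => D^[n] (g i) (r, y)) (fun n r hr => ?_) (fun r hr => ?_) (t₀ := t)
    (by simpa using hb.1) (fun n => (hD n).2 _ (h.subset ht) ht) t' (by simpa using ht')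
  · rw [Function.iterate_succ_apply']
    exact (((hD n).1 _ (hy r hr)).differentiableAt (by simp)).hasFDerivAt.comp_hasDerivAt r (hinc r)
  · exact (ContDiffAt.comp (f := fun r : 𝕜 => (r, y)) r (hg i _ (hy r hr))
      (by fun_prop)).analyticAt

theorem mem_iff (h : IsReductionBox b ρ Λ) {q : 𝕜 × (𝕜 × StdSpace 𝕜 m)}
    (hq : q ∈ Metric.ball 0 ρ) : q ∈ Λ ↔ q.2.1 = 0 ∧ q.2.2 ∈ reducedSet Λ := by
  obtain ⟨t, s, z⟩ := q
  constructor
  · intro hΛ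
    have hs := h.snd_fst_eq_zero _ hΛ
    dsimp only at hs
    subst hs
    exact ⟨rfl, h.mem_of_mem hΛ (by simpa using h.pos)⟩
  · rintro ⟨hs, hz⟩
    dsimp only at hs
    subst hs
    exact h.mem_of_mem hz (mem_ball_prod_iff.1 hq).1

theorem isAnalyticSubset (h : IsReductionBox b ρ Λ) :
    IsAnalyticSubset 𝕜 (StdSpace 𝕜 m) (Metric.ball 0 ρ) (reducedSet Λ) := by
  obtain ⟨N, g, hg, hΛ⟩ := h.exists_eq_zeros
  have hz (z : StdSpace 𝕜 m) (hz : z ∈ Metric.ball 0 ρ) :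
      ((0 : 𝕜), ((0 : 𝕜), z)) ∈ Metric.ball 0 ρ :=
    mem_ball_prod_iff.2 ⟨by simpa using h.pos, by simpa using h.pos, by simpa using hz⟩
  refine ⟨fun z hz => ?_, fun x hx => ⟨Metric.ball 0 ρ, Metric.isOpen_ball, hx, le_rfl, N,
    fun i z => g i (0, (0, z)), fun i z hz' => ?_, fun z hz' => hΛ _ (hz z hz')⟩⟩
  · simpa using (mem_ball_prod_iff.1 (h.subset hz)).2.2
  · exact (ContDiffAt.comp (f := fun z => ((0 : 𝕜), ((0 : 𝕜), z))) z (hg i _ (hz z hz'))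
      (by fun_prop)).contMDiffAt.contMDiffWithinAt

/-- Pulled back along `(t, s, z) ↦ z`, the functions `f` and `g` vanish on `Λ`. The hamiltonian
vector of the pullback of `f` at `(0, 0, z)` has the standard hamiltonian vector of `f` as its
`z`-component, so the vanishing upstairs is the vanishing of the standard bracket. -/
theorem involutive_reducedSet (h : IsReductionBox b ρ Λ) (V : Set (StdSpace 𝕜 m)) (hV : IsOpen V)
    (f g : StdSpace 𝕜 m → 𝕜)
    (hf : ContMDiffOn 𝓘(𝕜, StdSpace 𝕜 m) 𝓘(𝕜, 𝕜) ω f V)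
    (hg : ContMDiffOn 𝓘(𝕜, StdSpace 𝕜 m) 𝓘(𝕜, 𝕜) ω g V)
    (hf0 : ∀ z ∈ V ∩ reducedSet Λ, f z = 0) (hg0 : ∀ z ∈ V ∩ reducedSet Λ, g z = 0)
    (z : StdSpace 𝕜 m) (hz : z ∈ V ∩ reducedSet Λ) : (stdForm 𝕜 m).poisson f g z = 0 := by
  have hf' (z) (hz : z ∈ V) : ContDiffAt 𝕜 ω f z := (hf.contMDiffAt (hV.mem_nhds hz)).contDiffAt
  have hg' (z) (hz : z ∈ V) : ContDiffAt 𝕜 ω g z := (hg.contMDiffAt (hV.mem_nhds hz)).contDiffAt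
  let W : Set (𝕜 × (𝕜 × StdSpace 𝕜 m)) := Metric.ball 0 ρ ∩ (fun q => q.2.2) ⁻¹' V
  have hW : IsOpen W := Metric.isOpen_ball.inter (hV.preimage (by fun_prop))
  have hham (k : StdSpace 𝕜 m → 𝕜) (w : StdSpace 𝕜 m) :
      stdAlt 𝕜 m ![(stdForm 𝕜 m).hamiltonian k z, w] = fderiv 𝕜 k z w := by
    rw [← mfderiv_eq_fderiv]
    exact (stdForm 𝕜 m).form_hamiltonian k z w
  set ζ : StdSpace 𝕜 m := (stdForm 𝕜 m).hamiltonian f z with hζ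
  have hqΛ : ((0 : 𝕜), ((0 : 𝕜), z)) ∈ Λ := hz.2
  have hqO := h.subset hqΛ
  let q₀ : 𝕜 × (𝕜 × StdSpace 𝕜 m) := (0, (0, z))
  -- Chosen so that `(τ, 0, ζ)` pairs to zero with `∂ₛ`, as it must because the pullback of `f` does
  -- not depend on `s`.
  let τ : 𝕜 := -b q₀ (0, (0, ζ)) (0, (1, 0))
  have key := h.involutive W hW Set.inter_subset_left (fun q => f q.2.2) (fun q => g q.2.2)
    (fun q hq => ContDiffAt.comp (g := f) q (hf' _ hq.2) (by fun_prop))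
    (fun q hq => ContDiffAt.comp (g := g) q (hg' _ hq.2) (by fun_prop))
    (fun q hq hqΛ => hf0 _ ⟨hq.2, ((h.mem_iff hq.1).1 hqΛ).2⟩)
    (fun q hq hqΛ => hg0 _ ⟨hq.2, ((h.mem_iff hq.1).1 hqΛ).2⟩) q₀ ⟨hqO, hz.1⟩ hqΛ
    (τ, (0, ζ)) (fun w => by
      obtain ⟨t, s, w⟩ := w
      rw [fderiv_comp_snd_snd (hf' z hz.1)]
      change _ = fderiv 𝕜 f z w
      rw [← hham f w, ← hζ]
      have e1 : ((t, (s, w)) : 𝕜 × (𝕜 × StdSpace 𝕜 m)) = (t, (0, w)) + s • (0, (1, 0)) := by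
        simp
      have e2 : ((τ, (0, ζ)) : 𝕜 × (𝕜 × StdSpace 𝕜 m)) = τ • (1, 0) + (0, (0, ζ)) := by
        simp
      have e3 : b q₀ (τ, (0, ζ)) (0, (1, 0)) = 0 := by
        rw [e2, map_add, map_smul, add_apply, smul_apply, h.contraction q₀ hqO]
        simp [τ]
      rw [e1, map_add, map_smul, e3, h.form_eq q₀ hqO rfl, smul_zero, add_zero])
  rw [fderiv_comp_snd_snd (hg' z hz.1)] at key
  rw [SymplecticForm.poisson_eq, mfderiv_eq_fderiv]
  exact neg_eq_zero.2 key

/-- A differential conormal to `Λ` kills `∂ₜ` and restricts on the slice `t = s = 0` to one conormal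
to the reduced set; conversely `ds` and the pulled-back differentials are conormal to `Λ`. The extra
dimension, that of `ds`, is the drop from `k` to `k - 1`. -/
theorem finrank_conormal (h : IsReductionBox b ρ Λ) :
    Module.finrank 𝕜 (conormal 𝕜 (𝕜 × (𝕜 × StdSpace 𝕜 m)) Λ 0) =
      Module.finrank 𝕜 (conormal 𝕜 (StdSpace 𝕜 m) (reducedSet Λ) 0) + 1 := by
  let S : (𝕜 × (StdSpace 𝕜 m →L[𝕜] 𝕜)) →ₗ[𝕜] (𝕜 × (𝕜 × StdSpace 𝕜 m) →L[𝕜] 𝕜) :=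
    { toFun := fun c => c.1 •
          (ContinuousLinearMap.fst 𝕜 𝕜 (StdSpace 𝕜 m) ∘L ContinuousLinearMap.snd 𝕜 𝕜 _)
          + c.2 ∘L ContinuousLinearMap.snd 𝕜 𝕜 (StdSpace 𝕜 m) ∘L ContinuousLinearMap.snd 𝕜 𝕜 _
      map_add' := fun c d => by
        ext v <;> simp
      map_smul' := fun a c => by
        ext v <;> simp }
  have hSapp (c : 𝕜 × (StdSpace 𝕜 m →L[𝕜] 𝕜)) (v : 𝕜 × (𝕜 × StdSpace 𝕜 m)) :
      S c v = c.1 * v.2.1 + c.2 v.2.2 := rfl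
  have hS : Function.Injective S := by
    intro c d hcd
    have h1 (v : 𝕜 × (𝕜 × StdSpace 𝕜 m)) : S c v = S d v := by rw [hcd]
    simp only [hSapp] at h1
    refine Prod.ext (by simpa using h1 (0, (1, 0))) (ContinuousLinearMap.ext fun z => ?_)
    simpa using h1 (0, (0, z))
  have hO : ∀ᶠ q in 𝓝 (0 : 𝕜 × (𝕜 × StdSpace 𝕜 m)), q ∈ Metric.ball 0 ρ :=
    Metric.ball_mem_nhds 0 h.pos
  have hmap : conormal 𝕜 (𝕜 × (𝕜 × StdSpace 𝕜 m)) Λ 0 =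
      ((⊤ : Submodule 𝕜 𝕜).prod (conormal 𝕜 (StdSpace 𝕜 m) (reducedSet Λ) 0)).map S := by
    apply le_antisymm
    · rintro _ ⟨g, hg, rfl⟩
      have hg1 : ContDiffAt 𝕜 ω g.1 0 := g.2.contDiffAt
      have hg2 : ∀ᶠ q in 𝓝 0, q ∈ Λ → g.1 q = 0 := hg
      have hd : differentialAt 𝕜 (𝕜 × (𝕜 × StdSpace 𝕜 m)) 0 g = fderiv 𝕜 g.1 0 :=
        mfderiv_eq_fderiv
      rw [hd]
      obtain ⟨W, hW, hWo, h0W⟩ := eventually_nhds_iff.1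
        ((hg1.eventually (by simp)).and (hg2.and hO))
      have ht := h.fderiv_eq_zero hWo (fun q hq => (hW q hq).2.2) (fun q hq => (hW q hq).1)
        (fun q hq => (hW q hq).2.1) h0W h.zero_mem
      have hj : HasFDerivAt (fun z : StdSpace 𝕜 m => ((0 : 𝕜), ((0 : 𝕜), z)))
          (ContinuousLinearMap.inr 𝕜 𝕜 (𝕜 × StdSpace 𝕜 m) ∘L
            ContinuousLinearMap.inr 𝕜 𝕜 (StdSpace 𝕜 m)) 0 :=
        (ContinuousLinearMap.inr 𝕜 𝕜 (𝕜 × StdSpace 𝕜 m) ∘L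
            ContinuousLinearMap.inr 𝕜 𝕜 (StdSpace 𝕜 m)).hasFDerivAt
      have hjt : Filter.Tendsto (fun z : StdSpace 𝕜 m => ((0 : 𝕜), ((0 : 𝕜), z))) (𝓝 0) (𝓝 0) :=
        Continuous.tendsto' (by fun_prop) _ _ rfl
      have hgj : HasFDerivAt (fun z => g.1 (0, (0, z))) (fderiv 𝕜 g.1 0 ∘L
          ContinuousLinearMap.inr 𝕜 𝕜 (𝕜 × StdSpace 𝕜 m) ∘L
            ContinuousLinearMap.inr 𝕜 𝕜 (StdSpace 𝕜 m)) 0 :=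
        HasFDerivAt.comp (g := g.1) 0 (hg1.differentiableAt (by simp)).hasFDerivAt hj
      refine ⟨(fderiv 𝕜 g.1 0 (0, (1, 0)), fderiv 𝕜 (fun z => g.1 (0, (0, z))) 0),
        ⟨trivial, fderiv_mem_conormal (ContDiffAt.comp (g := g.1) 0 hg1 (by fun_prop))
          (hjt.eventually hg2)⟩, ?_⟩
      rw [hgj.fderiv]
      refine ContinuousLinearMap.ext fun v => ?_
      obtain ⟨t, s, z⟩ := v
      have e : ((t, (s, z)) : 𝕜 × (𝕜 × StdSpace 𝕜 m))
          = t • (1, 0) + s • (0, (1, 0)) + (0, (0, z)) := by simp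
      rw [hSapp, e, map_add, map_add, map_smul, map_smul, ht]
      simp [mul_comm]
    · rintro _ ⟨⟨c, _⟩, ⟨-, g, hg, rfl⟩, rfl⟩
      have hg1 : ContDiffAt 𝕜 ω g.1 0 := g.2.contDiffAt
      have hg2 : ∀ᶠ z in 𝓝 0, z ∈ reducedSet Λ → g.1 z = 0 := hg
      have hd : differentialAt 𝕜 (StdSpace 𝕜 m) 0 g = fderiv 𝕜 g.1 0 := mfderiv_eq_fderiv
      rw [hd]
      have ht : Filter.Tendsto (fun q : 𝕜 × (𝕜 × StdSpace 𝕜 m) => q.2.2) (𝓝 0) (𝓝 0) :=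
        Continuous.tendsto' (by fun_prop) _ _ rfl
      have h1 := fderiv_mem_conormal (L := Λ) (x := 0)
        (g := fun q : 𝕜 × (𝕜 × StdSpace 𝕜 m) => q.2.1) (by fun_prop)
        (Filter.Eventually.of_forall fun q hq => h.snd_fst_eq_zero q hq)
      have h2 := fderiv_mem_conormal (L := Λ) (x := 0)
        (g := fun q : 𝕜 × (𝕜 × StdSpace 𝕜 m) => g.1 q.2.2)
        (ContDiffAt.comp (g := g.1) 0 hg1 (by fun_prop))
        (((ht.eventually hg2).and hO).mono fun q hq hqΛ => hq.1 ((h.mem_iff hq.2).1 hqΛ).2)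
      rw [fderiv_snd_fst] at h1
      rw [fderiv_comp_snd_snd (q := 0) hg1] at h2
      exact add_mem (Submodule.smul_mem _ c h1) h2
  rw [hmap, finrank_map_top_prod hS]

end IsReductionBox

end ReductionBox

-- From a symplectic manifold to a germ of closed forms

section Bridge

variable {𝕜 : Type*} [RCLike 𝕜]
  {E : Type*} [NormedAddCommGroup E] [NormedSpace 𝕜 E]
  {M : Type*} [TopologicalSpace M] [ChartedSpace E M]

variable (𝕜 E) in
/-- Alternating 2-forms as bilinear forms. -/
def curryForm : (E [⋀^Fin 2]→L[𝕜] 𝕜) →L[𝕜] E →L[𝕜] E →L[𝕜] 𝕜 :=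
  (ContinuousLinearMap.compL 𝕜 E (ContinuousMultilinearMap 𝕜 (fun _ : Fin 1 => E) 𝕜) (E →L[𝕜] 𝕜)
      (continuousMultilinearCurryFin1 𝕜 E 𝕜).toContinuousLinearEquiv.toContinuousLinearMap) ∘L
    (continuousMultilinearCurryLeftEquiv 𝕜
      (fun _ : Fin 2 => E) 𝕜).toContinuousLinearEquiv.toContinuousLinearMap ∘L
    ContinuousAlternatingMap.toContinuousMultilinearMapCLM 𝕜

theorem curryForm_apply (a : E [⋀^Fin 2]→L[𝕜] 𝕜) (u v : E) :
    curryForm 𝕜 E a u v = a ![u, v] := by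
  change a (Fin.cons u (Fin.snoc 0 v)) = _
  congr 1
  funext i
  fin_cases i <;> rfl

/-- The symplectic form in the chart around `p`, as a field of bilinear forms. -/
def localBilin (Ω : SymplecticForm 𝕜 E M) (p : M) : E → E →L[𝕜] E →L[𝕜] 𝕜 :=
  fun y => curryForm 𝕜 E (localForm 𝕜 Ω.form p y)

theorem localBilin_apply (Ω : SymplecticForm 𝕜 E M) (p : M) (y u v : E) :
    localBilin Ω p y u v = Ω.form ((extChartAt 𝓘(𝕜, E) p).symm y)
      ![mfderiv 𝓘(𝕜, E) 𝓘(𝕜, E) (extChartAt 𝓘(𝕜, E) p).symm y u,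
        mfderiv 𝓘(𝕜, E) 𝓘(𝕜, E) (extChartAt 𝓘(𝕜, E) p).symm y v] := by
  rw [localBilin, curryForm_apply]
  change Ω.form _ (_ ∘ _) = _
  congr 1
  funext i
  fin_cases i <;> rfl

/-- On three vectors, `extDeriv` is a sum with alternating signs; swapping the arguments of the form
in the middle term gives the cyclic sum of `IsClosedGerm`. -/
theorem isClosedGerm_localBilin (Ω : SymplecticForm 𝕜 E M) (p : M) :
    IsClosedGerm (localBilin Ω p) (extChartAt 𝓘(𝕜, E) p p) := by
  have hcd (y : E) (hy : y ∈ (extChartAt 𝓘(𝕜, E) p).target) : ContDiffAt 𝕜 ω (localBilin Ω p) y :=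
    ContDiffAt.comp (g := curryForm 𝕜 E) y (by fun_prop)
      (Ω.analytic p y hy).contDiffAt
  have halt (y u : E) : localBilin Ω p y u u = 0 := by
    rw [localBilin, curryForm_apply]
    exact (localForm 𝕜 Ω.form p y).map_eq_zero_of_eq _ (i := 0) (j := 1) rfl (by simp)
  refine ⟨hcd _ (mem_extChartAt_target p), Filter.Eventually.of_forall halt, ?_⟩
  filter_upwards [extChartAt_target_mem_nhds p] with y hy u v w
  have hd (a c d : E) : fderiv 𝕜 (fun x => localForm 𝕜 Ω.form p x ![c, d]) y a
      = fderiv 𝕜 (localBilin Ω p) y a c d := by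
    have h1 := (((hcd y hy).differentiableAt (by simp)).hasFDerivAt.clm_apply
      (hasFDerivAt_const c y)).clm_apply (hasFDerivAt_const d y)
    have h2 : (fun x => localForm 𝕜 Ω.form p x ![c, d]) = fun x => localBilin Ω p x c d := by
      funext x
      rw [localBilin, curryForm_apply]
    rw [h2, h1.fderiv]
    simp
  have hswap : fderiv 𝕜 (localBilin Ω p) y v w u = -fderiv 𝕜 (localBilin Ω p) y v u w := by
    rw [← hd, ← hd]
    have : (fun x => localForm 𝕜 Ω.form p x ![w, u])
        = fun x => -localForm 𝕜 Ω.form p x ![u, w] := by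
      funext x
      rw [← curryForm_apply, ← curryForm_apply]
      exact form_swap_of_alt (halt x) w u
    rw [this, fderiv_fun_neg]
    rfl
  have h0 : extDeriv (localForm 𝕜 Ω.form p) y ![u, v, w] = 0 := by
    rw [Ω.closed p y hy]
    rfl
  rw [extDeriv_apply (Ω.analytic p y hy).differentiableAt, Fin.sum_univ_three] at h0
  have e0 : (0 : Fin 3).removeNth ![u, v, w] = ![v, w] := by
    funext i; fin_cases i <;> rfl
  have e1 : (1 : Fin 3).removeNth ![u, v, w] = ![u, w] := by
    funext i; fin_cases i <;> rfl
  have e2 : (2 : Fin 3).removeNth ![u, v, w] = ![u, v] := by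
    funext i; fin_cases i <;> rfl
  rw [e0, e1, e2] at h0
  simp only [hd] at h0
  rw [hswap]
  simpa [sub_eq_add_neg] using h0

theorem bijective_mfderiv_extChartAt_symm [IsManifold 𝓘(𝕜, E) ω M] {p : M} {y : E}
    (hy : y ∈ (extChartAt 𝓘(𝕜, E) p).target) :
    Function.Bijective (mfderiv 𝓘(𝕜, E) 𝓘(𝕜, E) (extChartAt 𝓘(𝕜, E) p).symm y) := by
  have : IsManifold 𝓘(𝕜, E) 1 M := IsManifold.of_le (n := ω) (by simp)
  have h := isInvertible_mfderivWithin_extChartAt_symm (I := 𝓘(𝕜, E)) (x := p) hy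
  rw [modelWithCornersSelf_coe, Set.range_id, mfderivWithin_univ] at h
  exact h.bijective

theorem isNondegenerateForm_localBilin [IsManifold 𝓘(𝕜, E) ω M] (Ω : SymplecticForm 𝕜 E M)
    (p : M) : IsNondegenerateForm (localBilin Ω p (extChartAt 𝓘(𝕜, E) p p)) := by
  intro u hu
  have hb := bijective_mfderiv_extChartAt_symm (𝕜 := 𝕜) (E := E) (mem_extChartAt_target p)
  have h0 := Ω.nondegenerate _ (mfderiv 𝓘(𝕜, E) 𝓘(𝕜, E) (extChartAt 𝓘(𝕜, E) p).symm
    (extChartAt 𝓘(𝕜, E) p p) u) fun w => by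
      obtain ⟨v, rfl⟩ := hb.2 w
      exact (localBilin_apply Ω p _ u v).symm.trans (hu v)
  exact hb.1 (h0.trans (map_zero _).symm)

/-- Analytic coordinates `(t, s, z)` around a point where `df ≠ 0`, in which `f = s` and the
symplectic form is as in `IsReductionBox`. -/
theorem exists_reductionHomeomorph [FiniteDimensional 𝕜 E] [IsManifold 𝓘(𝕜, E) ω M]
    (Ω : SymplecticForm 𝕜 E M) {m : ℕ} (hdim : Module.finrank 𝕜 E = 2 * (m + 1)) {p : M}
    {f : M → 𝕜} (hf : ContMDiffAt 𝓘(𝕜, E) 𝓘(𝕜, 𝕜) ω f p) (hfp : f p = 0)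
    (hf' : mfderiv 𝓘(𝕜, E) 𝓘(𝕜, 𝕜) f p ≠ 0) :
    ∃ (θ : OpenPartialHomeomorph (𝕜 × (𝕜 × StdSpace 𝕜 m)) M)
      (b : 𝕜 × (𝕜 × StdSpace 𝕜 m) → 𝕜 × (𝕜 × StdSpace 𝕜 m) →L[𝕜]
        𝕜 × (𝕜 × StdSpace 𝕜 m) →L[𝕜] 𝕜),
      0 ∈ θ.source ∧ θ 0 = p ∧
      ContMDiffOn 𝓘(𝕜, 𝕜 × (𝕜 × StdSpace 𝕜 m)) 𝓘(𝕜, E) ω θ θ.source ∧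
      ContMDiffOn 𝓘(𝕜, E) 𝓘(𝕜, 𝕜 × (𝕜 × StdSpace 𝕜 m)) ω θ.symm θ.target ∧
      (∀ q ∈ θ.source, f (θ q) = q.2.1) ∧
      (∀ q ∈ θ.source, ∀ u v, b q u v = Ω.form (θ q)
        ![mfderiv 𝓘(𝕜, 𝕜 × (𝕜 × StdSpace 𝕜 m)) 𝓘(𝕜, E) θ q u,
          mfderiv 𝓘(𝕜, 𝕜 × (𝕜 × StdSpace 𝕜 m)) 𝓘(𝕜, E) θ q v]) ∧
      (∀ q ∈ θ.source, ∀ v, b q (1, 0) v = v.2.1) ∧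
      (∀ q ∈ θ.source, q.2.1 = 0 → ∀ (a c : 𝕜) (u v : StdSpace 𝕜 m),
        b q (a, (0, u)) (c, (0, v)) = stdAlt 𝕜 m ![u, v]) := by
  have : CompleteSpace E := FiniteDimensional.complete 𝕜 E
  let e := extChartAt 𝓘(𝕜, E) p
  have hesymm : ContMDiffOn 𝓘(𝕜, E) 𝓘(𝕜, E) ω e.symm e.target := contMDiffOn_extChartAt_symm p
  have heo : IsOpen e.target := isOpen_extChartAt_target p
  have hep : e.symm (e p) = p := extChartAt_to_inv p
  have hes : ContMDiffAt 𝓘(𝕜, E) 𝓘(𝕜, E) ω e.symm (e p) :=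
    hesymm.contMDiffAt (heo.mem_nhds (mem_extChartAt_target p))
  have hf₁ : ContMDiffAt 𝓘(𝕜, E) 𝓘(𝕜, 𝕜) ω (f ∘ e.symm) (e p) :=
    ContMDiffAt.comp (e p) (by rwa [hep]) hes
  have hf₁' : fderiv 𝕜 (f ∘ e.symm) (e p) ≠ 0 := by
    intro h0
    apply hf'
    rw [← mfderiv_eq_fderiv, mfderiv_comp (I' := 𝓘(𝕜, E)) (e p)
      (by rw [hep]; exact hf.mdifferentiableAt (by simp)) (hes.mdifferentiableAt (by simp))] at h0
    refine ContinuousLinearMap.ext fun w => ?_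
    have h1 : ∀ x, x = p → ∀ w, mfderiv 𝓘(𝕜, E) 𝓘(𝕜, 𝕜) f x w = 0 →
      mfderiv 𝓘(𝕜, E) 𝓘(𝕜, 𝕜) f p w = 0 := by
      rintro x rfl w h
      exact h
    obtain ⟨v, hv⟩ := (bijective_mfderiv_extChartAt_symm (𝕜 := 𝕜) (E := E)
      (mem_extChartAt_target p)).2 w
    refine h1 (e.symm (e p)) hep w ?_
    rw [← hv]
    exact congrArg (fun l => l v) h0
  have hB := isClosedGerm_localBilin Ω p
  obtain ⟨Φ, hΦ⟩ := exists_isReductionChart (darbouxProperty 𝕜 m) hdim hB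
    (isNondegenerateForm_localBilin Ω p) hf₁.contDiffAt
    (show f (e.symm (e p)) = 0 by rw [hep, hfp]) hf₁'
  have hω : (ω : WithTop ℕ∞) ≠ 0 := by simp
  let A : (𝕜 × (𝕜 × StdSpace 𝕜 m)) ≃L[𝕜] E :=
    (LinearEquiv.ofBijective (fderiv 𝕜 Φ 0).toLinearMap hΦ.bijective).toContinuousLinearEquiv
  have hA : HasFDerivAt Φ (A : (𝕜 × (𝕜 × StdSpace 𝕜 m)) →L[𝕜] E) 0 :=
    (hΦ.contDiffAt.differentiableAt (by simp)).hasFDerivAt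
  let T := hΦ.contDiffAt.toOpenPartialHomeomorph Φ hA hω
  have hTinv : ContDiffAt 𝕜 ω T.symm (Φ 0) := hΦ.contDiffAt.to_localInverse hA hω
  have hT0 : (0 : 𝕜 × (𝕜 × StdSpace 𝕜 m)) ∈ T.source :=
    hΦ.contDiffAt.mem_toOpenPartialHomeomorph_source hA hω
  let θ₀ : OpenPartialHomeomorph (𝕜 × (𝕜 × StdSpace 𝕜 m)) M := T ≫ₕ (chartAt E p).symm
  have hpr : Filter.Tendsto (fun q : 𝕜 × (𝕜 × StdSpace 𝕜 m) => (q.1, q.2.2)) (𝓝 0) (𝓝 0) :=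
    Continuous.tendsto' (by fun_prop) _ _ rfl
  -- The chart is shrunk so that the conditions known for germs at the origin hold at every point of
  -- its source.
  obtain ⟨W, hW, hWo, h0W⟩ := eventually_nhds_iff.1
    ((hΦ.contDiffAt.eventually (by simp)).and
      ((hΦ.contDiffAt.continuousAt.eventually (hTinv.eventually (by simp))).and
      (hΦ.eq_snd.and (hΦ.contraction.and (hpr.eventually (hΦ.form_eq hB))))))
  let θ := θ₀.restrOpen W hWo
  have hsrc (q) (hq : q ∈ θ.source) : q ∈ T.source ∧ Φ q ∈ e.target ∧ q ∈ W := by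
    have h1 : (q ∈ T.source ∧ T q ∈ (chartAt E p).target) ∧ q ∈ W := hq
    refine ⟨h1.1.1, ?_, h1.2⟩
    have h2 : Φ q ∈ (chartAt E p).target := h1.1.2
    simpa [e, mfld_simps] using h2
  have hθ : (θ : 𝕜 × (𝕜 × StdSpace 𝕜 m) → M) = e.symm ∘ Φ := rfl
  have hθsymm : (θ.symm : M → 𝕜 × (𝕜 × StdSpace 𝕜 m)) = T.symm ∘ chartAt E p := rfl
  have hΦ' (q) (hq : q ∈ θ.source) := (hW q (hsrc q hq).2.2).1.contMDiffAt
  have hes' (q) (hq : q ∈ θ.source) : ContMDiffAt 𝓘(𝕜, E) 𝓘(𝕜, E) ω e.symm (Φ q) :=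
    hesymm.contMDiffAt (heo.mem_nhds (hsrc q hq).2.1)
  refine ⟨θ, pullbackForm (localBilin Ω p) Φ, ?_, ?_, ?_, ?_, ?_, ?_, ?_, ?_⟩
  · refine ⟨⟨hT0, ?_⟩, h0W⟩
    change Φ 0 ∈ (chartAt E p).target
    rw [hΦ.map_zero]
    simp [mfld_simps]
  · rw [hθ, Function.comp_apply, hΦ.map_zero]
    exact hep
  · intro q hq
    rw [hθ]
    exact (ContMDiffAt.comp q (hes' q hq) (hΦ' q hq)).contMDiffWithinAt
  · intro x hx
    obtain ⟨q, hq, rfl⟩ : ∃ q ∈ θ.source, θ q = x := ⟨θ.symm x, θ.map_target hx, θ.right_inv hx⟩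
    rw [hθsymm]
    have h1 : chartAt E p (θ q) = Φ q := by
      have h2 : (q ∈ T.source ∧ T q ∈ (chartAt E p).target) ∧ q ∈ W := hq
      exact (chartAt E p).right_inv h2.1.2
    have h2 : θ q ∈ (chartAt E p).source := by
      have h2 : (q ∈ T.source ∧ T q ∈ (chartAt E p).target) ∧ q ∈ W := hq
      exact (chartAt E p).map_target h2.1.2
    refine (ContMDiffAt.comp (θ q) (I' := 𝓘(𝕜, E)) ?_ (contMDiffOn_chart.contMDiffAt
      ((chartAt E p).open_source.mem_nhds h2))).contMDiffWithinAt
    rw [h1]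
    exact (hW q (hsrc q hq).2.2).2.1.contMDiffAt
  · intro q hq
    exact (hW q (hsrc q hq).2.2).2.2.1
  · intro q hq u v
    have h1 := mfderiv_comp q ((hes' q hq).mdifferentiableAt (by simp))
      ((hΦ' q hq).mdifferentiableAt (by simp))
    rw [mfderiv_eq_fderiv] at h1
    rw [pullbackForm_apply, localBilin_apply, hθ, h1]
    rfl
  · intro q hq
    exact (hW q (hsrc q hq).2.2).2.2.2.1
  · rintro ⟨t, s, z⟩ hq hs
    dsimp only at hs
    subst hs
    exact (hW _ (hsrc _ hq).2.2).2.2.2.2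

end Bridge

-- Transport along analytic homeomorphisms

section Transport

variable {𝕜 : Type*} [RCLike 𝕜]
  {E : Type*} [NormedAddCommGroup E] [NormedSpace 𝕜 E]
  {F : Type*} [NormedAddCommGroup F] [NormedSpace 𝕜 F]
  {M : Type*} [TopologicalSpace M] [ChartedSpace E M]

/-- `θ` and its inverse are analytic. -/
structure IsAnalyticHomeomorph (θ : OpenPartialHomeomorph F M) : Prop where
  contMDiffOn : ContMDiffOn 𝓘(𝕜, F) 𝓘(𝕜, E) ω θ θ.source
  contMDiffOn_symm : ContMDiffOn 𝓘(𝕜, E) 𝓘(𝕜, F) ω θ.symm θ.target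

namespace IsAnalyticHomeomorph

variable {θ : OpenPartialHomeomorph F M}

theorem contMDiffAt (hθ : IsAnalyticHomeomorph (𝕜 := 𝕜) (E := E) θ) {q : F} (hq : q ∈ θ.source) :
    ContMDiffAt 𝓘(𝕜, F) 𝓘(𝕜, E) ω θ q :=
  hθ.contMDiffOn.contMDiffAt (θ.open_source.mem_nhds hq)

theorem contMDiffAt_symm (hθ : IsAnalyticHomeomorph (𝕜 := 𝕜) (E := E) θ) {x : M}
    (hx : x ∈ θ.target) : ContMDiffAt 𝓘(𝕜, E) 𝓘(𝕜, F) ω θ.symm x :=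
  hθ.contMDiffOn_symm.contMDiffAt (θ.open_target.mem_nhds hx)

theorem bijective_mfderiv [IsManifold 𝓘(𝕜, E) ω M]
    (hθ : IsAnalyticHomeomorph (𝕜 := 𝕜) (E := E) θ) {q : F} (hq : q ∈ θ.source) :
    Function.Bijective (mfderiv 𝓘(𝕜, F) 𝓘(𝕜, E) θ q) := by
  have : IsManifold 𝓘(𝕜, E) 1 M := IsManifold.of_le (n := ω) (by simp)
  have h : θ.MDifferentiable 𝓘(𝕜, F) 𝓘(𝕜, E) :=
    ⟨hθ.contMDiffOn.mdifferentiableOn (by simp), hθ.contMDiffOn_symm.mdifferentiableOn (by simp)⟩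
  exact h.mfderiv_bijective hq

theorem contMDiffAt_comp_symm (hθ : IsAnalyticHomeomorph (𝕜 := 𝕜) (E := E) θ) {q : F}
    (hq : q ∈ θ.source) {g : F → 𝕜} (hg : ContDiffAt 𝕜 ω g q) :
    ContMDiffAt 𝓘(𝕜, E) 𝓘(𝕜, 𝕜) ω (g ∘ θ.symm) (θ q) := by
  refine ContMDiffAt.comp (I' := 𝓘(𝕜, F)) (θ q) ?_ (hθ.contMDiffAt_symm (θ.map_source hq))
  rw [θ.left_inv hq]
  exact hg.contMDiffAt

theorem contDiffAt_comp (hθ : IsAnalyticHomeomorph (𝕜 := 𝕜) (E := E) θ) {q : F}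
    (hq : q ∈ θ.source) {g : M → 𝕜} (hg : ContMDiffAt 𝓘(𝕜, E) 𝓘(𝕜, 𝕜) ω g (θ q)) :
    ContDiffAt 𝕜 ω (g ∘ θ) q :=
  (ContMDiffAt.comp q hg (hθ.contMDiffAt hq)).contDiffAt

theorem fderiv_comp_apply (hθ : IsAnalyticHomeomorph (𝕜 := 𝕜) (E := E) θ) {q : F}
    (hq : q ∈ θ.source) {g : M → 𝕜} (hg : ContMDiffAt 𝓘(𝕜, E) 𝓘(𝕜, 𝕜) ω g (θ q)) (w : F) :
    fderiv 𝕜 (g ∘ θ) q w =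
      mfderiv 𝓘(𝕜, E) 𝓘(𝕜, 𝕜) g (θ q) (mfderiv 𝓘(𝕜, F) 𝓘(𝕜, E) θ q w) := by
  rw [← mfderiv_eq_fderiv, mfderiv_comp q (hg.mdifferentiableAt (by simp))
    ((hθ.contMDiffAt hq).mdifferentiableAt (by simp))]
  rfl

theorem mfderiv_comp_symm_apply (hθ : IsAnalyticHomeomorph (𝕜 := 𝕜) (E := E) θ) {q : F}
    (hq : q ∈ θ.source) {g : F → 𝕜} (hg : ContDiffAt 𝕜 ω g q) (w : F) :
    mfderiv 𝓘(𝕜, E) 𝓘(𝕜, 𝕜) (g ∘ θ.symm) (θ q) (mfderiv 𝓘(𝕜, F) 𝓘(𝕜, E) θ q w)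
      = fderiv 𝕜 g q w := by
  rw [← hθ.fderiv_comp_apply hq (hθ.contMDiffAt_comp_symm hq hg)]
  have : (g ∘ θ.symm) ∘ θ =ᶠ[𝓝 q] g := by
    filter_upwards [θ.open_source.mem_nhds hq] with y hy
    rw [Function.comp_apply, Function.comp_apply, θ.left_inv hy]
  rw [this.fderiv_eq]

/-- Composition with `θ` and with its inverse exchanges the functions vanishing on `L` and on `Λ`,
and the transpose of the invertible derivative of `θ` then matches the conormal spaces. -/
theorem finrank_conormal [IsManifold 𝓘(𝕜, E) ω M]
    (hθ : IsAnalyticHomeomorph (𝕜 := 𝕜) (E := E) θ) {q : F} (hq : q ∈ θ.source) {Λ : Set F}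
    {L : Set M} (hΛ : ∀ᶠ y in 𝓝 q, y ∈ Λ ↔ θ y ∈ L) :
    Module.finrank 𝕜 (conormal 𝕜 F Λ q) = Module.finrank 𝕜 (conormal 𝕜 E L (θ q)) := by
  let A : F →L[𝕜] E := mfderiv 𝓘(𝕜, F) 𝓘(𝕜, E) θ q
  have hA : Function.Surjective A := (hθ.bijective_mfderiv hq).2
  let T : (E →L[𝕜] 𝕜) →ₗ[𝕜] (F →L[𝕜] 𝕜) :=
    { toFun := fun l => l ∘L A
      map_add' := fun _ _ => rfl
      map_smul' := fun _ _ => rfl }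
  have hT : Function.Injective T := by
    intro l l' h
    refine ContinuousLinearMap.ext fun w => ?_
    obtain ⟨v, rfl⟩ := hA w
    exact congrArg (fun l => l v) h
  have hmap : conormal 𝕜 F Λ q = (conormal 𝕜 E L (θ q)).map T := by
    apply le_antisymm
    · rintro _ ⟨g, hg, rfl⟩
      have hg1 : ContDiffAt 𝕜 ω g.1 q := g.2.contDiffAt
      have hg2 : ∀ᶠ y in 𝓝 q, y ∈ Λ → g.1 y = 0 := hg
      refine ⟨_, ⟨⟨g.1 ∘ θ.symm, hθ.contMDiffAt_comp_symm hq hg1⟩, ?_, rfl⟩, ?_⟩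
      · have ht : Filter.Tendsto θ.symm (𝓝 (θ q)) (𝓝 q) := by
          have := (θ.continuousAt_symm (θ.map_source hq)).tendsto
          rwa [θ.left_inv hq] at this
        change ∀ᶠ x in 𝓝 (θ q), x ∈ L → g.1 (θ.symm x) = 0
        filter_upwards [ht.eventually hg2, ht.eventually hΛ,
          θ.open_target.mem_nhds (θ.map_source hq)] with x h1 h2 h3 hx
        refine h1 (h2.2 ?_)
        rwa [θ.right_inv h3]
      · refine ContinuousLinearMap.ext fun w => ?_
        refine (hθ.mfderiv_comp_symm_apply hq hg1 w).trans ?_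
        rw [← mfderiv_eq_fderiv]
        rfl
    · rintro _ ⟨_, ⟨g, hg, rfl⟩, rfl⟩
      have hg2 : ∀ᶠ x in 𝓝 (θ q), x ∈ L → g.1 x = 0 := hg
      have h1 := fderiv_mem_conormal (L := Λ) (hθ.contDiffAt_comp hq g.2)
        (((θ.continuousAt hq).eventually hg2).and hΛ |>.mono fun y hy hyΛ => hy.1 (hy.2.1 hyΛ))
      have h2 : fderiv 𝕜 (g.1 ∘ θ) q = T (differentialAt 𝕜 E (θ q) g) :=
        ContinuousLinearMap.ext fun w => hθ.fderiv_comp_apply hq g.2 w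
      rwa [h2] at h1
  rw [hmap]
  exact (LinearEquiv.finrank_eq (Submodule.equivMapOfInjective T hT _)).symm

end IsAnalyticHomeomorph

end Transport

-- Assembling the product decomposition

section Main

variable {𝕜 : Type*} [RCLike 𝕜]
  {E : Type*} [NormedAddCommGroup E] [NormedSpace 𝕜 E]
  {M : Type*} [TopologicalSpace M] [ChartedSpace E M]

section Box

variable {m : ℕ} {L : Set M} {θ : OpenPartialHomeomorph (𝕜 × (𝕜 × StdSpace 𝕜 m)) M}
  {b : 𝕜 × (𝕜 × StdSpace 𝕜 m) → 𝕜 × (𝕜 × StdSpace 𝕜 m) →L[𝕜]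
    𝕜 × (𝕜 × StdSpace 𝕜 m) →L[𝕜] 𝕜} {ρ : ℝ}

/-- In the coordinates `θ`, the isomorphism is `(t, s, z) ↦ (z, t)`, with inverse inserting `s = 0`;
`mem_iff` says that these match the two sets. -/
theorem IsReductionBox.germIso (hθ : IsAnalyticHomeomorph (𝕜 := 𝕜) (E := E) θ)
    (hsrc : Metric.ball 0 ρ ⊆ θ.source) (h : IsReductionBox b ρ (Metric.ball 0 ρ ∩ θ ⁻¹' L)) :
    GermIso 𝕜 E (StdSpace 𝕜 m × 𝕜) L (θ 0)
      (reducedSet (Metric.ball 0 ρ ∩ θ ⁻¹' L) ×ˢ (Set.univ : Set 𝕜))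
      ((0 : StdSpace 𝕜 m), (0 : 𝕜)) := by
  have h0 : (0 : 𝕜 × (𝕜 × StdSpace 𝕜 m)) ∈ Metric.ball 0 ρ := Metric.mem_ball_self h.pos
  have hj : Filter.Tendsto (fun y : StdSpace 𝕜 m × 𝕜 => (y.2, ((0 : 𝕜), y.1))) (𝓝 0) (𝓝 0) :=
    Continuous.tendsto' (by fun_prop) _ _ rfl
  have ht : Filter.Tendsto θ.symm (𝓝 (θ 0)) (𝓝 0) := by
    have := (θ.continuousAt_symm (θ.map_source (hsrc h0))).tendsto
    rwa [θ.left_inv (hsrc h0)] at this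
  refine ⟨fun x => ((θ.symm x).2.2, (θ.symm x).1), fun y => θ (y.2, (0, y.1)), ?_, ?_, ?_, rfl,
    ?_, ?_⟩
  · have h1 : ContDiffAt 𝕜 ω (fun q : 𝕜 × (𝕜 × StdSpace 𝕜 m) => (q.2.2, q.1)) (θ.symm (θ 0)) := by
      fun_prop
    exact ContMDiffAt.comp (I' := 𝓘(𝕜, 𝕜 × (𝕜 × StdSpace 𝕜 m))) (θ 0) h1.contMDiffAt
      (hθ.contMDiffAt_symm (θ.map_source (hsrc h0)))
  · have h1 : ContDiffAt 𝕜 ω (fun y : StdSpace 𝕜 m × 𝕜 => (y.2, ((0 : 𝕜), y.1))) (0, 0) := by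
      fun_prop
    exact ContMDiffAt.comp (I' := 𝓘(𝕜, 𝕜 × (𝕜 × StdSpace 𝕜 m))) (g := θ) _
      (hθ.contMDiffAt (hsrc h0)) h1.contMDiffAt
  · dsimp only
    rw [θ.left_inv (hsrc h0)]
    rfl
  · filter_upwards [θ.open_target.mem_nhds (θ.map_source (hsrc h0)),
      ht.eventually (Metric.isOpen_ball.eventually_mem h0)] with x hx hxb hxL
    obtain ⟨h1, h2⟩ := (h.mem_iff hxb).1 ⟨hxb, by rwa [Set.mem_preimage, θ.right_inv hx]⟩
    refine ⟨⟨h2, trivial⟩, ?_⟩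
    have h3 : ((θ.symm x).1, ((0 : 𝕜), (θ.symm x).2.2)) = θ.symm x :=
      Prod.ext rfl (Prod.ext h1.symm rfl)
    change θ ((θ.symm x).1, ((0 : 𝕜), (θ.symm x).2.2)) = x
    rw [h3, θ.right_inv hx]
  · filter_upwards [hj.eventually (Metric.isOpen_ball.eventually_mem h0)] with y hy hyL
    refine ⟨((h.mem_iff hy).2 ⟨rfl, hyL.1⟩).2, ?_⟩
    rw [θ.left_inv (hsrc hy)]

/-- A submanifold of the reduced set times the `t`-line is mapped into `L` by `θ`. This bounds the
dimension of the reduced set from above. -/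
theorem IsReductionBox.containsSubmanifold [IsManifold 𝓘(𝕜, E) ω M]
    (hθ : IsAnalyticHomeomorph (𝕜 := 𝕜) (E := E) θ)
    (hsrc : Metric.ball 0 ρ ⊆ θ.source) (h : IsReductionBox b ρ (Metric.ball 0 ρ ∩ θ ⁻¹' L))
    {d : ℕ} (hd : ContainsSubmanifold 𝕜 (StdSpace 𝕜 m)
      (reducedSet (Metric.ball 0 ρ ∩ θ ⁻¹' L)) d) : ContainsSubmanifold 𝕜 E L (d + 1) := by
  obtain ⟨φ, hφ, hinj, hφL⟩ := hd
  have hφ : ContDiffAt 𝕜 ω φ 0 := hφ.contDiffAt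
  rw [mfderiv_eq_fderiv] at hinj
  let π : (Fin (d + 1) → 𝕜) →L[𝕜] (Fin d → 𝕜) :=
    ContinuousLinearMap.pi fun i => ContinuousLinearMap.proj i.succ
  let π₀ : (Fin (d + 1) → 𝕜) →L[𝕜] 𝕜 := ContinuousLinearMap.proj 0
  let χ : (Fin (d + 1) → 𝕜) → 𝕜 × (𝕜 × StdSpace 𝕜 m) := fun y => (π₀ y, (0, φ (π y)))
  have hχ0 : χ 0 = (0, (0, φ 0)) := by simp [χ]
  have hmem := hφL.self_of_nhds
  have hχb : χ 0 ∈ Metric.ball 0 ρ := by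
    rw [hχ0]
    exact h.subset hmem
  have hπ : Filter.Tendsto π (𝓝 0) (𝓝 0) := Continuous.tendsto' (by fun_prop) _ _ (map_zero π)
  have hφπ : ContDiffAt 𝕜 ω (fun y => φ (π y)) 0 :=
    ContDiffAt.comp (g := φ) 0 (by rwa [map_zero]) π.contDiff.contDiffAt
  have hχ : ContDiffAt 𝕜 ω χ 0 := by fun_prop
  have hχd : HasFDerivAt χ (π₀.prod ((0 : (Fin (d + 1) → 𝕜) →L[𝕜] 𝕜).prod (fderiv 𝕜 φ 0 ∘L π)))
      0 := by
    refine HasFDerivAt.prodMk π₀.hasFDerivAt (HasFDerivAt.prodMk (hasFDerivAt_const _ _) ?_)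
    refine HasFDerivAt.comp (g := φ) 0 ?_ π.hasFDerivAt
    rw [map_zero]
    exact (hφ.differentiableAt (by simp)).hasFDerivAt
  refine ⟨fun y => θ (χ y), ?_, ?_, ?_⟩
  · exact ContMDiffAt.comp (I' := 𝓘(𝕜, 𝕜 × (𝕜 × StdSpace 𝕜 m))) (g := θ) 0
      (hθ.contMDiffAt (hsrc hχb)) hχ.contMDiffAt
  · have h1 := mfderiv_comp (I := 𝓘(𝕜, Fin (d + 1) → 𝕜)) (I' := 𝓘(𝕜, 𝕜 × (𝕜 × StdSpace 𝕜 m)))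
      (I'' := 𝓘(𝕜, E)) (g := θ) (f := χ) 0
      ((hθ.contMDiffAt (hsrc hχb)).mdifferentiableAt (by simp))
      (hχ.contMDiffAt.mdifferentiableAt (by simp))
    rw [mfderiv_eq_fderiv (f := χ), hχd.fderiv] at h1
    change Function.Injective (mfderiv 𝓘(𝕜, Fin (d + 1) → 𝕜) 𝓘(𝕜, E) (θ ∘ χ) 0)
    rw [h1]
    refine (hθ.bijective_mfderiv (hsrc hχb)).1.comp ?_
    intro v w hvw
    have h2 : v 0 = w 0 := congrArg Prod.fst hvw
    have h3 : π v = π w := hinj (congrArg (fun q => q.2.2) hvw)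
    funext i
    refine Fin.cases h2 (fun i => ?_) i
    exact congrFun h3 i
  · filter_upwards [hχ.continuousAt.eventually (Metric.isOpen_ball.eventually_mem hχb),
      hπ.eventually hφL] with y h1 h2
    exact ((h.mem_iff h1).2 ⟨rfl, h2⟩).2

end Box

theorem exists_mem_ne_zero_of_finrank_pos {K V : Type*} [Field K] [AddCommGroup V] [Module K V]
    {C : Submodule K V} (hC : 0 < Module.finrank K C) : ∃ v ∈ C, v ≠ 0 := by
  by_contra! h
  rw [(Submodule.eq_bot_iff C).2 h, finrank_bot] at hC
  exact hC.false

variable [FiniteDimensional 𝕜 E] [IsManifold 𝓘(𝕜, E) ω M]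

/-- If some function vanishing on `L` has nonzero differential at `p`, then `L` can be brought
into the form `IsReductionBox` near `p`. -/
theorem exists_isReductionBox (Ω : SymplecticForm 𝕜 E M) {m : ℕ}
    (hdim : Module.finrank 𝕜 E = 2 * (m + 1)) {n : ℕ} {L : Set M}
    (hL : IsLagrangian Ω n Set.univ L) {p : M} (hp : p ∈ L)
    (hc : 0 < Module.finrank 𝕜 (conormal 𝕜 E L p)) :
    ∃ (θ : OpenPartialHomeomorph (𝕜 × (𝕜 × StdSpace 𝕜 m)) M)
      (b : 𝕜 × (𝕜 × StdSpace 𝕜 m) → 𝕜 × (𝕜 × StdSpace 𝕜 m) →L[𝕜]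
        𝕜 × (𝕜 × StdSpace 𝕜 m) →L[𝕜] 𝕜) (ρ : ℝ),
      IsAnalyticHomeomorph (𝕜 := 𝕜) (E := E) θ ∧ θ 0 = p ∧ Metric.ball 0 ρ ⊆ θ.source ∧
      IsReductionBox b ρ (Metric.ball 0 ρ ∩ θ ⁻¹' L) := by
  obtain ⟨_, ⟨f, hfI, rfl⟩, hf'⟩ := exists_mem_ne_zero_of_finrank_pos hc
  have hf2 : ∀ᶠ x in 𝓝 p, x ∈ L → f.1 x = 0 := hfI
  obtain ⟨θ, b, h0, hθ0, hθ1, hθ2, hfθ, hb, hcontr, hform⟩ :=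
    exists_reductionHomeomorph Ω hdim f.2 (hf2.self_of_nhds hp) hf'
  have hθ : IsAnalyticHomeomorph (𝕜 := 𝕜) (E := E) θ := ⟨hθ1, hθ2⟩
  obtain ⟨V, hV, hpV, -, N, h, hh, hLV⟩ := hL.isAnalytic.2 p trivial
  have hθt : Filter.Tendsto θ (𝓝 0) (𝓝 p) := by
    have := (θ.continuousAt h0).tendsto
    rwa [hθ0] at this
  obtain ⟨ρ, hρ, hball⟩ := Metric.eventually_nhds_iff_ball.1
    ((θ.open_source.eventually_mem h0).and ((hθt.eventually hf2).and
      (hθt.eventually (hV.eventually_mem hpV))))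
  have hsrc : Metric.ball 0 ρ ⊆ θ.source := fun q hq => (hball q hq).1
  refine ⟨θ, b, ρ, hθ, hθ0, hsrc, ?_, Set.inter_subset_left, ⟨N, fun i => h i ∘ θ, ?_, ?_⟩,
    ?_, ?_, fun q hq => hcontr q (hsrc hq), fun q hq => hform q (hsrc hq)⟩
  · refine ⟨Metric.mem_ball_self hρ, ?_⟩
    rw [Set.mem_preimage, hθ0]
    exact hp
  · intro i q hq
    exact hθ.contDiffAt_comp (hsrc hq) ((hh i).contMDiffAt (hV.mem_nhds (hball q hq).2.2))
  · intro q hq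
    rw [Set.mem_inter_iff, and_iff_right hq]
    exact hLV _ (hball q hq).2.2
  · rintro q ⟨hq, hqL⟩
    rw [← hfθ q (hsrc hq)]
    exact (hball q hq).2.1 hqL
  · intro W hW hWO g k hg hk hg0 hk0 q hq hqΛ a ha
    have hWs := hWO.trans hsrc
    have hcd {g : 𝕜 × (𝕜 × StdSpace 𝕜 m) → 𝕜} (hg : ∀ q ∈ W, ContDiffAt 𝕜 ω g q) :
        ContMDiffOn 𝓘(𝕜, E) 𝓘(𝕜, 𝕜) ω (g ∘ θ.symm) (θ '' W) := by
      rintro _ ⟨y, hy, rfl⟩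
      exact (hθ.contMDiffAt_comp_symm (hWs hy) (hg y hy)).contMDiffWithinAt
    have hv {g : 𝕜 × (𝕜 × StdSpace 𝕜 m) → 𝕜}
        (hg0 : ∀ q ∈ W, q ∈ Metric.ball 0 ρ ∩ θ ⁻¹' L → g q = 0) :
        ∀ x ∈ θ '' W ∩ L, (g ∘ θ.symm) x = 0 := by
      rintro _ ⟨⟨y, hy, rfl⟩, hyL⟩
      rw [Function.comp_apply, θ.left_inv (hWs hy)]
      exact hg0 y hy ⟨hWO hy, hyL⟩
    have hP := hL.involutive (θ '' W) (θ.isOpen_image_of_subset_source hW hWs)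
      (Set.subset_univ _) _ _ (hcd hg) (hcd hk) (hv hg0) (hv hk0) (θ q) ⟨⟨q, hq, rfl⟩, hqΛ.2⟩
    -- Since `b` is the pullback of `Ω` by `θ`, the derivative of `θ` carries hamiltonian vectors
    -- for `b` to hamiltonian vectors for `Ω`.
    have hH : Ω.hamiltonian (g ∘ θ.symm) (θ q)
        = mfderiv 𝓘(𝕜, 𝕜 × (𝕜 × StdSpace 𝕜 m)) 𝓘(𝕜, E) θ q a := by
      refine Ω.hamiltonian_eq fun w => ?_
      obtain ⟨v, rfl⟩ := (hθ.bijective_mfderiv (hWs hq)).2 w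
      exact (hb q (hWs hq) a v).symm.trans
        ((ha v).trans (hθ.mfderiv_comp_symm_apply (hWs hq) (hg q hq) v).symm)
    rw [Ω.poisson_eq, hH] at hP
    exact (hθ.mfderiv_comp_symm_apply (hWs hq) (hk q hq) a).symm.trans (neg_eq_zero.1 hP)

theorem exists_germIso_prod (Ω : SymplecticForm 𝕜 E M) (m : ℕ)
    (hdim : Module.finrank 𝕜 E = 2 * (m + 1)) (L : Set M)
    (hL : IsLagrangian Ω (m + 1) Set.univ L) (k : ℕ) (hk : 0 < k) (p : M)
    (hp : p ∈ stratum 𝕜 E (m + 1) L k) :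
    ∃ (U' : Set (StdSpace 𝕜 m)) (L' : Set (StdSpace 𝕜 m)) (p' : StdSpace 𝕜 m),
      IsOpen U' ∧ p' ∈ U' ∧ IsLagrangian (stdForm 𝕜 m) m U' L' ∧
      GermIso 𝕜 E (StdSpace 𝕜 m × 𝕜) L p (L' ×ˢ (Set.univ : Set 𝕜)) (p', (0 : 𝕜)) ∧
      p' ∈ stratum 𝕜 (StdSpace 𝕜 m) m L' (k - 1) := by
  have h1 := edim_add_finrank_conormal (𝕜 := 𝕜) (E := E) hp.1
  have h2 := hp.2
  obtain ⟨θ, b, ρ, hθ, rfl, hsrc, h⟩ :=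
    exists_isReductionBox Ω hdim hL hp.1 (p := p) (by omega)
  set Λ := Metric.ball 0 ρ ∩ θ ⁻¹' L with hΛ
  have h0 : (0 : 𝕜 × (𝕜 × StdSpace 𝕜 m)) ∈ Metric.ball 0 ρ := Metric.mem_ball_self h.pos
  have h3 := hθ.finrank_conormal (hsrc h0) (Λ := Λ) (L := L) (by
    filter_upwards [Metric.isOpen_ball.eventually_mem h0] with q hq
    exact ⟨fun hq => hq.2, fun hqL => ⟨hq, hqL⟩⟩)
  rw [h.finrank_conormal] at h3
  have hmem : (0 : StdSpace 𝕜 m) ∈ reducedSet Λ := h.zero_mem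
  have h4 := edim_add_finrank_conormal (𝕜 := 𝕜) (E := StdSpace 𝕜 m) hmem
  rw [finrank_stdSpace] at h4
  have hinv : ∀ V : Set (StdSpace 𝕜 m), IsOpen V → V ⊆ Metric.ball 0 ρ → _ :=
    fun V hV _ => h.involutive_reducedSet V hV
  have hup : (m : ℕ) ∈ upperBounds {d | ContainsSubmanifold 𝕜 (StdSpace 𝕜 m) (reducedSet Λ) d} :=
    fun d hd => Nat.succ_le_succ_iff.1 (hL.hasDimension.2 (h.containsSubmanifold hθ hsrc hd))
  -- Involutivity provides a submanifold of dimension at least `m`, and with the upper bound the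
  -- dimension is exactly `m`.
  obtain ⟨d, hd, hdL⟩ := exists_containsSubmanifold_of_involutive (stdForm 𝕜 m)
    Metric.isOpen_ball h.isAnalyticSubset ⟨0, hmem⟩ hinv
  have hdm : d = m := by
    have := hup hdL
    rw [finrank_stdSpace] at hd
    omega
  subst hdm
  refine ⟨Metric.ball 0 ρ, reducedSet Λ, 0, Metric.isOpen_ball, Metric.mem_ball_self h.pos,
    ⟨h.isAnalyticSubset, ⟨hdL, hup⟩, hinv⟩, h.germIso hθ hsrc, hmem, ?_⟩
  -- The conormal dimension is `k` for `L` at `θ 0`, hence `k - 1` for the reduced set at `0`.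
  omega

end Main

end LagrangianGerm

end

theorem mainTheorem10 {𝕜 : Type*} [RCLike 𝕜]
    {E : Type*} [NormedAddCommGroup E] [NormedSpace 𝕜 E] [FiniteDimensional 𝕜 E]
    {M : Type*} [TopologicalSpace M] [ChartedSpace E M] [IsManifold 𝓘(𝕜, E) ω M]
    (n : ℕ) (hdim : Module.finrank 𝕜 E = 2 * n)
    (Ω : LagrangianGerm.SymplecticForm 𝕜 E M)
    (L : Set M) (hL : LagrangianGerm.IsLagrangian Ω n Set.univ L)
    (k : ℕ) (hk : 0 < k) (p : M) (hp : p ∈ LagrangianGerm.stratum 𝕜 E n L k) :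
    ∃ (U' : Set (LagrangianGerm.StdSpace 𝕜 (n - 1)))
      (L' : Set (LagrangianGerm.StdSpace 𝕜 (n - 1)))
      (p' : LagrangianGerm.StdSpace 𝕜 (n - 1)),
      IsOpen U' ∧ p' ∈ U' ∧
      LagrangianGerm.IsLagrangian (LagrangianGerm.stdForm 𝕜 (n - 1)) (n - 1) U' L' ∧
      LagrangianGerm.GermIso 𝕜 E (LagrangianGerm.StdSpace 𝕜 (n - 1) × 𝕜)
        L p (L' ×ˢ (Set.univ : Set 𝕜)) (p', (0 : 𝕜)) ∧
      p' ∈ LagrangianGerm.stratum 𝕜 (LagrangianGerm.StdSpace 𝕜 (n - 1)) (n - 1) L' (k - 1) := by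
  -- `n = 0` is impossible, because `edim + k = 2n` with `k > 0`; so the subtraction `n - 1` is a
  -- true one.
  obtain ⟨m, rfl⟩ : ∃ m, n = m + 1 := Nat.exists_eq_succ_of_ne_zero (by
    have := hp.2
    omega)
  exact LagrangianGerm.exists_germIso_prod Ω m hdim L hL k hk p hp
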